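/- Let $0<R<1$ and write $A(a,b)=\{z\in\mathbb C: a<|z|<b\}$. Let $\rho(w)=\rho(|w|)$ be a regular radial metric on $\Omega^*=A(R,1)$: it is smooth and positive on $A(R,1)$, has bounded Gauss curvature $-\Delta\log\rho/\rho^2$ and finite area $\mathcal A(\rho)=\int_{\Omega^*}\rho^2$, and $\inf_{R<s<1}s\rho(s)=\lim_{s\to R+}s\rho(s)$; by $\rho(R)$ and $\rho(1)$ we denote its boundary values, so that $\rho$ is continuous on $\overline{\Omega^*}$. Put $$\gamma_\diamond=-R^2\rho^2(R),\qquad \tau_\diamond=\int_R^1\frac{\rho(y)\,dy}{\sqrt{y^2\rho^2(y)-R^2\rho^2(R)}}\in(0,\infty].$$ Let $\gamma\in\mathbb R$ be such that $y^2+\gamma/\rho^2(y)\ge 0$ for $R\le y\le 1$ and $\int_R^1 \frac{dy}{\sqrt{y^2+\gamma/\rho^2(y)}}<\infty$ (with $1/0=\infty$). Put $$q(s)=\exp\left(\int_1^s\frac{dy}{\sqrt{y^2+\gamma/\rho^2(y)}}\right)\ (R\le s\le 1),\qquad r=q(R)\in(0,1),\qquad f^\gamma(se^{it})=q^{-1}(s)e^{it},$$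 and $\Omega=A(r,1)$, so that $\operatorname{Mod}\Omega=\log(1/r)$. Definitions. The energy of a $W^{1,2}_{loc}$ map $h:\Omega\to\overline{\Omega^*}$ is $\mathcal E^\rho[h]=\int_\Omega\rho^2(h)\,(|h_x|^2+|h_y|^2)$. For $a\in\Omega^*$, $\mathrm{dist}_\rho(a,\partial\Omega^*)$ is the infimum of $\int_c\rho\,|dw|$ over rectifiable Jordan arcs $c$ joining $a$ within $\Omega^*$ to a point of $\partial\Omega^*$; it is $0$ for $a\in\partial\Omega^*$. A deformation is a $W^{1,2}_{loc}$ map $h:\Omega\to\overline{\Omega^*}$ of finite energy with Jacobian $J_h\ge0$ a.e. and $\int_\Omega\rho^2(h)J_h\le\mathcal A(\rho)$, for which there are sense-preserving diffeomorphisms $h_j$ of $\Omega$ onto $\Omega^*$ such that $h_j\to h$ uniformly on compact subsets of $\Omega$ and $\mathrm{dist}_\rho(h_j(\cdot),\partial\Omega^*)\to\mathrm{dist}_\rho(h(\cdot),\partial\Omega^*)$ uniformly on $\Omega$. A minimizer is a deformation of least energy among all deformations. A $C^2$ map $f:\Omega\to\Omega^*$ is $\rho$-harmonic if $f_{z\bar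 z}+(\log\rho^2)_w\circ f\; f_zf_{\bar z}=0$. A homeomorphism $f$ of $\Omega$ onto $\Omega^*$ of class $W^{1,2}_{loc}$ is $K$-quasiconformal ($K\ge 1$) if $(|f_z|+|f_{\bar z}|)^2\le K(|f_z|^2-|f_{\bar z}|^2)$ a.e.; it is quasiconformal if it is $K$-quasiconformal for some $K$, and the least such $K$ is its constant of quasiconformality $K_f$. Then the following hold. 1. $f^\gamma:\Omega\to\Omega^*$ is $\rho$-harmonic. 2. $f^\gamma$ is a quasiconformal minimizer (a minimizer that is quasiconformal) if and only if $\gamma>\gamma_\diamond=-R^2\rho^2(R)$, and $\gamma>\gamma_\diamond$ if and only if $\operatorname{Mod}A(r,1)<\tau_\diamond$. 3. If $\gamma=\gamma_\diamond$, then $f^\gamma$ is a minimizer and is $\rho$-harmonic, but it is not quasiconformal. 4. If $\gamma>\gamma_\diamond$, then the constant of quasiconformality of $f^\gamma$ is $$K_{f^\gamma}=\max\left\{\sqrt{\frac{\gamma_\diamond-\gamma}{\gamma_\diamond}},\ \sqrt{\frac{\gamma_\diamond}{\gamma_\diamond-\gamma}}\right\}.$$ -/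

import Mathlib

open Set Filter Topology MeasureTheory
open scoped ENNReal ContDiff

noncomputable section

namespace RadialNitsche

/-- The circular annulus `A(a,b) = {a < |z| < b}`. -/
def annulus (a b : ℝ) : Set ℂ := {z | a < ‖z‖ ∧ ‖z‖ < b}

/-- The conformal modulus `log (1/r)` of the circular annulus `A(r,1)`, `0 < r < 1`. -/
def modAnnulus (r : ℝ) : ℝ := Real.log (1 / r)

/-! ### Conformal metrics `m(w) |dw|` -/

/-- The Gauss curvature `- Δ log m / m²` of the metric `m(w) |dw|`. -/
def gaussCurvature (m : ℂ → ℝ) (w : ℂ) : ℝ :=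
  -(Laplacian.laplacian (fun z => Real.log (m z)) w) / m w ^ 2

/-- The area of `Ω` in the metric `m`. -/
def area (m : ℂ → ℝ) (Ω : Set ℂ) : ℝ≥0∞ := ∫⁻ w in Ω, ENNReal.ofReal (m w ^ 2)

/-- Allowable metrics: smooth, nonvanishing, of bounded Gauss curvature and of finite area. -/
structure IsAllowable (Ω : Set ℂ) (m : ℂ → ℝ) : Prop where
  pos : ∀ w ∈ Ω, 0 < m w
  smooth : ContDiffOn ℝ ∞ m Ω
  curvature : ∃ κ : ℝ, ∀ w ∈ Ω, |gaussCurvature m w| ≤ κ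
  finite_area : area m Ω < ⊤

/-- The radial metric with profile `ρ`. -/
def radial (ρ : ℝ → ℝ) : ℂ → ℝ := fun w => ρ ‖w‖

/-- Regular radial metrics on `A(R,1)`: allowable, with `inf_{R<s<1} s ρ(s) = lim_{s → R+} s ρ(s)`.
The field `boundary` says that `ρ R` and `ρ 1` denote the boundary values of the metric. (These
limits exist automatically: the first by `isGLB`, the second since curvature and area are
bounded. So the field only fixes the meaning of `ρ R` and `ρ 1`.) -/
structure IsRegular (R : ℝ) (ρ : ℝ → ℝ) : Prop where
  allowable : IsAllowable (annulus R 1) (radial ρ)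
  boundary : ContinuousOn ρ (Icc R 1)
  isGLB : IsGLB ((fun s => s * ρ s) '' Ioo R 1) (R * ρ R)

/-! ### Wirtinger derivatives and harmonic maps -/

/-- `∂f/∂z`. -/
def dz (f : ℂ → ℂ) (z : ℂ) : ℂ := (fderiv ℝ f z 1 - Complex.I * fderiv ℝ f z Complex.I) / 2

/-- `∂f/∂z̄`. -/
def dzbar (f : ℂ → ℂ) (z : ℂ) : ℂ := (fderiv ℝ f z 1 + Complex.I * fderiv ℝ f z Complex.I) / 2

/-- `f : Ω → Ω'` is `m`-harmonic: it is `C²` and `f_{z z̄} + (log m²)_w ∘ f · f_z f_{z̄} = 0`. -/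
structure IsHarmonic (Ω Ω' : Set ℂ) (m : ℂ → ℝ) (f : ℂ → ℂ) : Prop where
  mapsTo : MapsTo f Ω Ω'
  contDiffOn : ContDiffOn ℝ 2 f Ω
  eq_zero : ∀ z ∈ Ω, dzbar (dz f) z +
    dz (fun w => ((Real.log (m w ^ 2) : ℝ) : ℂ)) (f z) * dz f z * dzbar f z = 0

/-! ### Sobolev maps and the energy -/

/-- `h` is of class `W^{1,2}_loc` on the open set `Ω`, with weak differential `D`. -/
structure HasWeakDiff (Ω : Set ℂ) (h : ℂ → ℂ) (D : ℂ → ℂ →L[ℝ] ℂ) : Prop where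
  memLp : ∀ K ⊆ Ω, IsCompact K → MemLp h 2 (volume.restrict K)
  memLp_diff : ∀ K ⊆ Ω, IsCompact K → MemLp D 2 (volume.restrict K)
  integral_eq : ∀ φ : ℂ → ℝ, ContDiff ℝ ∞ φ → HasCompactSupport φ → tsupport φ ⊆ Ω →
    ∀ v : ℂ, ∫ z in Ω, (fderiv ℝ φ z v) • h z = - ∫ z in Ω, φ z • D z v

/-- The square of the Hilbert-Schmidt norm. -/
def hsSq (T : ℂ →L[ℝ] ℂ) : ℝ := ‖T 1‖ ^ 2 + ‖T Complex.I‖ ^ 2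

/-- The Dirichlet energy `∫_Ω m(h)² |Dh|²` of a `W^{1,2}_loc` map into `(Ω', m)`, where `|Dh|` is
the Hilbert-Schmidt norm of the weak differential. The weak differential is unique up to a null
set, so that all terms of the infimum coincide; the value is `⊤` if `h` is not `W^{1,2}_loc`. -/
def energy (Ω : Set ℂ) (m : ℂ → ℝ) (h : ℂ → ℂ) : ℝ≥0∞ :=
  ⨅ (D : ℂ → ℂ →L[ℝ] ℂ) (_ : HasWeakDiff Ω h D),
    ∫⁻ z in Ω, ENNReal.ofReal (m (h z) ^ 2 * hsSq (D z))

/-! ### Deformations -/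

/-- Sense-preserving diffeomorphisms of `Ω` onto `Ω'`. -/
structure IsDiffeo (Ω Ω' : Set ℂ) (h : ℂ → ℂ) : Prop where
  bijOn : BijOn h Ω Ω'
  smooth : ContDiffOn ℝ ∞ h Ω
  jacobian_pos : ∀ z ∈ Ω, 0 < (fderiv ℝ h z).det

/-- `c` parametrizes a rectifiable Jordan arc that joins `a` to `b` within `Ω'`, apart from the
endpoint `b`. (Every rectifiable arc has a Lipschitz parametrization.) -/
structure IsArc (Ω' : Set ℂ) (a b : ℂ) (c : ℝ → ℂ) : Prop where
  lipschitz : ∃ L, LipschitzOnWith L c (Icc 0 1)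
  injOn : InjOn c (Icc 0 1)
  source : c 0 = a
  target : c 1 = b
  mem : ∀ t ∈ Ico (0 : ℝ) 1, c t ∈ Ω'

/-- `dist_m(a,b)` for `a ∈ Ω'` and `b ∈ ∂Ω'`: the infimum of the lengths `∫_c m(w) |dw|` of arcs;
`⊤` if there are none. -/
def arcDist (Ω' : Set ℂ) (m : ℂ → ℝ) (a b : ℂ) : ℝ≥0∞ :=
  ⨅ (c : ℝ → ℂ) (_ : IsArc Ω' a b c),
    ∫⁻ t in Ioo (0 : ℝ) 1, ENNReal.ofReal (m (c t) * ‖deriv c t‖)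

open Classical in
/-- The distance to the boundary of `Ω'`, zero at points of the boundary. -/
def boundaryDist (Ω' : Set ℂ) (m : ℂ → ℝ) (a : ℂ) : ℝ≥0∞ :=
  if a ∈ Ω' then ⨅ b ∈ frontier Ω', arcDist Ω' m a b else 0

/-- `cδ`-uniform convergence of `h_j` to `h`: uniform on compact subsets of `Ω`, and with boundary
distances `δ_{h_j}` converging to `δ_h` uniformly on `Ω` (on `∂Ω` all of them are zero). -/
structure CDeltaTendsto (Ω Ω' : Set ℂ) (m : ℂ → ℝ) (hj : ℕ → ℂ → ℂ) (h : ℂ → ℂ) : Prop where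
  compact : ∀ K ⊆ Ω, IsCompact K → TendstoUniformlyOn hj h atTop K
  boundary : ∀ ε : ℝ≥0∞, 0 < ε → ∀ᶠ j in atTop, ∀ z ∈ Ω,
    boundaryDist Ω' m (hj j z) ≤ boundaryDist Ω' m (h z) + ε ∧
    boundaryDist Ω' m (h z) ≤ boundaryDist Ω' m (hj j z) + ε

/-- Deformations `h : Ω → closure Ω'`. The metric `m` is also evaluated on `∂Ω'`. -/
structure IsDeformation (Ω Ω' : Set ℂ) (m : ℂ → ℝ) (h : ℂ → ℂ) : Prop where
  mapsTo : MapsTo h Ω (closure Ω')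
  energy_lt_top : energy Ω m h < ⊤
  jacobian : ∃ D, HasWeakDiff Ω h D ∧
    (∀ᵐ z ∂(volume.restrict Ω), 0 ≤ (D z).det) ∧
    ∫⁻ z in Ω, ENNReal.ofReal (m (h z) ^ 2 * (D z).det) ≤ area m Ω'
  approx : ∃ hj : ℕ → ℂ → ℂ, (∀ j, IsDiffeo Ω Ω' (hj j)) ∧ CDeltaTendsto Ω Ω' m hj h

/-- Energy-minimal deformations. -/
def IsMinimizer (Ω Ω' : Set ℂ) (m : ℂ → ℝ) (h : ℂ → ℂ) : Prop :=
  IsDeformation Ω Ω' m h ∧ ∀ g, IsDeformation Ω Ω' m g → energy Ω m h ≤ energy Ω m g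

/-! ### Quasiconformal maps -/

/-- `f` is a `K`-quasiconformal map of `Ω` onto `Ω'`: a homeomorphism of class `W^{1,2}_loc` with
`|Df|² ≤ K J_f` a.e., where `|Df| = |f_z| + |f_z̄|` is the operator norm. In other words
`(|f_z| + |f_z̄|) / (|f_z| - |f_z̄|) ≤ K`. (The inequality forces `J_f ≥ 0`, so that `f` preserves
the orientation.) -/
structure IsQCWith (K : ℝ) (Ω Ω' : Set ℂ) (f : ℂ → ℂ) : Prop where
  one_le : 1 ≤ K
  image_eq : f '' Ω = Ω'
  isEmbedding : IsEmbedding (Ω.domRestrict f)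
  distortion : ∃ D, HasWeakDiff Ω f D ∧
    ∀ᵐ z ∂(volume.restrict Ω), ‖D z‖ ^ 2 ≤ K * (D z).det

/-- Quasiconformal maps of `Ω` onto `Ω'`. -/
def IsQC (Ω Ω' : Set ℂ) (f : ℂ → ℂ) : Prop := ∃ K, IsQCWith K Ω Ω' f

/-! ### The radial harmonic maps -/

/-- `∫_s^1 dy / √(y² + γ / ρ(y)²)`, as an integral of a function with values in `[0,∞]`. -/
def qIntegral (ρ : ℝ → ℝ) (γ s : ℝ) : ℝ≥0∞ :=
  ∫⁻ y in Ioo s 1, (ENNReal.ofReal (√(y ^ 2 + γ * (1 / ρ y) ^ 2)))⁻¹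

/-- `q(s) = exp (∫_1^s dy / √(y² + γ / ρ(y)²))`, for `s ≤ 1`. -/
def qFun (ρ : ℝ → ℝ) (γ s : ℝ) : ℝ := Real.exp (-(qIntegral ρ γ s).toReal)

/-- `p = q⁻¹`, the inverse of `q : [R,1] → [q(R),1]`. -/
def pFun (R : ℝ) (ρ : ℝ → ℝ) (γ : ℝ) : ℝ → ℝ := Function.invFunOn (qFun ρ γ) (Icc R 1)

/-- The radial map `s e^{it} ↦ p(s) e^{it}`. -/
def nitscheMap (R : ℝ) (ρ : ℝ → ℝ) (γ : ℝ) (z : ℂ) : ℂ := (pFun R ρ γ ‖z‖ : ℂ) * (z / (‖z‖ : ℂ))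

/-- The critical parameter `γ_⋄ = -R² ρ(R)²`. -/
def gammaCrit (R : ℝ) (ρ : ℝ → ℝ) : ℝ := -(R ^ 2 * ρ R ^ 2)

/-- The critical modulus `τ_⋄ = ∫_R^1 ρ(y) dy / √(y² ρ(y)² - R² ρ(R)²) ∈ (0,∞]`. -/
def tauCrit (R : ℝ) (ρ : ℝ → ℝ) : ℝ≥0∞ :=
  ∫⁻ y in Ioo R 1,
    ENNReal.ofReal (ρ y) / ENNReal.ofReal (√(y ^ 2 * ρ y ^ 2 - R ^ 2 * ρ R ^ 2))

end RadialNitsche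

end

open RadialNitsche

open scoped ComplexConjugate

noncomputable section

namespace RadialNitsche

/-! Write F(t) = √(t² + γ/ρ(t)²) (`speed`) and p = q⁻¹. Then ρ²F² = t²ρ² + γ and s p'(s) = F(p(s)).
With t = p(|z|), the radial map stretches by F(t)/|z| in the radial direction and by t/|z| in the
tangential one. Harmonicity follows by differentiating F² = t² + γ/ρ² (`isHarmonic_nitscheMap`).

Minimality is proved with free Lagrangians. For a competitor g let N, N' be the derivatives of |g|
along z and iz, and T, T' those of arg g multiplied by |g|. Then |z|² times the energy density is
ρ²(N² + T² + N'² + T'²). Completing squares bounds this from below by a combination of ψ(|g|)(NT' -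
TN'), ψ(|g|)N, T'/|g| and constants (`lagrangian_le_of_nonneg`, `lagrangian_le_of_nonpos`). The sign
of γ decides whether N or T'/|g| is used, so that the squares have nonnegative coefficients. These
expressions come from the closed form d arg and from exact forms in |g|, so by Stokes their
integrals depend only on the winding of g and on which boundary component goes where. The radial map
gives equality, so the bound is its energy (`exists_bound`, `energy_nitscheMap_le`).

The work lies in the integrals, because a deformation is only weakly differentiable and has no
boundary values. Cutoffs make ψ vanish near R and 1. Since ρ lies between positive constants, the
uniform convergence of boundary distances forces |g| to be near R or near 1 on circles close to the
boundary, and g is uniformly close to a diffeomorphism on the annulus between them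
(`CDeltaTendsto.exists_diffeo`). The winding ±2π of that diffeomorphism is found by computing one
area integral in two ways: by change of variables and by Stokes (`IsDiffeo.winding_eq`). Stokes is
applied to mollifications of g, with differentials converging in L², and the identities pass to the
limit (`HasWeakDiff.hasIdentities`). Sense-preserving maps may interchange the boundary components;
the sign σ keeps track of this. Letting the cutoffs tend to 1 gives `nitscheEnergy_le_energy`.

The distortion is governed by (F/t)² = 1 + γ/(tρ(t))². As tρ(t) is smallest at R, the worst ratio is
approached at the inner boundary, where it degenerates exactly for γ = γ_⋄ (`isLeast_isQCWith`,
`not_isQC_nitscheMap`). The modulus is the integral of ρ/√(t²ρ² + γ), whose integrand strictly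
decreases in γ (`gammaCrit_lt_iff`).

Two facts about the data come first: ρ(R) > 0, because bounded curvature bounds log ρ, and F > 0
inside (R,1), because an interior zero would make 1/F nonintegrable. -/

/-! ### Radial functions -/

/-- The differential of the norm at a point of the punctured plane. -/
def normDiff (z : ℂ) : ℂ →L[ℝ] ℝ := ‖z‖⁻¹ • innerSL ℝ z

lemma normDiff_apply (z v : ℂ) : normDiff z v = (z.re * v.re + z.im * v.im) / ‖z‖ := by
  simp [normDiff, Complex.inner]; ring

lemma hasFDerivAt_norm {z : ℂ} (hz : z ≠ 0) : HasFDerivAt (fun w : ℂ => ‖w‖) (normDiff z) z := by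
  have h1 : HasFDerivAt (fun w : ℂ => ‖w‖ ^ 2) (2 • innerSL ℝ z) z :=
    (hasStrictFDerivAt_norm_sq z).hasFDerivAt
  have h2 := h1.sqrt (pow_ne_zero 2 (norm_ne_zero_iff.2 hz))
  have e : (fun w : ℂ => √(‖w‖ ^ 2)) = fun w => ‖w‖ := by
    ext w; exact Real.sqrt_sq (norm_nonneg w)
  rw [e] at h2
  refine h2.congr_fderiv (ContinuousLinearMap.ext fun v => ?_)
  rw [normDiff_apply]
  simp [Real.sqrt_sq, Complex.inner]
  have := norm_ne_zero_iff.2 hz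
  field_simp

lemma hasFDerivAt_comp_norm {u : ℝ → ℝ} {u' : ℝ} {z : ℂ} (hz : z ≠ 0) (hu : HasDerivAt u u' ‖z‖) :
    HasFDerivAt (fun w : ℂ => u ‖w‖) (u' • normDiff z) z :=
  hu.comp_hasFDerivAt z (hasFDerivAt_norm hz)

/-- This turns the curvature bound into a statement about an ordinary differential operator. By
symmetry the positive real axis suffices; there the direction 1 is radial and `I` is tangential. -/
lemma laplacian_comp_norm {a b : ℝ} (ha : 0 ≤ a) {u : ℝ → ℝ} (hu : ContDiffOn ℝ ∞ u (Ioo a b))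
    {s : ℝ} (hs : s ∈ Ioo a b) :
    Laplacian.laplacian (fun z : ℂ => u ‖z‖) (s : ℂ) = deriv (deriv u) s + deriv u s / s := by
  have hs0 : 0 < s := ha.trans_lt hs.1
  have hopen : IsOpen (annulus a b) :=
    (isOpen_lt continuous_const continuous_norm).inter (isOpen_lt continuous_norm continuous_const)
  have hsm : (s : ℂ) ∈ annulus a b := by simpa [annulus, abs_of_pos hs0] using hs
  have hnorm : ‖(s : ℂ)‖ = s := by simp [abs_of_pos hs0]
  have hne : ∀ z ∈ annulus a b, z ≠ 0 := fun z hz => norm_pos_iff.1 (ha.trans_lt hz.1)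
  have hder : ∀ t ∈ Ioo a b, HasDerivAt u (deriv u t) t := fun t ht =>
    ((hu.contDiffAt (isOpen_Ioo.mem_nhds ht)).differentiableAt (by simp)).hasDerivAt
  have hC : ContDiffOn ℝ 2 (fun z : ℂ => u ‖z‖) (annulus a b) := by
    refine (hu.of_le ENat.LEInfty.out).comp (t := Ioo a b) ?_ (fun z hz => hz)
    exact fun z hz => (contDiffAt_norm ℝ (hne z hz)).contDiffWithinAt
  have hCA : ContDiffAt ℝ 2 (fun z : ℂ => u ‖z‖) (s : ℂ) := hC.contDiffAt (hopen.mem_nhds hsm)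
  have hdd : DifferentiableAt ℝ (fderiv ℝ (fun z : ℂ => u ‖z‖)) (s : ℂ) :=
    (hCA.fderiv_right (m := 1) (by norm_num)).differentiableAt (by simp)
  have hfd : ∀ z ∈ annulus a b, fderiv ℝ (fun z : ℂ => u ‖z‖) z = deriv u ‖z‖ • normDiff z :=
    fun z hz => (hasFDerivAt_comp_norm (hne z hz) (hder _ hz)).fderiv
  have key : ∀ e : ℂ, iteratedFDeriv ℝ 2 (fun z : ℂ => u ‖z‖) (s : ℂ) ![e, e] =
      fderiv ℝ (fun z : ℂ => deriv u ‖z‖ * ((z.re * e.re + z.im * e.im) / ‖z‖)) (s : ℂ) e := by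
    intro e
    rw [iteratedFDeriv_two_apply]
    simp only [Matrix.cons_val_zero, Matrix.cons_val_one]
    have h1 : fderiv ℝ (fun z => fderiv ℝ (fun z : ℂ => u ‖z‖) z e) (s : ℂ) =
        fderiv ℝ (fun z : ℂ => deriv u ‖z‖ * ((z.re * e.re + z.im * e.im) / ‖z‖)) (s : ℂ) := by
      apply Filter.EventuallyEq.fderiv_eq
      filter_upwards [hopen.mem_nhds hsm] with z hz
      rw [hfd z hz]
      simp [normDiff_apply]
    rw [← h1, fderiv_clm_apply hdd (differentiableAt_const e)]
    simp
  have hd2 : HasDerivAt (deriv u) (deriv (deriv u) s) s := by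
    have := hu.deriv_of_isOpen (m := ∞) isOpen_Ioo le_rfl
    exact ((this.contDiffAt (isOpen_Ioo.mem_nhds hs)).differentiableAt (by simp)).hasDerivAt
  have hd2' : HasFDerivAt (fun z : ℂ => deriv u ‖z‖) (deriv (deriv u) s • normDiff s) (s : ℂ) :=
    hasFDerivAt_comp_norm (hne _ hsm) (by rwa [hnorm])
  have hq : ∀ e : ℂ, HasFDerivAt (fun z : ℂ => (z.re * e.re + z.im * e.im))
      (e.re • Complex.reCLM + e.im • Complex.imCLM) (s : ℂ) := by
    intro e
    convert (e.re • Complex.reCLM + e.im • Complex.imCLM).hasFDerivAt using 2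
    simp; ring
  have hinv : HasFDerivAt (fun z : ℂ => (‖z‖)⁻¹) ((-(s ^ 2)⁻¹) • normDiff s) (s : ℂ) := by
    have h0 : HasDerivAt (fun t : ℝ => t⁻¹) (-(s ^ 2)⁻¹) ‖(s : ℂ)‖ := by
      rw [hnorm]; exact hasDerivAt_inv hs0.ne'
    exact h0.comp_hasFDerivAt (s : ℂ) (hasFDerivAt_norm (hne _ hsm))
  -- Product rule for u'(|z|) · ⟨z,e⟩ · |z|⁻¹. The direction e = 1 will contribute u'' and e = i
  -- will contribute u'/s.
  have key2 : ∀ e : ℂ, iteratedFDeriv ℝ 2 (fun z : ℂ => u ‖z‖) (s : ℂ) ![e, e] =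
      deriv u s * (s * e.re * (-(s ^ 2)⁻¹ * e.re) + s⁻¹ * (e.re * e.re + e.im * e.im)) +
      s * e.re * s⁻¹ * (deriv (deriv u) s * e.re) := by
    intro e
    have h3 : fderiv ℝ (fun z : ℂ => deriv u ‖z‖ * ((z.re * e.re + z.im * e.im) / ‖z‖)) (s : ℂ) = _ :=
      (hd2'.mul ((hq e).mul hinv)).fderiv
    rw [key e, h3]
    simp [normDiff_apply, abs_of_pos hs0]
    field_simp
  rw [InnerProductSpace.laplacian_eq_iteratedFDeriv_complexPlane]
  simp only [key2]
  simp
  field_simp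
  ring

/-! ### The profile of a regular metric -/

lemma ofReal_mem_annulus {a b s : ℝ} (ha : 0 ≤ a) (hs : s ∈ Ioo a b) : (s : ℂ) ∈ annulus a b := by
  simpa [annulus, abs_of_pos (ha.trans_lt hs.1)] using hs

lemma IsRegular.contDiffOn {R : ℝ} {ρ : ℝ → ℝ} (hR0 : 0 < R) (hρ : IsRegular R ρ) :
    ContDiffOn ℝ ∞ ρ (Ioo R 1) := by
  have h := hρ.allowable.smooth.comp (s := Ioo R 1) (g := radial ρ)
    (Complex.ofRealCLM.contDiff.contDiffOn) (fun s hs => ofReal_mem_annulus hR0.le hs)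
  refine h.congr fun s hs => ?_
  simp [radial, abs_of_pos (hR0.trans hs.1)]

lemma IsRegular.pos {R : ℝ} {ρ : ℝ → ℝ} (hR0 : 0 < R) (hρ : IsRegular R ρ) {s : ℝ}
    (hs : s ∈ Ioo R 1) : 0 < ρ s := by
  simpa [radial, abs_of_pos (hR0.trans hs.1)] using
    hρ.allowable.pos s (ofReal_mem_annulus hR0.le hs)

/-- A function on `(a,b)`, `0 < a`, whose radial Laplacian is bounded, is bounded. -/
lemma exists_bound_of_radial_laplacian {a b C : ℝ} (ha : 0 < a) {v : ℝ → ℝ}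
    (hv : ContDiffOn ℝ ∞ v (Ioo a b))
    (hC : ∀ s ∈ Ioo a b, |deriv (deriv v) s + deriv v s / s| ≤ C) :
    ∃ B, ∀ s ∈ Ioo a b, |v s| ≤ B := by
  rcases le_or_gt b a with hab | hab
  · exact ⟨0, fun s hs => absurd (hs.1.trans hs.2) hab.not_gt⟩
  obtain ⟨s₀, hs₀⟩ : (Ioo a b).Nonempty := nonempty_Ioo.2 hab
  have hC0 : 0 ≤ C := (abs_nonneg _).trans (hC s₀ hs₀)
  have hd1 : ∀ s ∈ Ioo a b, HasDerivAt v (deriv v s) s := fun s hs =>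
    ((hv.contDiffAt (isOpen_Ioo.mem_nhds hs)).differentiableAt (by simp)).hasDerivAt
  have hv' := hv.deriv_of_isOpen (m := ∞) isOpen_Ioo le_rfl
  have hd2 : ∀ s ∈ Ioo a b, HasDerivAt (deriv v) (deriv (deriv v) s) s := fun s hs =>
    ((hv'.contDiffAt (isOpen_Ioo.mem_nhds hs)).differentiableAt (by simp)).hasDerivAt
  -- The radial Laplacian is (s v')'/s. Hence s v' has bounded derivative and is bounded; dividing
  -- by s ≥ a bounds v', and a second mean value estimate bounds v.
  have hdw : ∀ s ∈ Ioo a b, HasDerivAt (fun s => s * deriv v s)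
      (s * (deriv (deriv v) s + deriv v s / s)) s := by
    intro s hs
    have hs0 : s ≠ 0 := (ha.trans hs.1).ne'
    refine ((hasDerivAt_id s).mul (hd2 s hs)).congr_deriv ?_
    simp only [id]
    field_simp
    ring
  have hw : ∀ s ∈ Ioo a b, |s * deriv v s| ≤ |s₀ * deriv v s₀| + b * C * (b - a) := by
    intro s hs
    have h := (convex_Ioo a b).norm_image_sub_le_of_norm_hasDerivWithin_le (C := b * C)
      (fun x hx => (hdw x hx).hasDerivWithinAt) (fun x hx => ?_) hs₀ hs
    · have h1 : |s - s₀| ≤ b - a := by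
        rw [abs_le]; constructor <;> linarith [hs.1, hs.2, hs₀.1, hs₀.2]
      have h2 : b * C * |s - s₀| ≤ b * C * (b - a) :=
        mul_le_mul_of_nonneg_left h1 (mul_nonneg (ha.trans hab).le hC0)
      simp only [Real.norm_eq_abs] at h
      have h3 := abs_sub_abs_le_abs_sub (s * deriv v s) (s₀ * deriv v s₀)
      linarith
    · rw [Real.norm_eq_abs, abs_mul, abs_of_pos (ha.trans hx.1)]
      exact mul_le_mul hx.2.le (hC x hx) (abs_nonneg _) (ha.trans hab).le
  set B := |s₀ * deriv v s₀| + b * C * (b - a)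
  have hB : 0 ≤ B := (abs_nonneg _).trans (hw s₀ hs₀)
  refine ⟨|v s₀| + B / a * (b - a), fun s hs => ?_⟩
  have h := (convex_Ioo a b).norm_image_sub_le_of_norm_hasDerivWithin_le (C := B / a)
      (fun x hx => (hd1 x hx).hasDerivWithinAt) (fun x hx => ?_) hs₀ hs
  · have h1 : |s - s₀| ≤ b - a := by
      rw [abs_le]; constructor <;> linarith [hs.1, hs.2, hs₀.1, hs₀.2]
    have h2 : B / a * |s - s₀| ≤ B / a * (b - a) := mul_le_mul_of_nonneg_left h1 (by positivity)
    simp only [Real.norm_eq_abs] at h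
    have h3 := abs_sub_abs_le_abs_sub (v s) (v s₀)
    linarith
  · have h1 := hw x hx
    rw [abs_mul, abs_of_pos (ha.trans hx.1)] at h1
    rw [Real.norm_eq_abs, le_div_iff₀ ha]
    nlinarith [abs_nonneg (deriv v x), hx.1]

/-- Continuity makes ρ bounded, so bounded curvature makes Δ log ρ bounded. Therefore log ρ is
bounded below on (R,1), and the boundary value cannot drop to zero. -/
lemma IsRegular.pos_left {R : ℝ} {ρ : ℝ → ℝ} (hR0 : 0 < R) (hR1 : R < 1) (hρ : IsRegular R ρ) :
    0 < ρ R := by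
  have hv : ContDiffOn ℝ ∞ (fun s => Real.log (ρ s)) (Ioo R 1) :=
    (hρ.contDiffOn hR0).log fun s hs => (hρ.pos hR0 hs).ne'
  obtain ⟨κ, hκ⟩ := hρ.allowable.curvature
  obtain ⟨M, hM⟩ := isCompact_Icc.exists_bound_of_continuousOn hρ.boundary
  obtain ⟨B, hB⟩ := exists_bound_of_radial_laplacian (C := κ * M ^ 2) hR0 hv (fun s hs => by
    have h := hκ s (ofReal_mem_annulus hR0.le hs)
    have hρs := hρ.pos hR0 hs
    have hM' := hM s (Ioo_subset_Icc_self hs)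
    have e : gaussCurvature (radial ρ) s =
        -(deriv (deriv fun s => Real.log (ρ s)) s + deriv (fun s => Real.log (ρ s)) s / s) /
          ρ s ^ 2 := by
      rw [gaussCurvature, ← laplacian_comp_norm hR0.le hv hs]
      simp [radial, abs_of_pos (hR0.trans hs.1)]
    rw [e, abs_div, abs_neg, abs_of_pos (by positivity : 0 < ρ s ^ 2),
      div_le_iff₀ (by positivity)] at h
    have hκ0 : 0 ≤ κ := by
      by_contra hn
      have := (abs_nonneg _).trans h
      nlinarith [pow_pos hρs 2]
    rw [Real.norm_eq_abs, abs_of_pos hρs] at hM'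
    refine h.trans (mul_le_mul_of_nonneg_left ?_ hκ0)
    exact pow_le_pow_left₀ hρs.le hM' 2)
  have hlow : ∀ s ∈ Ioo R 1, Real.exp (-B) ≤ ρ s := fun s hs => by
    rw [← Real.exp_log (hρ.pos hR0 hs)]
    exact Real.exp_le_exp.2 (abs_le.1 (hB s hs)).1
  have ht : Tendsto ρ (𝓝[Ioo R 1] R) (𝓝 (ρ R)) :=
    (hρ.boundary R (left_mem_Icc.2 hR1.le)).mono Ioo_subset_Icc_self
  have : (𝓝[Ioo R 1] R).NeBot := left_nhdsWithin_Ioo_neBot hR1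
  exact (Real.exp_pos _).trans_le (ge_of_tendsto ht (eventually_mem_nhdsWithin.mono hlow))

/-! ### Strict positivity of the radicand inside the interval -/

/-- `√(t² + γ / ρ(t)²)` -/
def speed (ρ : ℝ → ℝ) (γ t : ℝ) : ℝ := √(t ^ 2 + γ * (1 / ρ t) ^ 2)

/-- Comparison with 1/|t - y|, which is not integrable across an interior point. -/
lemma lintegral_inv_ofReal_eq_top {a b y : ℝ} (hy : y ∈ Ioo a b) {C : ℝ} {w : ℝ → ℝ}
    (hw : ∀ t ∈ Ioo a b, w t ≤ C * |t - y|) :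
    ∫⁻ t in Ioo a b, (ENNReal.ofReal (w t))⁻¹ = ⊤ := by
  by_contra hne
  have hlt : ∫⁻ t in Ioo a b, (ENNReal.ofReal (w t))⁻¹ < ⊤ := lt_top_iff_ne_top.2 hne
  set C' := max C 1
  have hC' : 0 < C' := lt_max_of_lt_right one_pos
  have hle : ∫⁻ t in Ioo a b, ENNReal.ofReal C'⁻¹ * ‖(t - y)⁻¹‖ₑ ≤
      ∫⁻ t in Ioo a b, (ENNReal.ofReal (w t))⁻¹ := by
    refine setLIntegral_mono' measurableSet_Ioo fun t ht => ?_
    -- At t = y the real inverse is `0⁻¹ = 0`, so the comparison is trivial there.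
    rcases eq_or_ne t y with rfl | hty
    · simp
    have hpos : 0 < |t - y| := abs_pos.2 (sub_ne_zero.2 hty)
    rw [← ofReal_norm, ← ENNReal.ofReal_mul (by positivity), norm_inv, Real.norm_eq_abs,
      ← mul_inv, ENNReal.ofReal_inv_of_pos (by positivity)]
    refine ENNReal.inv_le_inv.2 (ENNReal.ofReal_le_ofReal ((hw t ht).trans ?_))
    exact mul_le_mul_of_nonneg_right (le_max_left _ _) (abs_nonneg _)
  rw [lintegral_const_mul' _ _ ENNReal.ofReal_ne_top] at hle
  have h2 : ∫⁻ t in Ioo a b, ‖(t - y)⁻¹‖ₑ < ⊤ := by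
    have := (hle.trans_lt hlt)
    by_contra h
    rw [not_lt, top_le_iff] at h
    rw [h, ENNReal.mul_top (by simpa using hC')] at this
    exact lt_irrefl _ this
  have hab : a < b := hy.1.trans hy.2
  have h3 : IntervalIntegrable (fun t => (t - y)⁻¹) volume a b := by
    rw [intervalIntegrable_iff_integrableOn_Ioo_of_le hab.le]
    exact ⟨(by fun_prop : Measurable fun t : ℝ => (t - y)⁻¹).aestronglyMeasurable, h2⟩
  rw [intervalIntegrable_sub_inv_iff, uIcc_of_le hab.le] at h3
  rcases h3 with h3 | h3
  · exact hab.ne h3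
  · exact h3 (Ioo_subset_Icc_self hy)

/-- A nonnegative smooth function whose root has an integrable inverse has no zeros. -/
lemma pos_of_lintegral_inv_sqrt {a b : ℝ} {u : ℝ → ℝ} (hu : ContDiffOn ℝ ∞ u (Ioo a b))
    (hu0 : ∀ t ∈ Ioo a b, 0 ≤ u t)
    (hfin : ∫⁻ t in Ioo a b, (ENNReal.ofReal (√(u t)))⁻¹ < ⊤) {y : ℝ} (hy : y ∈ Ioo a b) :
    0 < u y := by
  refine (hu0 y hy).lt_of_ne' fun h0 => ?_
  -- A zero is a minimum, so u'(y) = 0. As u' is Lipschitz near y, u is at most K|x - y|² and its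
  -- root at most √K |x - y|.
  have hmin : IsLocalMin u y := by
    filter_upwards [isOpen_Ioo.mem_nhds hy] with t ht
    rw [h0]; exact hu0 t ht
  have hd := hmin.deriv_eq_zero
  have hu' := (hu.deriv_of_isOpen (m := ∞) isOpen_Ioo le_rfl).contDiffAt (isOpen_Ioo.mem_nhds hy)
  obtain ⟨K, t, ht, hK⟩ := (hu'.of_le (m := 1) ENat.LEInfty.out).exists_lipschitzOnWith
  obtain ⟨ε, hε, hball⟩ := Metric.mem_nhds_iff.1 (inter_mem ht (isOpen_Ioo.mem_nhds hy))
  have hsub : Ioo (y - ε) (y + ε) ⊆ Ioo a b := fun x hx =>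
    (hball (by rwa [Real.ball_eq_Ioo])).2
  have hbd : ∀ x ∈ Ioo (y - ε) (y + ε), √(u x) ≤ √K * |x - y| := by
    intro x hx
    have hseg : ∀ z ∈ uIcc y x, z ∈ Ioo (y - ε) (y + ε) := fun z hz =>
      (ordConnected_Ioo.uIcc_subset (by constructor <;> linarith) hx) hz
    have h := (convex_uIcc y x).norm_image_sub_le_of_norm_hasDerivWithin_le (f := u)
      (f' := deriv u) (C := K * |x - y|) (fun z hz =>
        ((hu.contDiffAt (isOpen_Ioo.mem_nhds (hsub (hseg z hz)))).differentiableAt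
          (by simp)).hasDerivAt.hasDerivWithinAt) (fun z hz => ?_) left_mem_uIcc right_mem_uIcc
    · rw [h0, sub_zero, Real.norm_eq_abs, Real.norm_eq_abs] at h
      have h2 : u x ≤ K * |x - y| ^ 2 := by
        calc u x ≤ |u x| := le_abs_self _
          _ ≤ _ := h
          _ = _ := by ring
      calc √(u x) ≤ √(K * |x - y| ^ 2) := Real.sqrt_le_sqrt h2
        _ = √K * |x - y| := by rw [Real.sqrt_mul K.coe_nonneg, Real.sqrt_sq (abs_nonneg _)]
    · have hz' := hseg z hz
      have h1 := hK.dist_le_mul z (hball (by rwa [Real.ball_eq_Ioo])).1 y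
        (hball (Metric.mem_ball_self hε)).1
      rw [hd, Real.dist_eq, sub_zero, Real.dist_eq] at h1
      refine h1.trans (mul_le_mul_of_nonneg_left ?_ K.2)
      exact abs_sub_left_of_mem_uIcc hz
  have htop := lintegral_inv_ofReal_eq_top (y := y) (by constructor <;> linarith) hbd
  exact absurd (htop ▸ lintegral_mono_set hsub) (not_le.2 hfin)

/-- The properties of `ρ` and `γ` that matter for the radial harmonic maps. -/
structure IsProfile (R : ℝ) (ρ : ℝ → ℝ) (γ : ℝ) : Prop where
  R_pos : 0 < R
  R_lt : R < 1
  cont : ContinuousOn ρ (Icc R 1)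
  smooth : ContDiffOn ℝ ∞ ρ (Ioo R 1)
  pos_left : 0 < ρ R
  lower : ∀ t ∈ Icc R 1, R * ρ R ≤ t * ρ t
  crit_le : gammaCrit R ρ ≤ γ
  interior : ∀ t ∈ Ioo R 1, 0 < t ^ 2 + γ * (1 / ρ t) ^ 2
  fin : qIntegral ρ γ R < ⊤

lemma IsRegular.lower {R : ℝ} {ρ : ℝ → ℝ} (hR1 : R < 1) (hρ : IsRegular R ρ) :
    ∀ t ∈ Icc R 1, R * ρ R ≤ t * ρ t := by
  have h : ∀ t ∈ Ioo R 1, R * ρ R ≤ t * ρ t := fun t ht => hρ.isGLB.1 ⟨t, ht, rfl⟩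
  have hc : ContinuousOn (fun t => t * ρ t) (Icc R 1) := continuousOn_id.mul hρ.boundary
  intro t ht
  have hcl : t ∈ closure (Ioo R 1) := by rwa [closure_Ioo hR1.ne]
  have hne : (𝓝[Ioo R 1] t).NeBot := mem_closure_iff_nhdsWithin_neBot.1 hcl
  exact ge_of_tendsto ((hc t ht).mono Ioo_subset_Icc_self) (eventually_mem_nhdsWithin.mono h)

/-- The radicand condition at y = R gives γ_⋄ ≤ γ. Strictness in the interior comes from the
finiteness of the integral. -/
lemma IsRegular.isProfile {R : ℝ} {ρ : ℝ → ℝ} {γ : ℝ} (hR0 : 0 < R) (hR1 : R < 1)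
    (hρ : IsRegular R ρ) (hγ : ∀ y ∈ Icc R 1, 0 ≤ y ^ 2 + γ * (1 / ρ y) ^ 2)
    (hfin : qIntegral ρ γ R < ⊤) : IsProfile R ρ γ where
  R_pos := hR0
  R_lt := hR1
  cont := hρ.boundary
  smooth := hρ.contDiffOn hR0
  pos_left := hρ.pos_left hR0 hR1
  lower := hρ.lower hR1
  crit_le := by
    have h := hγ R (left_mem_Icc.2 hR1.le)
    have hp := hρ.pos_left hR0 hR1
    rw [gammaCrit]
    have : 0 ≤ (R ^ 2 + γ * (1 / ρ R) ^ 2) * ρ R ^ 2 := by positivity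
    field_simp at this
    linarith
  interior := fun t ht => by
    refine pos_of_lintegral_inv_sqrt (u := fun t => t ^ 2 + γ * (1 / ρ t) ^ 2) ?_
      (fun t ht => hγ t (Ioo_subset_Icc_self ht)) hfin ht
    exact (contDiffOn_id.pow 2).add (contDiffOn_const.mul
      ((contDiffOn_const.div (hρ.contDiffOn hR0) fun s hs => (hρ.pos hR0 hs).ne').pow 2))
  fin := hfin


/-! ### The functions q and p -/

namespace IsProfile

variable {R : ℝ} {ρ : ℝ → ℝ} {γ : ℝ}

lemma pos (H : IsProfile R ρ γ) {t : ℝ} (ht : t ∈ Icc R 1) : 0 < ρ t :=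
  pos_of_mul_pos_right ((mul_pos H.R_pos H.pos_left).trans_le (H.lower t ht))
    (H.R_pos.le.trans ht.1)

/-- `ρ` is bounded from below by `R ρ(R)`. -/
lemma le_apply (H : IsProfile R ρ γ) {t : ℝ} (ht : t ∈ Icc R 1) : R * ρ R ≤ ρ t :=
  (H.lower t ht).trans (mul_le_of_le_one_left (H.pos ht).le ht.2)

lemma exists_le (H : IsProfile R ρ γ) : ∃ M, 0 < M ∧ ∀ t ∈ Icc R 1, ρ t ≤ M := by
  obtain ⟨M, hM⟩ := isCompact_Icc.exists_bound_of_continuousOn H.cont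
  have hl : R ∈ Icc R 1 := left_mem_Icc.2 H.R_lt.le
  refine ⟨M, (H.pos hl).trans_le ((le_abs_self _).trans (hM R hl)), fun t ht =>
    (le_abs_self _).trans (hM t ht)⟩

lemma speed_pos (H : IsProfile R ρ γ) {t : ℝ} (ht : t ∈ Ioo R 1) : 0 < speed ρ γ t :=
  Real.sqrt_pos.2 (H.interior t ht)

lemma sq_mul_nonneg (H : IsProfile R ρ γ) {t : ℝ} (ht : t ∈ Icc R 1) :
    0 ≤ t ^ 2 + γ * (1 / ρ t) ^ 2 := by
  have hp := H.pos ht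
  have h1 := H.lower t ht
  have h2 := H.crit_le
  have h3 : (R * ρ R) ^ 2 ≤ (t * ρ t) ^ 2 :=
    pow_le_pow_left₀ (mul_pos H.R_pos H.pos_left).le h1 2
  rw [gammaCrit] at h2
  have : t ^ 2 + γ * (1 / ρ t) ^ 2 = (t ^ 2 * ρ t ^ 2 + γ) / ρ t ^ 2 := by field_simp
  rw [this]
  exact div_nonneg (by nlinarith) (by positivity)

lemma speed_sq (H : IsProfile R ρ γ) {t : ℝ} (ht : t ∈ Icc R 1) :
    speed ρ γ t ^ 2 = t ^ 2 + γ * (1 / ρ t) ^ 2 :=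
  Real.sq_sqrt (H.sq_mul_nonneg ht)

/-- The algebraic identity behind the Lagrangian estimates, the value of the energy and the
distortion bounds. It holds at the endpoints too, where the speed may vanish. -/
lemma rho_sq_mul_speed_sq (H : IsProfile R ρ γ) {t : ℝ} (ht : t ∈ Icc R 1) :
    ρ t ^ 2 * speed ρ γ t ^ 2 = t ^ 2 * ρ t ^ 2 + γ := by
  rw [H.speed_sq ht]
  have := (H.pos ht).ne'
  field_simp

lemma continuousOn_speed (H : IsProfile R ρ γ) : ContinuousOn (speed ρ γ) (Icc R 1) :=
  ((continuousOn_id.pow 2).add (continuousOn_const.mul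
    ((continuousOn_const.div H.cont fun _ ht => (H.pos ht).ne').pow 2))).sqrt

lemma contDiffOn_speed (H : IsProfile R ρ γ) : ContDiffOn ℝ ∞ (speed ρ γ) (Ioo R 1) :=
  ContDiffOn.sqrt ((contDiffOn_id.pow 2).add (contDiffOn_const.mul
      ((contDiffOn_const.div H.smooth fun _ hs =>
        (H.pos (Ioo_subset_Icc_self hs)).ne').pow 2)))
    fun t ht => (H.interior t ht).ne'

lemma ofReal_inv_speed (H : IsProfile R ρ γ) {t : ℝ} (ht : t ∈ Ioo R 1) :
    (ENNReal.ofReal (√(t ^ 2 + γ * (1 / ρ t) ^ 2)))⁻¹ = ENNReal.ofReal (speed ρ γ t)⁻¹ := by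
  rw [ENNReal.ofReal_inv_of_pos (H.speed_pos ht), speed]

lemma integrableOn_inv_speed (H : IsProfile R ρ γ) :
    IntegrableOn (fun t => (speed ρ γ t)⁻¹) (Ioo R 1) := by
  refine ⟨((H.continuousOn_speed.mono Ioo_subset_Icc_self).inv₀ fun t ht =>
    (H.speed_pos ht).ne').aestronglyMeasurable measurableSet_Ioo, ?_⟩
  refine lt_of_eq_of_lt (setLIntegral_congr_fun measurableSet_Ioo fun t ht => ?_) H.fin
  rw [H.ofReal_inv_speed ht, ← ofReal_norm, Real.norm_of_nonneg (inv_nonneg.2 (H.speed_pos ht).le)]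

lemma intervalIntegrable (H : IsProfile R ρ γ) {a b : ℝ} (ha : a ∈ Icc R 1) (hb : b ∈ Icc R 1) :
    IntervalIntegrable (fun t => (speed ρ γ t)⁻¹) volume a b := by
  have h : IntervalIntegrable (fun t => (speed ρ γ t)⁻¹) volume R 1 :=
    (intervalIntegrable_iff_integrableOn_Ioo_of_le H.R_lt.le).2 H.integrableOn_inv_speed
  refine h.mono_set ?_
  rw [uIcc_of_le H.R_lt.le]
  exact ordConnected_Icc.uIcc_subset ha hb

lemma toReal_qIntegral (H : IsProfile R ρ γ) {s : ℝ} (hs : s ∈ Icc R 1) :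
    (qIntegral ρ γ s).toReal = ∫ t in s..1, (speed ρ γ t)⁻¹ := by
  have hsub : Ioo s 1 ⊆ Ioo R 1 := Ioo_subset_Ioo_left hs.1
  rw [intervalIntegral.integral_of_le hs.2, integral_Ioc_eq_integral_Ioo,
    integral_eq_lintegral_of_nonneg_ae
      ((ae_restrict_iff' measurableSet_Ioo).2 (ae_of_all _ fun t ht =>
        (inv_nonneg.2 (H.speed_pos (hsub ht)).le : 0 ≤ (speed ρ γ t)⁻¹)))
      (H.integrableOn_inv_speed.mono_set hsub).aestronglyMeasurable]
  congr 1
  exact setLIntegral_congr_fun measurableSet_Ioo fun t ht => H.ofReal_inv_speed (hsub ht)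

lemma qFun_eq (H : IsProfile R ρ γ) {s : ℝ} (hs : s ∈ Icc R 1) :
    qFun ρ γ s = Real.exp (-∫ t in s..1, (speed ρ γ t)⁻¹) := by
  rw [qFun, H.toReal_qIntegral hs]

lemma qFun_one : qFun ρ γ 1 = 1 := by simp [qFun, qIntegral]

lemma qFun_pos (s : ℝ) : 0 < qFun ρ γ s := Real.exp_pos _

lemma strictMonoOn_qFun (H : IsProfile R ρ γ) : StrictMonoOn (qFun ρ γ) (Icc R 1) := by
  intro a ha b hb hab
  rw [H.qFun_eq ha, H.qFun_eq hb, Real.exp_lt_exp, neg_lt_neg_iff]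
  have h1 : 1 ∈ Icc R 1 := right_mem_Icc.2 H.R_lt.le
  rw [← intervalIntegral.integral_add_adjacent_intervals (H.intervalIntegrable ha hb)
    (H.intervalIntegrable hb h1)]
  refine lt_add_of_pos_left _ (intervalIntegral.intervalIntegral_pos_of_pos_on
    (H.intervalIntegrable ha hb) (fun t ht => inv_pos.2 (H.speed_pos ?_)) hab)
  exact ⟨ha.1.trans_lt ht.1, ht.2.trans_le hb.2⟩

lemma continuousOn_qFun (H : IsProfile R ρ γ) : ContinuousOn (qFun ρ γ) (Icc R 1) := by
  have h1 : 1 ∈ Icc R 1 := right_mem_Icc.2 H.R_lt.le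
  have hl : R ∈ Icc R 1 := left_mem_Icc.2 H.R_lt.le
  have h : ContinuousOn (fun s => ∫ t in s..1, (speed ρ γ t)⁻¹) (Icc R 1) := by
    have h2 := intervalIntegral.continuousOn_primitive_interval' (H.intervalIntegrable hl h1)
      (right_mem_uIcc)
    rw [uIcc_of_le H.R_lt.le] at h2
    refine h2.neg.congr fun s _ => ?_
    rw [intervalIntegral.integral_symm, Pi.neg_apply]
  exact h.neg.rexp.congr fun s hs => H.qFun_eq hs

lemma hasDerivAt_qFun (H : IsProfile R ρ γ) {s : ℝ} (hs : s ∈ Ioo R 1) :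
    HasDerivAt (qFun ρ γ) (qFun ρ γ s / speed ρ γ s) s := by
  have h1 : 1 ∈ Icc R 1 := right_mem_Icc.2 H.R_lt.le
  have hc : ContinuousOn (fun t => (speed ρ γ t)⁻¹) (Ioo R 1) :=
    (H.continuousOn_speed.mono Ioo_subset_Icc_self).inv₀ fun t ht => (H.speed_pos ht).ne'
  have h2 := intervalIntegral.integral_hasDerivAt_left
    (H.intervalIntegrable (Ioo_subset_Icc_self hs) h1)
    (hc.stronglyMeasurableAtFilter isOpen_Ioo s hs) (hc.continuousAt (isOpen_Ioo.mem_nhds hs))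
  have h3 := h2.neg.exp
  have h4 : (fun s => Real.exp (-∫ t in s..1, (speed ρ γ t)⁻¹)) =ᶠ[𝓝 s] qFun ρ γ := by
    filter_upwards [isOpen_Ioo.mem_nhds hs] with x hx
    rw [H.qFun_eq (Ioo_subset_Icc_self hx)]
  refine (h3.congr_of_eventuallyEq h4.symm).congr_deriv ?_
  rw [Pi.neg_apply, ← H.qFun_eq (Ioo_subset_Icc_self hs)]
  ring

lemma qFun_left_lt_one (H : IsProfile R ρ γ) : qFun ρ γ R < 1 := by
  rw [← qFun_one (ρ := ρ) (γ := γ)]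
  exact H.strictMonoOn_qFun (left_mem_Icc.2 H.R_lt.le) (right_mem_Icc.2 H.R_lt.le) H.R_lt

lemma image_qFun (H : IsProfile R ρ γ) : qFun ρ γ '' Ioo R 1 = Ioo (qFun ρ γ R) 1 := by
  have h := H.continuousOn_qFun.image_Ioo_of_strictMonoOn H.R_lt.le H.strictMonoOn_qFun
  rwa [qFun_one] at h

lemma pFun_qFun (H : IsProfile R ρ γ) {t : ℝ} (ht : t ∈ Icc R 1) : pFun R ρ γ (qFun ρ γ t) = t :=
  H.strictMonoOn_qFun.injOn.leftInvOn_invFunOn ht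

lemma pFun_mem (H : IsProfile R ρ γ) {s : ℝ} (hs : s ∈ Ioo (qFun ρ γ R) 1) :
    pFun R ρ γ s ∈ Ioo R 1 := by
  obtain ⟨t, ht, rfl⟩ := H.image_qFun.symm ▸ hs
  rwa [H.pFun_qFun (Ioo_subset_Icc_self ht)]

lemma qFun_mem (H : IsProfile R ρ γ) {t : ℝ} (ht : t ∈ Ioo R 1) :
    qFun ρ γ t ∈ Ioo (qFun ρ γ R) 1 := H.image_qFun ▸ mem_image_of_mem _ ht

lemma qFun_pFun (H : IsProfile R ρ γ) {s : ℝ} (hs : s ∈ Ioo (qFun ρ γ R) 1) :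
    qFun ρ γ (pFun R ρ γ s) = s := by
  obtain ⟨t, ht, rfl⟩ := H.image_qFun.symm ▸ hs
  rw [H.pFun_qFun (Ioo_subset_Icc_self ht)]

lemma continuousOn_pFun (H : IsProfile R ρ γ) :
    ContinuousOn (pFun R ρ γ) (Ioo (qFun ρ γ R) 1) := by
  have hm : StrictMonoOn (pFun R ρ γ) (Ioo (qFun ρ γ R) 1) := by
    intro a ha b hb hab
    rwa [← H.strictMonoOn_qFun.lt_iff_lt (Ioo_subset_Icc_self (H.pFun_mem ha))
      (Ioo_subset_Icc_self (H.pFun_mem hb)), H.qFun_pFun ha, H.qFun_pFun hb]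
  have him : pFun R ρ γ '' Ioo (qFun ρ γ R) 1 = Ioo R 1 := by
    refine Subset.antisymm (image_subset_iff.2 fun s hs => H.pFun_mem hs) fun t ht => ?_
    exact ⟨_, H.qFun_mem ht, H.pFun_qFun (Ioo_subset_Icc_self ht)⟩
  intro s hs
  refine (hm.continuousAt_of_image_mem_nhds (isOpen_Ioo.mem_nhds hs) ?_).continuousWithinAt
  exact him ▸ isOpen_Ioo.mem_nhds (H.pFun_mem hs)

/-- The differential equation s p' = F(p), from q' = q/F and the inverse function rule. It is the
only property of p's derivative that is used later. -/
lemma hasDerivAt_pFun (H : IsProfile R ρ γ) {s : ℝ} (hs : s ∈ Ioo (qFun ρ γ R) 1) :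
    HasDerivAt (pFun R ρ γ) (speed ρ γ (pFun R ρ γ s) / s) s := by
  have hp := H.pFun_mem hs
  have h := H.hasDerivAt_qFun hp
  rw [H.qFun_pFun hs] at h
  have hs0 : 0 < s := (qFun_pos R).trans hs.1
  have h2 := HasDerivAt.of_local_left_inverse (H.continuousOn_pFun.continuousAt
    (isOpen_Ioo.mem_nhds hs)) h (div_pos hs0 (H.speed_pos hp)).ne'
    (by filter_upwards [isOpen_Ioo.mem_nhds hs] with x hx using H.qFun_pFun hx)
  rwa [inv_div] at h2

/-- Bootstrapping: if p is Cⁿ then p' = F(p)/s is Cⁿ, so p is Cⁿ⁺¹. -/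
lemma contDiffOn_pFun (H : IsProfile R ρ γ) :
    ContDiffOn ℝ ∞ (pFun R ρ γ) (Ioo (qFun ρ γ R) 1) := by
  rw [contDiffOn_infty]
  intro n
  induction n with
  | zero => exact contDiffOn_zero.2 H.continuousOn_pFun
  | succ n ih =>
    rw [Nat.cast_succ]
    refine (contDiffOn_succ_iff_deriv_of_isOpen isOpen_Ioo).2
      ⟨fun s hs => (H.hasDerivAt_pFun hs).differentiableAt.differentiableWithinAt,
        fun h => absurd h (WithTop.natCast_ne_top n), ?_⟩
    have h : ContDiffOn ℝ n (fun s => speed ρ γ (pFun R ρ γ s) / s) (Ioo (qFun ρ γ R) 1) :=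
      ((H.contDiffOn_speed.of_le (by exact_mod_cast le_top)).comp ih
        fun s hs => H.pFun_mem hs).div contDiffOn_id
        fun s hs => ((qFun_pos R).trans hs.1).ne'
    exact h.congr fun s hs => (H.hasDerivAt_pFun hs).deriv

end IsProfile

/-! ### Real linear maps of the plane -/

lemma clm_apply_eq (T : ℂ →L[ℝ] ℂ) (v : ℂ) : T v = v.re * T 1 + v.im * T Complex.I := by
  have h : v = v.re • (1 : ℂ) + v.im • Complex.I := by
    simp
  conv_lhs => rw [h]
  rw [map_add, map_smul, map_smul]
  simp

lemma det_eq (T : ℂ →L[ℝ] ℂ) : T.det = (conj (T 1) * T Complex.I).im := by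
  rw [ContinuousLinearMap.det, ← LinearMap.det_toMatrix Complex.basisOneI, Matrix.det_fin_two]
  simp [LinearMap.toMatrix_apply]
  ring

/-- The vectors e and ie form a rotated and scaled standard frame. With e = z this is the polar
frame of the domain. -/
lemma norm_sq_mul_det (T : ℂ →L[ℝ] ℂ) (e : ℂ) :
    ‖e‖ ^ 2 * T.det = (conj (T e) * T (Complex.I * e)).im := by
  rw [det_eq, clm_apply_eq T e, clm_apply_eq T (Complex.I * e), ← Complex.normSq_eq_norm_sq,
    Complex.normSq_apply]
  simp
  ring

lemma norm_sq_mul_hsSq (T : ℂ →L[ℝ] ℂ) (e : ℂ) :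
    ‖e‖ ^ 2 * hsSq T = ‖T e‖ ^ 2 + ‖T (Complex.I * e)‖ ^ 2 := by
  rw [hsSq, clm_apply_eq T e, clm_apply_eq T (Complex.I * e)]
  simp only [← Complex.normSq_eq_norm_sq, Complex.normSq_apply]
  simp
  ring

/-- The map with `e ↦ A e` and `i e ↦ B i e`, for `|e| = 1`. -/
def radialDiff (e : ℂ) (A B : ℝ) : ℂ →L[ℝ] ℂ :=
  ((A + B) / 2 : ℝ) • ContinuousLinearMap.id ℝ ℂ +
    (((A - B) / 2 : ℝ) * e ^ 2 : ℂ) • (Complex.conjCLE : ℂ →L[ℝ] ℂ)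

lemma radialDiff_apply (e : ℂ) (A B : ℝ) (v : ℂ) :
    radialDiff e A B v = ((A + B) / 2 : ℝ) * v + ((A - B) / 2 : ℝ) * e ^ 2 * conj v := by
  simp [radialDiff]

lemma radialDiff_apply_self {e : ℂ} (he : ‖e‖ = 1) (A B : ℝ) : radialDiff e A B e = A * e := by
  have h : e * conj e = 1 := by rw [Complex.mul_conj, Complex.normSq_eq_norm_sq, he]; simp
  rw [radialDiff_apply]
  push_cast
  linear_combination (A - B) / 2 * e * h

lemma radialDiff_apply_I_mul {e : ℂ} (he : ‖e‖ = 1) (A B : ℝ) :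
    radialDiff e A B (Complex.I * e) = B * (Complex.I * e) := by
  have h : e * conj e = 1 := by rw [Complex.mul_conj, Complex.normSq_eq_norm_sq, he]; simp
  rw [radialDiff_apply]
  simp only [map_mul, Complex.conj_I]
  push_cast
  linear_combination - (A - B) / 2 * Complex.I * e * h

lemma det_radialDiff {e : ℂ} (he : ‖e‖ = 1) (A B : ℝ) : (radialDiff e A B).det = A * B := by
  have h : conj e * e = 1 := by
    rw [mul_comm, Complex.mul_conj, Complex.normSq_eq_norm_sq, he]; simp
  have h1 := norm_sq_mul_det (radialDiff e A B) e
  have h2 : conj (A * e) * (B * (Complex.I * e)) = (A * B : ℝ) * Complex.I := by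
    simp only [map_mul, Complex.conj_ofReal]
    push_cast
    linear_combination A * B * Complex.I * h
  rw [radialDiff_apply_self he, radialDiff_apply_I_mul he, he, one_pow, one_mul, h2] at h1
  simpa using h1

lemma hsSq_radialDiff {e : ℂ} (he : ‖e‖ = 1) (A B : ℝ) :
    hsSq (radialDiff e A B) = A ^ 2 + B ^ 2 := by
  have h1 := norm_sq_mul_hsSq (radialDiff e A B) e
  rw [radialDiff_apply_self he, radialDiff_apply_I_mul he, he] at h1
  simpa [he] using h1

/-- The conformal and the anticonformal part have norms (A+B)/2 and |A-B|/2, whose sum is the larger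
of A and B. -/
lemma norm_radialDiff_le {e : ℂ} (he : ‖e‖ = 1) {A B M : ℝ} (hA : 0 ≤ A) (hB : 0 ≤ B)
    (hAM : A ≤ M) (hBM : B ≤ M) : ‖radialDiff e A B‖ ≤ M := by
  refine ContinuousLinearMap.opNorm_le_bound _ (hA.trans hAM) fun v => ?_
  rw [radialDiff_apply]
  refine (norm_add_le _ _).trans ?_
  simp only [norm_mul, Complex.norm_real, Real.norm_eq_abs, norm_pow, he, RCLike.norm_conj]
  rw [abs_of_nonneg (by linarith)]
  rcases abs_cases ((A - B) / 2) with ⟨h, _⟩ | ⟨h, _⟩ <;> rw [h] <;>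
    nlinarith [norm_nonneg v]

lemma le_norm_radialDiff {e : ℂ} (he : ‖e‖ = 1) (A B : ℝ) :
    A ≤ ‖radialDiff e A B‖ ∧ B ≤ ‖radialDiff e A B‖ := by
  have h1 := (radialDiff e A B).le_opNorm e
  have h2 := (radialDiff e A B).le_opNorm (Complex.I * e)
  rw [radialDiff_apply_self he] at h1
  rw [radialDiff_apply_I_mul he] at h2
  simp only [norm_mul, Complex.norm_real, Real.norm_eq_abs, he, Complex.norm_I, mul_one] at h1 h2
  exact ⟨(le_abs_self A).trans h1, (le_abs_self B).trans h2⟩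

lemma norm_div_norm {z : ℂ} (hz : z ≠ 0) : ‖z / (‖z‖ : ℂ)‖ = 1 := by
  simp [norm_ne_zero_iff.2 hz]

lemma hasFDerivAt_radialMap {p : ℝ → ℝ} {p' : ℝ} {z : ℂ} (hz : z ≠ 0)
    (hp : HasDerivAt p p' ‖z‖) :
    HasFDerivAt (fun w : ℂ => (p ‖w‖ : ℂ) * (w / (‖w‖ : ℂ)))
      (radialDiff (z / (‖z‖ : ℂ)) p' (p ‖z‖ / ‖z‖)) z := by
  have hz' : ‖z‖ ≠ 0 := norm_ne_zero_iff.2 hz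
  have h1 : HasDerivAt (fun s => p s / s) (p' / ‖z‖ - p ‖z‖ / ‖z‖ ^ 2) ‖z‖ := by
    refine (hp.div (hasDerivAt_id _) hz').congr_deriv ?_
    simp only [id]
    field_simp
  have h2 := (Complex.ofRealCLM.hasFDerivAt.comp z (hasFDerivAt_comp_norm hz h1)).mul
    (hasFDerivAt_id z)
  -- Written as (p(|w|)/|w|) · w, the map is a real radial factor times the identity.
  have e : (fun w : ℂ => (p ‖w‖ : ℂ) * (w / (‖w‖ : ℂ))) =
      fun w => ((Complex.ofRealCLM ∘ fun w : ℂ => p ‖w‖ / ‖w‖) w) * w := by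
    ext w; simp; ring
  rw [e]
  refine h2.congr_fderiv (ContinuousLinearMap.ext fun v => ?_)
  rw [radialDiff_apply]
  have h3 : ((normDiff z v : ℝ) : ℂ) = (z * conj v + v * conj z) / (2 * ‖z‖) := by
    rw [normDiff_apply]
    apply Complex.ext
    · simp [← Complex.ofReal_ofNat, ← Complex.ofReal_mul, Complex.div_ofReal_re]
      field_simp
      ring
    · simp [← Complex.ofReal_ofNat, ← Complex.ofReal_mul, Complex.div_ofReal_im]
      ring
  have h4 : z * conj z = (‖z‖ : ℂ) ^ 2 := by
    rw [Complex.mul_conj, Complex.normSq_eq_norm_sq]; simp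
  have h5 : (‖z‖ : ℂ) ≠ 0 := by exact_mod_cast hz'
  simp [h3]
  field_simp
  linear_combination (-(p ‖z‖ : ℂ) * v + p' * ‖z‖ * v) * h4

/-! ### Wirtinger derivatives -/

lemma dz_eq {f : ℂ → ℂ} {L : ℂ →L[ℝ] ℂ} {z : ℂ} (h : HasFDerivAt f L z) :
    dz f z = (L 1 - Complex.I * L Complex.I) / 2 := by rw [dz, h.fderiv]

lemma dzbar_eq {f : ℂ → ℂ} {L : ℂ →L[ℝ] ℂ} {z : ℂ} (h : HasFDerivAt f L z) :
    dzbar f z = (L 1 + Complex.I * L Complex.I) / 2 := by rw [dzbar, h.fderiv]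

/-- The z-derivative of a radial map is again a real radial function, so `dzbar_ofReal_comp_norm`
gives the second derivative in the harmonic map equation. -/
lemma dz_radialMap {p : ℝ → ℝ} {p' : ℝ} {z : ℂ} (hz : z ≠ 0) (hp : HasDerivAt p p' ‖z‖) :
    dz (fun w : ℂ => (p ‖w‖ : ℂ) * (w / (‖w‖ : ℂ))) z = ((p' + p ‖z‖ / ‖z‖) / 2 : ℝ) := by
  rw [dz_eq (hasFDerivAt_radialMap hz hp), radialDiff_apply, radialDiff_apply]
  simp only [map_one, Complex.conj_I]
  push_cast
  linear_combination (-((p' : ℂ) + p ‖z‖ / ‖z‖) / 4 + ((p' : ℂ) - p ‖z‖ / ‖z‖) / 4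
    * (z / (‖z‖ : ℂ)) ^ 2) * Complex.I_sq

lemma dzbar_radialMap {p : ℝ → ℝ} {p' : ℝ} {z : ℂ} (hz : z ≠ 0) (hp : HasDerivAt p p' ‖z‖) :
    dzbar (fun w : ℂ => (p ‖w‖ : ℂ) * (w / (‖w‖ : ℂ))) z =
      ((p' - p ‖z‖ / ‖z‖) / 2 : ℝ) * (z / (‖z‖ : ℂ)) ^ 2 := by
  rw [dzbar_eq (hasFDerivAt_radialMap hz hp), radialDiff_apply, radialDiff_apply]
  simp only [map_one, Complex.conj_I]
  push_cast
  linear_combination (((p' : ℂ) + p ‖z‖ / ‖z‖) / 4 - ((p' : ℂ) - p ‖z‖ / ‖z‖) / 4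
    * (z / (‖z‖ : ℂ)) ^ 2) * Complex.I_sq

lemma hasFDerivAt_ofReal_comp_norm {u : ℝ → ℝ} {u' : ℝ} {z : ℂ} (hz : z ≠ 0)
    (hu : HasDerivAt u u' ‖z‖) :
    HasFDerivAt (fun w : ℂ => (u ‖w‖ : ℂ)) (Complex.ofRealCLM ∘L (u' • normDiff z)) z :=
  Complex.ofRealCLM.hasFDerivAt.comp z (hasFDerivAt_comp_norm hz hu)

lemma dz_ofReal_comp_norm {u : ℝ → ℝ} {u' : ℝ} {z : ℂ} (hz : z ≠ 0) (hu : HasDerivAt u u' ‖z‖) :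
    dz (fun w : ℂ => (u ‖w‖ : ℂ)) z = u' / 2 * conj (z / (‖z‖ : ℂ)) := by
  rw [dz_eq (hasFDerivAt_ofReal_comp_norm hz hu)]
  have h : (conj z : ℂ) = z.re - Complex.I * z.im := by
    apply Complex.ext <;> simp
  simp [normDiff_apply, h]
  ring

lemma dzbar_ofReal_comp_norm {u : ℝ → ℝ} {u' : ℝ} {z : ℂ} (hz : z ≠ 0)
    (hu : HasDerivAt u u' ‖z‖) :
    dzbar (fun w : ℂ => (u ‖w‖ : ℂ)) z = u' / 2 * (z / (‖z‖ : ℂ)) := by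
  rw [dzbar_eq (hasFDerivAt_ofReal_comp_norm hz hu)]
  simp [normDiff_apply]
  linear_combination (u' : ℂ) / (2 * ‖z‖) * Complex.re_add_im z

lemma isOpen_annulus (a b : ℝ) : IsOpen (annulus a b) :=
  (isOpen_lt continuous_const continuous_norm).inter (isOpen_lt continuous_norm continuous_const)

lemma ne_zero_of_mem_annulus {a b : ℝ} (ha : 0 ≤ a) {z : ℂ} (hz : z ∈ annulus a b) : z ≠ 0 :=
  norm_pos_iff.1 (ha.trans_lt hz.1)

/-! ### The radial map: harmonicity, inverse, embedding -/

namespace IsProfile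

variable {R : ℝ} {ρ : ℝ → ℝ} {γ : ℝ}

lemma norm_nitscheMap (H : IsProfile R ρ γ) {z : ℂ} (hz : z ∈ annulus (qFun ρ γ R) 1) :
    ‖nitscheMap R ρ γ z‖ = pFun R ρ γ ‖z‖ := by
  have hz0 := ne_zero_of_mem_annulus (qFun_pos R).le hz
  rw [nitscheMap, norm_mul, norm_div_norm hz0, mul_one, Complex.norm_real, Real.norm_eq_abs,
    abs_of_pos (H.R_pos.trans (H.pFun_mem hz).1)]

lemma mapsTo_nitscheMap (H : IsProfile R ρ γ) :
    MapsTo (nitscheMap R ρ γ) (annulus (qFun ρ γ R) 1) (annulus R 1) := fun z hz => by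
  change R < _ ∧ _ < 1
  rw [H.norm_nitscheMap hz]
  exact H.pFun_mem hz

lemma hasFDerivAt_nitscheMap (H : IsProfile R ρ γ) {z : ℂ} (hz : z ∈ annulus (qFun ρ γ R) 1) :
    HasFDerivAt (nitscheMap R ρ γ) (radialDiff (z / (‖z‖ : ℂ))
      (speed ρ γ (pFun R ρ γ ‖z‖) / ‖z‖) (pFun R ρ γ ‖z‖ / ‖z‖)) z :=
  hasFDerivAt_radialMap (ne_zero_of_mem_annulus (qFun_pos R).le hz) (H.hasDerivAt_pFun hz)

lemma contDiffOn_nitscheMap (H : IsProfile R ρ γ) :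
    ContDiffOn ℝ ∞ (nitscheMap R ρ γ) (annulus (qFun ρ γ R) 1) := by
  have hn : ContDiffOn ℝ ∞ (fun z : ℂ => ‖z‖) (annulus (qFun ρ γ R) 1) := fun z hz =>
    (contDiffAt_norm ℝ (ne_zero_of_mem_annulus (qFun_pos R).le hz)).contDiffWithinAt
  have hi : ContDiffOn ℝ ∞ (fun z : ℂ => ‖z‖⁻¹) (annulus (qFun ρ γ R) 1) :=
    hn.inv fun z hz => norm_ne_zero_iff.2 (ne_zero_of_mem_annulus (qFun_pos R).le hz)
  refine ((Complex.ofRealCLM.contDiff.comp_contDiffOn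
    (H.contDiffOn_pFun.comp hn fun z hz => hz)).mul
    ((Complex.ofRealCLM.contDiff.comp_contDiffOn hi).mul contDiffOn_id)).congr fun z hz => ?_
  simp [nitscheMap]
  left
  ring

/-- With e = z/|z|, the product f_z f_z̄ is (F² - t²)e²/(4s²) = γe²/(4ρ²s²), and (log ρ²)_w is
(ρ'/ρ) times the conjugate of e. The derivative of F² makes f_{zz̄} = -γρ'e/(4ρ³s²), which cancels
their product. -/
lemma isHarmonic_nitscheMap (H : IsProfile R ρ γ) :
    IsHarmonic (annulus (qFun ρ γ R) 1) (annulus R 1) (radial ρ) (nitscheMap R ρ γ) where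
  mapsTo := H.mapsTo_nitscheMap
  contDiffOn := H.contDiffOn_nitscheMap.of_le ENat.LEInfty.out
  eq_zero := fun z hz => by
    have hz0 := ne_zero_of_mem_annulus (qFun_pos R).le hz
    have hnz : ‖z‖ ≠ 0 := norm_ne_zero_iff.2 hz0
    set s := ‖z‖ with hs
    set t := pFun R ρ γ s with ht
    have htm : t ∈ Ioo R 1 := H.pFun_mem hz
    have ht0 : 0 < t := H.R_pos.trans htm.1
    have hρt := H.pos (Ioo_subset_Icc_self htm)
    have hF := H.speed_pos htm
    have hp := H.hasDerivAt_pFun hz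
    have hFd : HasDerivAt (speed ρ γ) (deriv (speed ρ γ) t) t :=
      ((H.contDiffOn_speed.contDiffAt (isOpen_Ioo.mem_nhds htm)).differentiableAt
        (by simp)).hasDerivAt
    have hρd : HasDerivAt ρ (deriv ρ t) t :=
      ((H.smooth.contDiffAt (isOpen_Ioo.mem_nhds htm)).differentiableAt (by simp)).hasDerivAt
    -- Half the derivative of F² = t² + γ/ρ², obtained by uniqueness of derivatives.
    have hFF : speed ρ γ t * deriv (speed ρ γ) t = t - γ * deriv ρ t / ρ t ^ 3 := by
      have h1 := hFd.pow 2
      have h2 : HasDerivAt (fun t => t ^ 2 + γ * (1 / ρ t) ^ 2) _ t :=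
        ((hasDerivAt_id t).pow 2).add ((((hasDerivAt_const t (1 : ℝ)).div hρd hρt.ne').pow 2
          ).const_mul γ)
      have h3 : (speed ρ γ ^ 2) =ᶠ[𝓝 t] fun t => t ^ 2 + γ * (1 / ρ t) ^ 2 := by
        filter_upwards [isOpen_Ioo.mem_nhds htm] with x hx
          using H.speed_sq (Ioo_subset_Icc_self hx)
      have h4 := h1.unique (h2.congr_of_eventuallyEq h3)
      simp only [id, Pi.div_apply] at h4
      field_simp at h4 ⊢
      norm_num at h4
      linear_combination ρ t * h4 - γ * deriv ρ t * inv_mul_cancel₀ hρt.ne'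
    have hFs : speed ρ γ t ^ 2 = t ^ 2 + γ / ρ t ^ 2 := by
      rw [H.speed_sq (Ioo_subset_Icc_self htm)]; field_simp
    -- the `z`-derivative of the map is a radial function
    have hm : HasDerivAt (fun s => (speed ρ γ (pFun R ρ γ s) / s + pFun R ρ γ s / s) / 2)
        (-(γ * deriv ρ t) / (2 * ρ t ^ 3 * s ^ 2)) s := by
      have h1 := ((((hFd.comp s hp).div (hasDerivAt_id s) hnz).add
        (hp.div (hasDerivAt_id s) hnz)).div_const 2)
      refine h1.congr_deriv ?_
      simp only [id, Function.comp, ← ht]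
      have e : -(γ * deriv ρ t) / (2 * ρ t ^ 3 * s ^ 2) =
          (speed ρ γ t * deriv (speed ρ γ) t - t) / (2 * s ^ 2) := by
        rw [hFF]; field_simp; ring
      rw [e]
      field_simp
      ring
    have hdz : dz (nitscheMap R ρ γ) =ᶠ[𝓝 z]
        fun w => (((speed ρ γ (pFun R ρ γ ‖w‖) / ‖w‖ + pFun R ρ γ ‖w‖ / ‖w‖) / 2 : ℝ) : ℂ) := by
      filter_upwards [(isOpen_annulus _ _).mem_nhds hz] with w hw
      exact dz_radialMap (ne_zero_of_mem_annulus (qFun_pos R).le hw) (H.hasDerivAt_pFun hw)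
    have h1 : dzbar (dz (nitscheMap R ρ γ)) z =
        (-(γ * deriv ρ t) / (2 * ρ t ^ 3 * s ^ 2) : ℝ) / 2 * (z / (s : ℂ)) := by
      rw [← dzbar_ofReal_comp_norm hz0 hm]
      simp only [dzbar]
      rw [hdz.fderiv_eq]
    have hw0 := ne_zero_of_mem_annulus H.R_pos.le (H.mapsTo_nitscheMap hz)
    have hlog : HasDerivAt (fun t => Real.log (ρ t ^ 2)) (2 * deriv ρ t / ρ t) t := by
      refine ((hρd.pow 2).log (pow_ne_zero 2 hρt.ne')).congr_deriv ?_
      simp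
      field_simp
    have hnw : ‖nitscheMap R ρ γ z‖ = t := H.norm_nitscheMap hz
    have h2 : dz (fun w => ((Real.log (radial ρ w ^ 2) : ℝ) : ℂ)) (nitscheMap R ρ γ z) =
        (2 * deriv ρ t / ρ t : ℝ) / 2 * conj (z / (s : ℂ)) := by
      have h := dz_ofReal_comp_norm (u := fun t => Real.log (ρ t ^ 2)) hw0 (by rw [hnw]; exact hlog)
      rw [hnw] at h
      have e : nitscheMap R ρ γ z / (t : ℂ) = z / (s : ℂ) := by
        rw [nitscheMap, ← hs, ← ht, mul_div_cancel_left₀]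
        exact_mod_cast ht0.ne'
      rw [e] at h
      exact h
    have h3 : dz (nitscheMap R ρ γ) z = ((speed ρ γ t / s + t / s) / 2 : ℝ) :=
      dz_radialMap hz0 hp
    have h4 : dzbar (nitscheMap R ρ γ) z =
        ((speed ρ γ t / s - t / s) / 2 : ℝ) * (z / (s : ℂ)) ^ 2 := dzbar_radialMap hz0 hp
    rw [h1, h2, h3, h4]
    have he : conj (z / (s : ℂ)) * (z / (s : ℂ)) = 1 := by
      rw [mul_comm, Complex.mul_conj, Complex.normSq_eq_norm_sq, norm_div_norm hz0]; simp
    have key : -(γ * deriv ρ t) / (2 * ρ t ^ 3 * s ^ 2) / 2 + (2 * deriv ρ t / ρ t) / 2 *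
        ((speed ρ γ t / s + t / s) / 2) * ((speed ρ γ t / s - t / s) / 2) = 0 := by
      have e : (2 * deriv ρ t / ρ t) / 2 * ((speed ρ γ t / s + t / s) / 2) *
          ((speed ρ γ t / s - t / s) / 2) =
          deriv ρ t / ρ t * (speed ρ γ t ^ 2 - t ^ 2) / (4 * s ^ 2) := by
        field_simp
        ring
      rw [e, hFs]
      field_simp
      ring
    have key' : ((-(γ * deriv ρ t) / (2 * ρ t ^ 3 * s ^ 2) : ℝ) : ℂ) / 2 +
        ((2 * deriv ρ t / ρ t : ℝ) : ℂ) / 2 * ((speed ρ γ t / s + t / s) / 2 : ℝ) *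
        ((speed ρ γ t / s - t / s) / 2 : ℝ) = 0 := by exact_mod_cast key
    linear_combination (z / (s : ℂ)) * key' + ((2 * deriv ρ t / ρ t : ℝ) : ℂ) / 2 *
      ((speed ρ γ t / s + t / s) / 2 : ℝ) * ((speed ρ γ t / s - t / s) / 2 : ℝ) *
      (z / (s : ℂ)) * he

lemma nitscheMap_radial_inverse (H : IsProfile R ρ γ) {w : ℂ} (hw : w ∈ annulus R 1) :
    (qFun ρ γ ‖w‖ : ℂ) * (w / (‖w‖ : ℂ)) ∈ annulus (qFun ρ γ R) 1 ∧
      nitscheMap R ρ γ ((qFun ρ γ ‖w‖ : ℂ) * (w / (‖w‖ : ℂ))) = w := by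
  have hw0 := ne_zero_of_mem_annulus H.R_pos.le hw
  have hq : 0 < qFun ρ γ ‖w‖ := qFun_pos _
  have hn : ‖(qFun ρ γ ‖w‖ : ℂ) * (w / (‖w‖ : ℂ))‖ = qFun ρ γ ‖w‖ := by
    rw [norm_mul, norm_div_norm hw0, mul_one, Complex.norm_real, Real.norm_eq_abs, abs_of_pos hq]
  refine ⟨?_, ?_⟩
  · change _ < _ ∧ _ < _
    rw [hn]
    exact H.qFun_mem hw
  · rw [nitscheMap, hn, H.pFun_qFun (Ioo_subset_Icc_self hw)]
    have h1 : (‖w‖ : ℂ) ≠ 0 := by simpa using hw0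
    have h2 : (qFun ρ γ ‖w‖ : ℂ) ≠ 0 := by exact_mod_cast hq.ne'
    field_simp

lemma radial_inverse_nitscheMap (H : IsProfile R ρ γ) {z : ℂ}
    (hz : z ∈ annulus (qFun ρ γ R) 1) :
    (qFun ρ γ ‖nitscheMap R ρ γ z‖ : ℂ) * (nitscheMap R ρ γ z / (‖nitscheMap R ρ γ z‖ : ℂ)) = z := by
  have hz0 := ne_zero_of_mem_annulus (qFun_pos R).le hz
  rw [H.norm_nitscheMap hz, H.qFun_pFun hz, nitscheMap]
  have h1 : (‖z‖ : ℂ) ≠ 0 := by simpa using hz0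
  have h2 : (pFun R ρ γ ‖z‖ : ℂ) ≠ 0 := by
    exact_mod_cast (H.R_pos.trans (H.pFun_mem hz).1).ne'
  field_simp

lemma bijOn_nitscheMap (H : IsProfile R ρ γ) :
    BijOn (nitscheMap R ρ γ) (annulus (qFun ρ γ R) 1) (annulus R 1) := by
  refine ⟨H.mapsTo_nitscheMap, fun z hz w hw h => ?_, fun w hw => ?_⟩
  · rw [← H.radial_inverse_nitscheMap hz, ← H.radial_inverse_nitscheMap hw, h]
  · exact ⟨_, H.nitscheMap_radial_inverse hw⟩

lemma isDiffeo_nitscheMap (H : IsProfile R ρ γ) :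
    IsDiffeo (annulus (qFun ρ γ R) 1) (annulus R 1) (nitscheMap R ρ γ) where
  bijOn := H.bijOn_nitscheMap
  smooth := H.contDiffOn_nitscheMap
  jacobian_pos := fun z hz => by
    have hz0 := ne_zero_of_mem_annulus (qFun_pos R).le hz
    have hp := H.pFun_mem hz
    rw [(H.hasFDerivAt_nitscheMap hz).fderiv, det_radialDiff (norm_div_norm hz0)]
    have h1 : 0 < ‖z‖ := norm_pos_iff.2 hz0
    exact mul_pos (div_pos (H.speed_pos hp) h1) (div_pos (H.R_pos.trans hp.1) h1)

lemma isEmbedding_nitscheMap (H : IsProfile R ρ γ) :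
    IsEmbedding ((annulus (qFun ρ γ R) 1).domRestrict (nitscheMap R ρ γ)) := by
  have hc : Continuous ((annulus (qFun ρ γ R) 1).domRestrict (nitscheMap R ρ γ)) :=
    continuousOn_iff_continuous_domRestrict.1 H.contDiffOn_nitscheMap.continuousOn
  have hq : ContinuousOn (fun w : ℂ => (qFun ρ γ ‖w‖ : ℂ) * (w / (‖w‖ : ℂ))) (annulus R 1) := by
    refine (Complex.continuous_ofReal.comp_continuousOn
      (H.continuousOn_qFun.comp continuous_norm.continuousOn
        fun w hw => Ioo_subset_Icc_self hw)).mul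
      (continuousOn_id.div (by fun_prop) fun w hw => ?_)
    simpa using ne_zero_of_mem_annulus H.R_pos.le hw
  rw [isEmbedding_iff, isInducing_iff_nhds]
  refine ⟨fun z => ?_, fun z w h => ?_⟩
  · refine le_antisymm (hc.tendsto z).le_comap ?_
    rw [nhds_subtype_eq_comap, ← map_le_iff_le_comap]
    have h1 : Tendsto (fun w : ℂ => (qFun ρ γ ‖w‖ : ℂ) * (w / (‖w‖ : ℂ)))
        (𝓝 (nitscheMap R ρ γ z)) (𝓝 (z : ℂ)) := by
      have := hq.continuousAt ((isOpen_annulus _ _).mem_nhds (H.mapsTo_nitscheMap z.2))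
      rwa [ContinuousAt, H.radial_inverse_nitscheMap z.2] at this
    refine le_trans (le_of_eq ?_) (h1.comp
      (tendsto_comap (f := (annulus (qFun ρ γ R) 1).domRestrict (nitscheMap R ρ γ))))
    congr 1
    ext x
    exact (H.radial_inverse_nitscheMap x.2).symm
  · exact Subtype.ext (H.bijOn_nitscheMap.injOn z.2 w.2 h)

end IsProfile

/-! ### Weak differentials -/

lemma memLp_of_continuousOn {E : Type*} [NormedAddCommGroup E] [SecondCountableTopology E]
    {K : Set ℂ} (hK : IsCompact K) {f : ℂ → E} (hf : ContinuousOn f K) {p : ℝ≥0∞} :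
    MemLp f p (volume.restrict K) := by
  obtain ⟨C, hC⟩ := hK.exists_bound_of_continuousOn hf
  have : IsFiniteMeasure (volume.restrict K) :=
    ⟨by rw [Measure.restrict_apply_univ]; exact hK.measure_lt_top⟩
  exact MemLp.of_bound (hf.aestronglyMeasurable hK.measurableSet) C
    ((ae_restrict_iff' hK.measurableSet).2 (ae_of_all _ hC))

/-- Integration by parts against a test function. Nothing is known about h outside Ω, but
differentiability is needed only on the support of φ. -/
lemma hasWeakDiff_fderiv {Ω : Set ℂ} (hΩ : IsOpen Ω) {h : ℂ → ℂ} (hh : ContDiffOn ℝ 1 h Ω) :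
    HasWeakDiff Ω h (fderiv ℝ h) where
  memLp := fun K hKΩ hK => memLp_of_continuousOn hK (hh.continuousOn.mono hKΩ)
  memLp_diff := fun K hKΩ hK => memLp_of_continuousOn hK
    ((hh.continuousOn_fderiv_of_isOpen hΩ le_rfl).mono hKΩ)
  integral_eq := fun φ hφ hc hsub v => by
    have hd : ∀ z ∈ Ω, DifferentiableAt ℝ h z := fun z hz =>
      (hh.contDiffAt (hΩ.mem_nhds hz)).differentiableAt (by simp)
    have h0 : ∀ z, z ∉ tsupport φ → φ z = 0 := fun z hz => image_eq_zero_of_notMem_tsupport hz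
    have h0' : ∀ z, z ∉ tsupport φ → fderiv ℝ φ z v = 0 := fun z hz => by
      rw [image_eq_zero_of_notMem_tsupport (fun hz' => hz (tsupport_fderiv_subset ℝ hz'))]; simp
    have key : ∀ F : ℂ → ℂ, ContinuousOn F (tsupport φ) → (∀ z, z ∉ tsupport φ → F z = 0) →
        Integrable F ∧ ∫ z in Ω, F z = ∫ z, F z := by
      intro F hF hF0
      refine ⟨?_, setIntegral_eq_integral_of_forall_compl_eq_zero fun z hz =>
        hF0 z fun hz' => hz (hsub hz')⟩
      exact (integrableOn_iff_integrable_of_support_subset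
        (fun z hz => by_contra fun hz' => hz (hF0 z hz'))).1 (hF.integrableOn_compact hc)
    have hcd : Continuous fun z => fderiv ℝ φ z v :=
      (hφ.continuous_fderiv (by simp)).clm_apply continuous_const
    have k1 := key (fun z => fderiv ℝ φ z v • h z)
      (hcd.continuousOn.smul (hh.continuousOn.mono hsub)) fun z hz => by rw [h0' z hz, zero_smul]
    have k2 := key (fun z => φ z • fderiv ℝ h z v)
      (hφ.continuous.continuousOn.smul
        (((hh.continuousOn_fderiv_of_isOpen hΩ le_rfl).mono hsub).clm_apply continuousOn_const))
      fun z hz => by rw [h0 z hz, zero_smul]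
    have k3 := key (fun z => φ z • h z)
      (hφ.continuous.continuousOn.smul (hh.continuousOn.mono hsub))
      fun z hz => by rw [h0 z hz, zero_smul]
    rw [k1.2, k2.2, integral_smul_fderiv_eq_neg_fderiv_smul_of_integrable k1.1 k2.1 k3.1
      (fun z _ => (hφ.differentiable (by simp)) z) (fun z hz => hd z (hsub hz)), neg_neg]

lemma HasWeakDiff.integrableOn {Ω : Set ℂ} {h : ℂ → ℂ} {D : ℂ → ℂ →L[ℝ] ℂ}
    (hD : HasWeakDiff Ω h D) {K : Set ℂ} (hKΩ : K ⊆ Ω) (hK : IsCompact K) : IntegrableOn D K := by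
  have : IsFiniteMeasure (volume.restrict K) :=
    ⟨by rw [Measure.restrict_apply_univ]; exact hK.measure_lt_top⟩
  exact (hD.memLp_diff K hKΩ hK).integrable one_le_two

/-- The weak differential is unique up to a null set. -/
lemma HasWeakDiff.ae_eq {Ω : Set ℂ} (hΩ : IsOpen Ω) {h : ℂ → ℂ} {D D' : ℂ → ℂ →L[ℝ] ℂ}
    (hD : HasWeakDiff Ω h D) (hD' : HasWeakDiff Ω h D') :
    ∀ᵐ z ∂(volume.restrict Ω), D z = D' z := by
  -- The fundamental lemma of the calculus of variations, one direction at a time; the directions 1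
  -- and `I` then determine the linear map.
  have key : ∀ v : ℂ, ∀ᵐ z, z ∈ Ω → D z v - D' z v = 0 := by
    intro v
    have hev : LocallyIntegrableOn (fun z => D z v - D' z v) Ω := by
      rw [locallyIntegrableOn_iff hΩ.isLocallyClosed]
      intro K hKΩ hK
      exact ((hD.integrableOn hKΩ hK).apply_continuousLinearMap v).sub
        ((hD'.integrableOn hKΩ hK).apply_continuousLinearMap v)
    refine hΩ.ae_eq_zero_of_integral_contDiff_smul_eq_zero hev fun φ hφ hc hsub => ?_
    have hi : ∀ {D : ℂ → ℂ →L[ℝ] ℂ}, HasWeakDiff Ω h D →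
        IntegrableOn (fun z => φ z • D z v) Ω := by
      intro D hD
      have h1 : IntegrableOn (fun z => φ z • D z v) (tsupport φ) :=
        IntegrableOn.continuousOn_smul (μ := volume)
          ((hD.integrableOn hsub hc).apply_continuousLinearMap v) hφ.continuous.continuousOn hc
      refine ((integrableOn_iff_integrable_of_support_subset ?_).1 h1).integrableOn
      intro z hz
      by_contra hz'
      exact hz (by simp [image_eq_zero_of_notMem_tsupport hz'])
    have h1 := (hD.integral_eq φ hφ hc hsub v).symm.trans (hD'.integral_eq φ hφ hc hsub v)
    have h2 : ∫ z, φ z • (D z v - D' z v) = ∫ z in Ω, φ z • (D z v - D' z v) := by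
      refine (setIntegral_eq_integral_of_forall_compl_eq_zero fun z hz => ?_).symm
      rw [image_eq_zero_of_notMem_tsupport fun hz' => hz (hsub hz'), zero_smul]
    rw [h2]
    simp only [smul_sub]
    rw [integral_sub (hi hD) (hi hD'), neg_inj.1 h1, sub_self]
  rw [ae_restrict_iff' hΩ.measurableSet]
  filter_upwards [key 1, key Complex.I] with z h1 h2 hz
  ext v
  rw [clm_apply_eq (D z), clm_apply_eq (D' z), sub_eq_zero.1 (h1 hz), sub_eq_zero.1 (h2 hz)]

/-! ### Mollification -/

section Mollify

variable {E : Type*} [NormedAddCommGroup E] [NormedSpace ℝ E]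

open scoped Convolution
open ContinuousLinearMap (lsmul)

/-- Jensen's inequality, as monotonicity of the L^p norms for the probability measure with density
w. -/
lemma sq_lintegral_mul_le {w f : ℂ → ℝ≥0∞} (hw : Measurable w) (hw1 : ∫⁻ t, w t = 1)
    (hf : AEMeasurable f) : (∫⁻ t, w t * f t) ^ 2 ≤ ∫⁻ t, w t * f t ^ 2 := by
  set ν := volume.withDensity w with hν
  have : IsProbabilityMeasure ν := ⟨by rw [hν, withDensity_apply _ MeasurableSet.univ]; simpa⟩
  have hfν : AEMeasurable f ν := hf.mono_ac (withDensity_absolutelyContinuous _ _)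
  have h1 : ∫⁻ t, f t ∂ν = ∫⁻ t, w t * f t := lintegral_withDensity_eq_lintegral_mul₀ hw.aemeasurable hf
  have h2 : ∫⁻ t, f t ^ 2 ∂ν = ∫⁻ t, w t * f t ^ 2 :=
    lintegral_withDensity_eq_lintegral_mul₀ hw.aemeasurable (hf.pow_const 2)
  rw [← h1, ← h2]
  have h3 := eLpNorm_le_eLpNorm_of_exponent_le (p := 1) (q := 2) one_le_two
    hfν.aestronglyMeasurable
  rw [eLpNorm_one_eq_lintegral_enorm, eLpNorm_eq_lintegral_rpow_enorm_toReal two_ne_zero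
    ENNReal.ofNat_ne_top] at h3
  simp only [enorm_eq_self, ENNReal.toReal_ofNat] at h3
  calc (∫⁻ t, f t ∂ν) ^ 2 ≤ ((∫⁻ t, f t ^ (2 : ℝ) ∂ν) ^ (1 / (2 : ℝ))) ^ 2 :=
        pow_le_pow_left' h3 2
    _ = ∫⁻ t, f t ^ 2 ∂ν := by
      rw [← ENNReal.rpow_natCast, ← ENNReal.rpow_mul]
      norm_num

/-- Jensen in the inner integral, then Tonelli and translation invariance. -/
lemma lintegral_sq_convolution_le (φ : ContDiffBump (0 : ℂ)) {f : ℂ → E}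
    (hf : AEStronglyMeasurable f) :
    ∫⁻ x, ‖(φ.normed volume ⋆[lsmul ℝ ℝ, volume] f) x‖ₑ ^ 2 ≤ ∫⁻ x, ‖f x‖ₑ ^ 2 := by
  set w : ℂ → ℝ≥0∞ := fun t => ‖φ.normed volume t‖ₑ with hwdef
  have hwm : Measurable w := φ.continuous_normed.measurable.enorm
  have hw1 : ∫⁻ t, w t = 1 := by
    have h1 := φ.integral_normed (μ := (volume : Measure ℂ))
    rw [integral_eq_lintegral_of_nonneg_ae (ae_of_all _ φ.nonneg_normed)
      φ.continuous_normed.aestronglyMeasurable] at h1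
    have h2 : ∀ t, w t = ENNReal.ofReal (φ.normed volume t) := fun t => by
      rw [hwdef]; exact (Real.enorm_of_nonneg (φ.nonneg_normed t))
    simp_rw [h2]
    rw [← ENNReal.toReal_eq_one_iff]
    exact h1
  have hsub : ∀ x, AEMeasurable fun t => ‖f (x - t)‖ₑ := fun x =>
    (hf.comp_measurePreserving (volume.measurePreserving_sub_left x)).enorm
  calc ∫⁻ x, ‖(φ.normed volume ⋆[lsmul ℝ ℝ, volume] f) x‖ₑ ^ 2
      ≤ ∫⁻ x, (∫⁻ t, w t * ‖f (x - t)‖ₑ ^ 2) := by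
        refine lintegral_mono fun x => ?_
        refine le_trans (pow_le_pow_left' ?_ 2) (sq_lintegral_mul_le hwm hw1 (hsub x))
        refine (enorm_integral_le_lintegral_enorm _).trans (lintegral_mono fun t => ?_)
        simp [hwdef, enorm_smul]
    _ = ∫⁻ t, (∫⁻ x, w t * ‖f (x - t)‖ₑ ^ 2) := by
        refine lintegral_lintegral_swap ?_
        refine (hwm.comp measurable_snd).aemeasurable.mul ((AEStronglyMeasurable.enorm ?_).pow_const 2)
        exact hf.comp_quasiMeasurePreserving (quasiMeasurePreserving_sub _ _)
    _ = ∫⁻ t, w t * ∫⁻ x, ‖f x‖ₑ ^ 2 := by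
        refine lintegral_congr fun t => ?_
        rw [lintegral_const_mul' _ _ (by simp [hwdef])]
        congr 1
        exact lintegral_sub_right_eq_self (fun x => ‖f x‖ₑ ^ 2) t
    _ = ∫⁻ x, ‖f x‖ₑ ^ 2 := by
        rw [lintegral_mul_const _ hwm, hw1, one_mul]

lemma eLpNorm_convolution_le (φ : ContDiffBump (0 : ℂ)) {f : ℂ → E}
    (hf : AEStronglyMeasurable f) :
    eLpNorm (φ.normed volume ⋆[lsmul ℝ ℝ, volume] f) 2 volume ≤ eLpNorm f 2 volume := by
  rw [eLpNorm_eq_lintegral_rpow_enorm_toReal two_ne_zero ENNReal.ofNat_ne_top,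
    eLpNorm_eq_lintegral_rpow_enorm_toReal two_ne_zero ENNReal.ofNat_ne_top]
  refine ENNReal.rpow_le_rpow ?_ (by positivity)
  simp only [ENNReal.toReal_ofNat, ENNReal.rpow_ofNat]
  exact lintegral_sq_convolution_le φ hf

/-- Mollifications converge in `L²`. -/
lemma exists_forall_eLpNorm_convolution_sub_le [CompleteSpace E] {f : ℂ → E} (hf : MemLp f 2 volume) {ε : ℝ≥0∞}
    (hε : ε ≠ 0) {K : Set ℂ} (hK : IsCompact K) :
    ∃ δ > 0, ∀ φ : ContDiffBump (0 : ℂ), φ.rOut < δ →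
      eLpNorm ((φ.normed volume ⋆[lsmul ℝ ℝ, volume] f) - f) 2 (volume.restrict K) ≤ ε := by
  have h3 : ε / 3 ≠ 0 := (ENNReal.div_pos hε ENNReal.ofNat_ne_top).ne'
  -- Split f = c + (f - c) with c continuous of compact support. The mollified remainder, the
  -- remainder itself and the uniform error of mollifying c each cost ε/3.
  obtain ⟨c, hc, hfc, hcc, hcm⟩ :=
    hf.exists_hasCompactSupport_eLpNorm_sub_le ENNReal.ofNat_ne_top h3
  -- A sup-norm error η on K costs at most η |K|^{1/2} in L²(K).
  obtain ⟨η, hη, hηε⟩ := ENNReal.exists_nnreal_pos_mul_lt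
    (a := volume K ^ (2 : ℝ≥0∞).toReal⁻¹)
    (ENNReal.rpow_ne_top_of_nonneg (by positivity) hK.measure_lt_top.ne) h3
  obtain ⟨δ, hδ, hcδ⟩ := Metric.uniformContinuous_iff.1
    (hc.uniformContinuous_of_continuous hcc) η hη
  refine ⟨δ, hδ, fun φ hφ => ?_⟩
  have hex : ∀ {g : ℂ → E}, MemLp g 2 volume →
      ConvolutionExists (φ.normed volume) g (lsmul ℝ ℝ) volume := fun hg =>
    φ.hasCompactSupport_normed.convolutionExists_left _ φ.continuous_normed
      (hg.locallyIntegrable one_le_two)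
  set F := φ.normed volume ⋆[lsmul ℝ ℝ, volume] f with hF
  set C := φ.normed volume ⋆[lsmul ℝ ℝ, volume] c with hC
  set S := φ.normed volume ⋆[lsmul ℝ ℝ, volume] (f - c) with hS
  have hsum : F = C + S := by
    have h : c + (f - c) = f := by abel
    rw [hF, ← h, (hex hcm).distrib_add (hex (hf.sub hcm))]
  have e : F - f = S + ((C - c) - (f - c)) := by rw [hsum]; abel
  have hCm : AEStronglyMeasurable C (volume.restrict K) :=
    (φ.hasCompactSupport_normed.continuous_convolution_left _ φ.continuous_normed
      (hcm.locallyIntegrable one_le_two)).aestronglyMeasurable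
  have hSm : AEStronglyMeasurable S (volume.restrict K) :=
    (φ.hasCompactSupport_normed.continuous_convolution_left _ φ.continuous_normed
      ((hf.sub hcm).locallyIntegrable one_le_two)).aestronglyMeasurable
  have hfm := hf.aestronglyMeasurable.restrict (s := K)
  have hcm' := hcc.aestronglyMeasurable (μ := volume.restrict K)
  have b1 : eLpNorm S 2 (volume.restrict K) ≤ ε / 3 :=
    (eLpNorm_mono_measure _ Measure.restrict_le_self).trans
      ((eLpNorm_convolution_le φ (hf.sub hcm).aestronglyMeasurable).trans hfc)
  have b2 : eLpNorm (f - c) 2 (volume.restrict K) ≤ ε / 3 :=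
    (eLpNorm_mono_measure _ Measure.restrict_le_self).trans hfc
  have b3 : eLpNorm (C - c) 2 (volume.restrict K) ≤ ε / 3 := by
    refine (eLpNorm_le_of_ae_bound (C := η) (ae_of_all _ fun x => ?_)).trans ?_
    · rw [Pi.sub_apply, ← dist_eq_norm]
      refine φ.dist_normed_convolution_le hcc.aestronglyMeasurable fun y hy => ?_
      exact (hcδ ((Metric.mem_ball.1 hy).trans hφ)).le
    · rw [Measure.restrict_apply_univ, ENNReal.ofReal_coe_nnreal, mul_comm]
      exact hηε.le
  calc eLpNorm (F - f) 2 (volume.restrict K)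
      ≤ eLpNorm S 2 (volume.restrict K) + (eLpNorm (C - c) 2 (volume.restrict K) +
        eLpNorm (f - c) 2 (volume.restrict K)) := by
        rw [e]
        refine (eLpNorm_add_le hSm ((hCm.sub hcm').sub (hfm.sub hcm')) one_le_two).trans ?_
        gcongr
        exact eLpNorm_sub_le (hCm.sub hcm') (hfm.sub hcm') one_le_two
    _ ≤ ε / 3 + (ε / 3 + ε / 3) := add_le_add b1 (add_le_add b3 b2)
    _ = ε := by rw [← add_assoc, ENNReal.add_thirds]

end Mollify

open scoped Convolution
open ContinuousLinearMap (lsmul)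

lemma integrable_indicator_of_integrableOn {E : Type*} [NormedAddCommGroup E] {K : Set ℂ}
    (hK : MeasurableSet K) {f : ℂ → E} (hf : IntegrableOn f K) : Integrable (K.indicator f) :=
  hf.integrable_indicator hK

lemma memLp_indicator_of_memLp_restrict {E : Type*} [NormedAddCommGroup E] {K : Set ℂ}
    (hK : MeasurableSet K) {f : ℂ → E} {p : ℝ≥0∞} (hf : MemLp f p (volume.restrict K)) :
    MemLp (K.indicator f) p :=
  (memLp_indicator_iff_restrict hK).2 hf

/-- The derivative falls on the kernel, and ψ(y) = φ(x - y) is an admissible test function. The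
minus sign from the chain rule cancels the one in the definition of the weak differential. Since ψ
is supported in K, cutting g and D off outside K changes nothing. -/
lemma HasWeakDiff.fderiv_convolution {Ω : Set ℂ} {g : ℂ → ℂ}
    {D : ℂ → ℂ →L[ℝ] ℂ} (hD : HasWeakDiff Ω g D) (hg : ContinuousOn g Ω) {K : Set ℂ}
    (hKΩ : K ⊆ Ω) (hK : IsCompact K) (φ : ContDiffBump (0 : ℂ)) {x : ℂ}
    (hx : Metric.closedBall x φ.rOut ⊆ K) :
    fderiv ℝ (φ.normed volume ⋆[lsmul ℝ ℝ, volume] K.indicator g) x =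
      (φ.normed volume ⋆[lsmul ℝ ℝ, volume] K.indicator D) x := by
  have hgi : Integrable (K.indicator g) :=
    ((hg.mono hKΩ).integrableOn_compact hK).integrable_indicator hK.measurableSet
  have hDi := integrable_indicator_of_integrableOn hK.measurableSet (hD.integrableOn hKΩ hK)
  have hcd : ContDiff ℝ ∞ (φ.normed (volume : Measure ℂ)) := φ.contDiff_normed (n := ⊤)
  have hcd1 : ContDiff ℝ 1 (φ.normed (volume : Measure ℂ)) := hcd.of_le ENat.LEInfty.out
  have hcs := φ.hasCompactSupport_normed (μ := (volume : Measure ℂ))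
  have hfd := hcs.hasFDerivAt_convolution_left (lsmul ℝ ℝ) hcd1 hgi.locallyIntegrable x
  rw [hfd.fderiv]
  ext v
  have hi1 := (hcs.fderiv (𝕜 := ℝ)).convolutionExists_left ((lsmul ℝ ℝ).precompL ℂ)
    (hcd1.continuous_fderiv (by simp)) hgi.locallyIntegrable x
  have hi2 := hcs.convolutionExists_left (lsmul ℝ ℝ)
    hcd.continuous hDi.locallyIntegrable x
  rw [convolution_def, convolution_def, ContinuousLinearMap.integral_apply hi1,
    ContinuousLinearMap.integral_apply hi2]
  simp only [ContinuousLinearMap.precompL_apply, ContinuousLinearMap.lsmul_apply,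
    smul_apply]
  set ψ : ℂ → ℝ := fun y => φ.normed volume (x - y) with hψ
  have hψd : ContDiff ℝ ∞ ψ := hcd.comp (contDiff_const.sub contDiff_id)
  have hψf : ∀ y, fderiv ℝ ψ y v = -(fderiv ℝ (φ.normed volume) (x - y) v) := fun y => by
    have h1 : HasFDerivAt ψ _ y := ((hcd1.differentiable (by simp)) (x - y)).hasFDerivAt.comp y
      ((hasFDerivAt_const x y).sub (hasFDerivAt_id y))
    rw [h1.fderiv]
    simp
  have hψt : tsupport ψ ⊆ Metric.closedBall x φ.rOut := by
    refine closure_minimal (fun y hy => ?_) Metric.isClosed_closedBall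
    have h1 : x - y ∈ Function.support (φ.normed (volume : Measure ℂ)) := hy
    rw [φ.support_normed_eq, mem_ball_zero_iff] at h1
    rw [Metric.mem_closedBall, dist_comm, dist_eq_norm]
    exact h1.le
  have hψc : HasCompactSupport ψ :=
    (isCompact_closedBall x φ.rOut).of_isClosed_subset (isClosed_tsupport _) hψt
  have hψK : tsupport ψ ⊆ K := hψt.trans hx
  have key := hD.integral_eq ψ hψd hψc (hψK.trans hKΩ) v
  have h1 : ∀ y, y ∉ K → fderiv ℝ ψ y = 0 := fun y hy =>
    image_eq_zero_of_notMem_tsupport (fun hy' => hy (hψK (tsupport_fderiv_subset ℝ hy')))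
  have h2 : ∀ y, y ∉ K → ψ y = 0 := fun y hy =>
    image_eq_zero_of_notMem_tsupport (fun hy' => hy (hψK hy'))
  have e1 : ∫ t, fderiv ℝ (φ.normed volume) t v • K.indicator g (x - t) =
      -∫ z in Ω, fderiv ℝ ψ z v • g z := by
    rw [← integral_sub_left_eq_self _ volume x, setIntegral_eq_integral_of_forall_compl_eq_zero
      fun z hz => ?_, ← integral_neg]
    · refine integral_congr_ae (ae_of_all _ fun y => ?_)
      simp only [sub_sub_cancel]
      rw [hψf]
      by_cases hy : y ∈ K
      · rw [indicator_of_mem hy, neg_smul, neg_neg]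
      · have := hψf y
        rw [h1 y hy] at this
        have h0 : fderiv ℝ (φ.normed volume) (x - y) v = 0 := by simpa using this.symm
        rw [h0]; simp
    · rw [h1 z fun hz' => hz (hKΩ hz')]; simp
  have e2 : ∫ t, φ.normed volume t • K.indicator D (x - t) v = ∫ z in Ω, ψ z • D z v := by
    rw [← integral_sub_left_eq_self _ volume x, setIntegral_eq_integral_of_forall_compl_eq_zero
      fun z hz => ?_]
    · refine integral_congr_ae (ae_of_all _ fun y => ?_)
      simp only [sub_sub_cancel]
      by_cases hy : y ∈ K
      · rw [indicator_of_mem hy]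
      · have h0 := h2 y hy
        rw [h0, zero_smul]
        rw [hψ] at h0
        simp only at h0
        rw [h0, zero_smul]
    · rw [h2 z fun hz' => hz (hKΩ hz'), zero_smul]
  rw [e1, key, e2, neg_neg]

/-- Continuous Sobolev maps are approximated by smooth maps, together with their differentials. -/
lemma HasWeakDiff.exists_smooth_approx {Ω : Set ℂ} (hΩ : IsOpen Ω) {g : ℂ → ℂ}
    {D : ℂ → ℂ →L[ℝ] ℂ} (hD : HasWeakDiff Ω g D) (hg : ContinuousOn g Ω) {K : Set ℂ}
    (hKΩ : K ⊆ Ω) (hK : IsCompact K) {ε : ℝ} (hε : 0 < ε) :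
    ∃ G : ℂ → ℂ, ContDiff ℝ ∞ G ∧ (∀ z ∈ K, ‖G z - g z‖ ≤ ε) ∧
      eLpNorm (fderiv ℝ G - D) 2 (volume.restrict K) ≤ ENNReal.ofReal ε := by
  obtain ⟨d, hd, hdΩ⟩ := hK.exists_cthickening_subset_open hΩ hKΩ
  -- The thickening contains the mollification ball around every point of K, so the truncated
  -- convolution is correct on K.
  set K' := Metric.cthickening d K with hK'
  have hK'c : IsCompact K' := hK.cthickening
  have hKK' : K ⊆ K' := Metric.self_subset_cthickening K
  have hballK' : ∀ x ∈ K, Metric.ball x d ⊆ K' := fun x hx =>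
    (Metric.ball_subset_thickening hx d).trans (Metric.thickening_subset_cthickening d K)
  have hgi : Integrable (K'.indicator g) :=
    ((hg.mono hdΩ).integrableOn_compact hK'c).integrable_indicator hK'c.measurableSet
  have hDL := memLp_indicator_of_memLp_restrict hK'c.measurableSet (hD.memLp_diff K' hdΩ hK'c)
  obtain ⟨δ₁, hδ₁, h₁⟩ := exists_forall_eLpNorm_convolution_sub_le hDL
    (ENNReal.ofReal_pos.2 hε).ne' hK
  obtain ⟨δ₂, hδ₂, h₂⟩ := Metric.uniformContinuousOn_iff.1
    (hK'c.uniformContinuousOn_of_continuous (hg.mono hdΩ)) ε hε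
  set δ := min d (min δ₁ δ₂) with hδ
  have hδ0 : 0 < δ := by positivity
  let φ : ContDiffBump (0 : ℂ) := ⟨δ / 4, δ / 2, by positivity, by linarith⟩
  have hφd : φ.rOut < d := (half_lt_self hδ0).trans_le (min_le_left _ _)
  have hφ1 : φ.rOut < δ₁ :=
    (half_lt_self hδ0).trans_le ((min_le_right _ _).trans (min_le_left _ _))
  have hφ2 : φ.rOut < δ₂ :=
    (half_lt_self hδ0).trans_le ((min_le_right _ _).trans (min_le_right _ _))
  refine ⟨φ.normed volume ⋆[lsmul ℝ ℝ, volume] K'.indicator g, ?_, fun z hz => ?_, ?_⟩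
  · exact φ.hasCompactSupport_normed.contDiff_convolution_left (n := ⊤) _ (φ.contDiff_normed (n := ⊤))
      hgi.locallyIntegrable
  · have hz' : K'.indicator g z = g z := indicator_of_mem (hKK' hz) g
    rw [← dist_eq_norm, ← hz']
    refine φ.dist_normed_convolution_le hgi.aestronglyMeasurable fun y hy => ?_
    have hy' : y ∈ K' := hballK' z hz (Metric.ball_subset_ball hφd.le hy)
    rw [hz', indicator_of_mem hy']
    exact (h₂ y hy' z (hKK' hz) ((Metric.mem_ball.1 hy).trans hφ2)).le
  · refine (eLpNorm_congr_ae ?_).trans_le (h₁ φ hφ1)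
    refine (ae_restrict_iff' hK.measurableSet).2 (ae_of_all _ fun x hx => ?_)
    rw [Pi.sub_apply, Pi.sub_apply, indicator_of_mem (hKK' hx) D]
    congr 1
    exact hD.fderiv_convolution hg hdΩ hK'c φ
      ((Metric.closedBall_subset_ball hφd).trans (hballK' x hx))

/-! ### Polar coordinates and Stokes' formula on annuli -/

/-- The closed annulus `{a ≤ |z| ≤ b}`. -/
def closedAnnulus (a b : ℝ) : Set ℂ := {z | a ≤ ‖z‖ ∧ ‖z‖ ≤ b}

lemma isCompact_closedAnnulus (a b : ℝ) : IsCompact (closedAnnulus a b) := by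
  refine (isCompact_closedBall (0 : ℂ) b).of_isClosed_subset ?_ fun z hz => by simpa using hz.2
  exact (isClosed_le continuous_const continuous_norm).inter
    (isClosed_le continuous_norm continuous_const)

lemma closedAnnulus_subset {a b r₁ r₂ : ℝ} (h₁ : a < r₁) (h₂ : r₂ < b) :
    closedAnnulus r₁ r₂ ⊆ annulus a b := fun _ hz => ⟨h₁.trans_le hz.1, hz.2.trans_lt h₂⟩

/-- The point with polar coordinates `(x.1, x.2)`. -/
def polar (x : ℝ × ℝ) : ℂ := x.1 * Complex.exp (x.2 * Complex.I)

lemma polar_eq (x : ℝ × ℝ) : polar x = Complex.polarCoord.symm x := by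
  rw [Complex.polarCoord_symm_apply, polar, Complex.exp_mul_I]
  push_cast
  rfl

lemma norm_polar (x : ℝ × ℝ) : ‖polar x‖ = |x.1| := by
  rw [polar, norm_mul, Complex.norm_exp_ofReal_mul_I, mul_one, Complex.norm_real, Real.norm_eq_abs]

lemma polar_mem_closedAnnulus {r₁ r₂ : ℝ} (h0 : 0 < r₁) {x : ℝ × ℝ} (hx : x.1 ∈ Icc r₁ r₂) :
    polar x ∈ closedAnnulus r₁ r₂ := by
  change _ ≤ _ ∧ _ ≤ _
  rwa [norm_polar, abs_of_pos (h0.trans_le hx.1)]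

lemma hasFDerivAt_polar (x : ℝ × ℝ) : HasFDerivAt polar
    ((ContinuousLinearMap.fst ℝ ℝ ℝ).smulRight (Complex.exp (x.2 * Complex.I)) +
      (ContinuousLinearMap.snd ℝ ℝ ℝ).smulRight (Complex.I * polar x)) x := by
  have h1 : HasFDerivAt (fun x : ℝ × ℝ => (x.1 : ℂ))
      (Complex.ofRealCLM ∘L ContinuousLinearMap.fst ℝ ℝ ℝ) x :=
    Complex.ofRealCLM.hasFDerivAt.comp x hasFDerivAt_fst
  have h2 : HasFDerivAt (fun x : ℝ × ℝ => (x.2 : ℂ) * Complex.I) _ x :=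
    (Complex.ofRealCLM.hasFDerivAt.comp x hasFDerivAt_snd).mul_const Complex.I
  refine (h1.mul h2.cexp).congr_fderiv (ContinuousLinearMap.ext fun v => ?_)
  simp [polar]
  ring

lemma contDiff_polar {n : WithTop ℕ∞} : ContDiff ℝ n polar := by
  have h1 : ContDiff ℝ n (fun x : ℝ × ℝ => (x.1 : ℂ)) := Complex.ofRealCLM.contDiff.comp contDiff_fst
  have h2 : ContDiff ℝ n (fun x : ℝ × ℝ => (x.2 : ℂ)) := Complex.ofRealCLM.contDiff.comp contDiff_snd
  exact h1.mul (h2.mul contDiff_const).cexp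

lemma polar_pi (s : ℝ) : polar (s, -Real.pi) = polar (s, Real.pi) := by
  simp [polar, Complex.exp_pi_mul_I, Complex.exp_neg]

lemma exp_neg_pi : Complex.exp ((-Real.pi : ℝ) * Complex.I) =
    Complex.exp ((Real.pi : ℝ) * Complex.I) := by
  simp [Complex.exp_pi_mul_I, Complex.exp_neg]

/-- The closed rectangle is what the divergence theorem needs; it differs from the range of the
polar chart by the null set θ = ±π. -/
lemma setIntegral_closedAnnulus {E : Type*} [NormedAddCommGroup E] [NormedSpace ℝ E] {r₁ r₂ : ℝ}
    (h0 : 0 < r₁) (B : ℂ → E) :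
    ∫ z in closedAnnulus r₁ r₂, B z =
      ∫ x in Icc (r₁, -Real.pi) (r₂, Real.pi), x.1 • B (polar x) := by
  rw [← integral_indicator (isCompact_closedAnnulus r₁ r₂).measurableSet,
    ← Complex.integral_comp_polarCoord_symm]
  have e : ∀ x : ℝ × ℝ, x ∈ polarCoord.target →
      x.1 • (closedAnnulus r₁ r₂).indicator B (Complex.polarCoord.symm x) =
        (Icc r₁ r₂ ×ˢ (univ : Set ℝ)).indicator (fun x => x.1 • B (polar x)) x := by
    intro x hx
    have hx1 : 0 < x.1 := hx.1
    by_cases h : x.1 ∈ Icc r₁ r₂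
    · rw [indicator_of_mem (by simpa using h : x ∈ Icc r₁ r₂ ×ˢ (univ : Set ℝ)), ← polar_eq,
        indicator_of_mem (polar_mem_closedAnnulus h0 h)]
    · rw [indicator_of_notMem (by simpa using h : x ∉ Icc r₁ r₂ ×ˢ (univ : Set ℝ)), ← polar_eq,
        indicator_of_notMem, smul_zero]
      intro h'
      change _ ≤ _ ∧ _ ≤ _ at h'
      rw [norm_polar, abs_of_pos hx1] at h'
      exact h h'
  rw [setIntegral_congr_fun polarCoord.open_target.measurableSet e,
    setIntegral_indicator (measurableSet_Icc.prod MeasurableSet.univ)]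
  refine setIntegral_congr_set ?_
  have h1 : polarCoord.target ∩ Icc r₁ r₂ ×ˢ (univ : Set ℝ) =
      Icc r₁ r₂ ×ˢ Ioo (-Real.pi) Real.pi := by
    ext x
    simp only [polarCoord_target, mem_inter_iff, mem_prod, mem_Ioi, mem_univ, and_true]
    exact ⟨fun h => ⟨h.2, h.1.2⟩, fun h => ⟨⟨h0.trans_le h.1.1, h.2⟩, h.1⟩⟩
  rw [h1, ← Icc_prod_Icc]
  exact Measure.set_prod_ae_eq (ae_eq_refl _) Ioo_ae_eq_Icc

/-- The density of the form `d arg h` on the circle of radius `s`. -/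
def argDensity (h : ℂ → ℂ) (z : ℂ) : ℝ := (fderiv ℝ h z (Complex.I * z) / h z).im

/-- Stokes' formula for `ϑ d arg h`. -/
lemma stokes_closedAnnulus {a b r₁ r₂ : ℝ} (ha : 0 ≤ a) (h₁ : a < r₁) (h₁₂ : r₁ ≤ r₂) (h₂ : r₂ < b)
    {ϑ : ℂ → ℝ} (hϑ : ContDiffOn ℝ 1 ϑ (annulus a b)) {h : ℂ → ℂ}
    (hh : ContDiffOn ℝ 2 h (annulus a b)) (hh0 : ∀ z ∈ annulus a b, h z ≠ 0) :
    ∫ z in closedAnnulus r₁ r₂, (fderiv ℝ ϑ z z * (fderiv ℝ h z (Complex.I * z) / h z).im -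
        fderiv ℝ ϑ z (Complex.I * z) * (fderiv ℝ h z z / h z).im) / ‖z‖ ^ 2 =
      (∫ θ in -Real.pi..Real.pi, ϑ (polar (r₂, θ)) * argDensity h (polar (r₂, θ))) -
        ∫ θ in -Real.pi..Real.pi, ϑ (polar (r₁, θ)) * argDensity h (polar (r₁, θ)) := by
  have h0 : 0 < r₁ := ha.trans_lt h₁
  have hU := isOpen_annulus a b
  set Q := Icc (r₁, -Real.pi) (r₂, Real.pi) with hQ
  have hmem : ∀ x ∈ Q, polar x ∈ annulus a b := fun x hx =>
    closedAnnulus_subset h₁ h₂ (polar_mem_closedAnnulus h0 ⟨hx.1.1, hx.2.1⟩)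
  have hmaps : MapsTo polar Q (annulus a b) := hmem
  set ee : ℝ × ℝ → ℂ := fun x => Complex.exp (x.2 * Complex.I) with hee
  have heec : Continuous ee := by fun_prop
  have hpc : Continuous polar := (contDiff_polar (n := 0)).continuous
  -- pointwise derivatives
  have dϑ : ∀ z ∈ annulus a b, HasFDerivAt ϑ (fderiv ℝ ϑ z) z := fun z hz =>
    ((hϑ.contDiffAt (hU.mem_nhds hz)).differentiableAt (by simp)).hasFDerivAt
  have dh : ∀ z ∈ annulus a b, HasFDerivAt h (fderiv ℝ h z) z := fun z hz =>
    ((hh.contDiffAt (hU.mem_nhds hz)).differentiableAt (by simp)).hasFDerivAt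
  have ddh : ∀ z ∈ annulus a b, HasFDerivAt (fderiv ℝ h) (fderiv ℝ (fderiv ℝ h) z) z :=
    fun z hz => (((hh.contDiffAt (hU.mem_nhds hz)).fderiv_right (m := 1)
      (by norm_num)).differentiableAt (by simp)).hasFDerivAt
  have hsym : ∀ z ∈ annulus a b, ∀ v w, fderiv ℝ (fderiv ℝ h) z v w = fderiv ℝ (fderiv ℝ h) z w v :=
    fun z hz v w => ((hh.contDiffAt (hU.mem_nhds hz)).isSymmSndFDerivAt (by simp)).eq v w
  have hee' : ∀ x : ℝ × ℝ, HasFDerivAt ee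
      ((ContinuousLinearMap.snd ℝ ℝ ℝ).smulRight (Complex.I * ee x)) x := fun x => by
    have h2 : HasFDerivAt (fun x : ℝ × ℝ => (x.2 : ℂ) * Complex.I) _ x :=
      (Complex.ofRealCLM.hasFDerivAt.comp x hasFDerivAt_snd).mul_const Complex.I
    refine h2.cexp.congr_fderiv (ContinuousLinearMap.ext fun v => ?_)
    simp [hee]
    ring
  -- the fields whose divergence is integrated
  let f : ℝ × ℝ → ℝ := fun x =>
    ϑ (polar x) * (fderiv ℝ h (polar x) (Complex.I * polar x) / h (polar x)).im
  let g : ℝ × ℝ → ℝ := fun x => -(ϑ (polar x) * (fderiv ℝ h (polar x) (ee x) / h (polar x)).im)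
  have chp : ContinuousOn (fun x => (h (polar x))) Q := hh.continuousOn.comp hpc.continuousOn hmaps
  have cDh : ContinuousOn (fun x => fderiv ℝ h (polar x)) Q :=
    (hh.continuousOn_fderiv_of_isOpen hU (by norm_num)).comp hpc.continuousOn hmaps
  have ch1 : ContinuousOn
      (fun x => (fderiv ℝ h (polar x) (Complex.I * polar x) / h (polar x)).im) Q :=
    Complex.continuous_im.comp_continuousOn
      ((cDh.clm_apply (continuous_const.mul hpc).continuousOn).div chp fun x hx => hh0 _ (hmem x hx))
  have ch2 : ContinuousOn (fun x => (fderiv ℝ h (polar x) (ee x) / h (polar x)).im) Q :=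
    Complex.continuous_im.comp_continuousOn
      ((cDh.clm_apply heec.continuousOn).div chp fun x hx => hh0 _ (hmem x hx))
  have cϑ : ContinuousOn (fun x => ϑ (polar x)) Q := hϑ.continuousOn.comp hpc.continuousOn hmaps
  have hcf : ContinuousOn f Q := cϑ.mul ch1
  have hcg : ContinuousOn g Q := (cϑ.mul ch2).neg
  have key : ∀ x ∈ Q, ∃ f' g' : ℝ × ℝ →L[ℝ] ℝ, HasFDerivAt f f' x ∧ HasFDerivAt g g' x ∧
      f' (1, 0) + g' (0, 1) =
        fderiv ℝ ϑ (polar x) (ee x) * (fderiv ℝ h (polar x) (Complex.I * polar x) / h (polar x)).im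
        - fderiv ℝ ϑ (polar x) (Complex.I * polar x) * (fderiv ℝ h (polar x) (ee x) / h (polar x)).im := by
    intro x hx
    have hz := hmem x hx
    have hp := hasFDerivAt_polar x
    have cϑ := (dϑ _ hz).comp x hp
    have ch := (dh _ hz).comp x hp
    have cd := (ddh _ hz).comp x hp
    have ce := cd.clm_apply (hee' x)
    have cp := cd.clm_apply (hp.const_mul Complex.I)
    have hne := hh0 _ hz
    have ci := (hasDerivAt_inv hne).complexToReal_fderiv.comp x ch
    have e1 := Complex.imCLM.hasFDerivAt.comp x (cp.mul ci)
    have e2 := Complex.imCLM.hasFDerivAt.comp x (ce.mul ci)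
    refine ⟨_, _, cϑ.mul e1, (cϑ.mul e2).neg, ?_⟩
    -- Here d arg h is seen to be closed: by symmetry of the second derivative all second-order
    -- terms cancel.
    have hs := hsym _ hz (ee x) (Complex.I * polar x)
    have hexp : Complex.exp (x.2 * Complex.I) = ee x := rfl
    simp [hexp, Complex.div_im]
    rw [hs]
    ring
  have cF1 : ContinuousOn (fun x => fderiv ℝ ϑ (polar x)) Q :=
    (hϑ.continuousOn_fderiv_of_isOpen hU le_rfl).comp hpc.continuousOn hmaps
  have cF2 : ContinuousOn (fun x => fderiv ℝ ϑ (polar x) (ee x) *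
        (fderiv ℝ h (polar x) (Complex.I * polar x) / h (polar x)).im -
      fderiv ℝ ϑ (polar x) (Complex.I * polar x) *
        (fderiv ℝ h (polar x) (ee x) / h (polar x)).im) Q :=
    ((cF1.clm_apply heec.continuousOn).mul ch1).sub
      ((cF1.clm_apply (continuous_const.mul hpc).continuousOn).mul ch2)
  have hdiv : ∀ x ∈ Q, fderiv ℝ f x (1, 0) + fderiv ℝ g x (0, 1) =
        fderiv ℝ ϑ (polar x) (ee x) *
          (fderiv ℝ h (polar x) (Complex.I * polar x) / h (polar x)).im -
        fderiv ℝ ϑ (polar x) (Complex.I * polar x) *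
          (fderiv ℝ h (polar x) (ee x) / h (polar x)).im := fun x hx => by
    obtain ⟨f', g', hf', hg', e⟩ := key x hx
    rw [hf'.fderiv, hg'.fderiv, e]
  have hQm : MeasurableSet Q := measurableSet_Icc
  have hsub : Ioo r₁ r₂ ×ˢ Ioo (-Real.pi) Real.pi ⊆ Q := fun x hx =>
    ⟨⟨hx.1.1.le, hx.2.1.le⟩, ⟨hx.1.2.le, hx.2.2.le⟩⟩
  have main := integral_divergence_prod_Icc_of_hasFDerivAt_of_le f g (fderiv ℝ f) (fderiv ℝ g)
    (r₁, -Real.pi) (r₂, Real.pi) ⟨h₁₂, by linarith [Real.pi_pos]⟩ hcf hcg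
    (fun x hx => by
      obtain ⟨f', g', hf', hg', e⟩ := key x (hsub hx)
      exact hf'.differentiableAt.hasFDerivAt)
    (fun x hx => by
      obtain ⟨f', g', hf', hg', e⟩ := key x (hsub hx)
      exact hg'.differentiableAt.hasFDerivAt)
    ((cF2.integrableOn_compact isCompact_Icc).congr_fun (fun x hx => (hdiv x hx).symm) hQm)
  rw [setIntegral_closedAnnulus h0]
  -- By periodicity the edges θ = ±π of the rectangle cancel, and only the two circles remain.
  have hper : ∀ s : ℝ, g (s, Real.pi) = g (s, -Real.pi) := fun s => by
    simp only [g, hee, polar_pi, exp_neg_pi]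
  simp only [hper, sub_self, zero_add] at main
  refine Eq.trans ?_ main
  refine setIntegral_congr_fun hQm fun x hx => ?_
  have hx1 : x.1 ≠ 0 := (h0.trans_le hx.1.1).ne'
  have hz : polar x = x.1 • ee x := by simp [polar, hee]
  have e1 : fderiv ℝ ϑ (polar x) (polar x) = x.1 * fderiv ℝ ϑ (polar x) (ee x) := by
    conv_lhs => rw [hz, map_smul, ← hz, smul_eq_mul]
  have e2 : (fderiv ℝ h (polar x) (polar x) / h (polar x)).im =
      x.1 * (fderiv ℝ h (polar x) (ee x) / h (polar x)).im := by
    have : fderiv ℝ h (polar x) (polar x) = x.1 • fderiv ℝ h (polar x) (ee x) := by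
      conv_lhs => rw [hz, map_smul, ← hz]
    rw [this, smul_div_assoc, Complex.smul_im, smul_eq_mul]
  rw [hdiv x hx, norm_polar, sq_abs, e1, e2, smul_eq_mul]
  field_simp

/-- `2π` times the winding number of `h` along the circle of radius `s`. -/
def winding (h : ℂ → ℂ) (s : ℝ) : ℝ := ∫ θ in -Real.pi..Real.pi, argDensity h (polar (s, θ))

/-- Stokes with ϑ = 1. -/
lemma winding_eq {a b r₁ r₂ : ℝ} (ha : 0 ≤ a) (h₁ : a < r₁) (h₁₂ : r₁ ≤ r₂) (h₂ : r₂ < b)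
    {h : ℂ → ℂ} (hh : ContDiffOn ℝ 2 h (annulus a b)) (hh0 : ∀ z ∈ annulus a b, h z ≠ 0) :
    winding h r₂ = winding h r₁ := by
  have := stokes_closedAnnulus ha h₁ h₁₂ h₂ (ϑ := fun _ => 1) contDiffOn_const hh hh0
  simp only [one_mul] at this
  rw [← winding, ← winding] at this
  simp at this
  linarith

/-- Stokes with ϑ = log |z|, whose derivative is 1 along z and 0 along iz. -/
lemma integral_argDensity {a b r₁ r₂ : ℝ} (ha : 0 ≤ a) (h₁ : a < r₁) (h₁₂ : r₁ ≤ r₂) (h₂ : r₂ < b)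
    {h : ℂ → ℂ} (hh : ContDiffOn ℝ 2 h (annulus a b)) (hh0 : ∀ z ∈ annulus a b, h z ≠ 0) :
    ∫ z in closedAnnulus r₁ r₂, argDensity h z / ‖z‖ ^ 2 =
      winding h r₁ * Real.log (r₂ / r₁) := by
  have h0 : 0 < r₁ := ha.trans_lt h₁
  have hn : ∀ z ∈ annulus a b, HasFDerivAt (fun z : ℂ => Real.log ‖z‖) (‖z‖⁻¹ • normDiff z) z :=
    fun z hz => hasFDerivAt_comp_norm (ne_zero_of_mem_annulus ha hz)
      (Real.hasDerivAt_log (norm_ne_zero_iff.2 (ne_zero_of_mem_annulus ha hz)))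
  have hc : ContDiffOn ℝ 1 (fun z : ℂ => Real.log ‖z‖) (annulus a b) := fun z hz =>
    (((contDiffAt_norm ℝ (ne_zero_of_mem_annulus ha hz)).log
      (norm_ne_zero_iff.2 (ne_zero_of_mem_annulus ha hz)))).contDiffWithinAt
  have := stokes_closedAnnulus ha h₁ h₁₂ h₂ hc hh hh0
  simp only [norm_polar, abs_of_pos h0, abs_of_pos (h0.trans_le h₁₂),
    intervalIntegral.integral_const_mul] at this
  rw [← winding, ← winding, winding_eq ha h₁ h₁₂ h₂ hh hh0, ← sub_mul] at this
  rw [Real.log_div (h0.trans_le h₁₂).ne' h0.ne', mul_comm, ← this]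
  refine setIntegral_congr_fun (isCompact_closedAnnulus _ _).measurableSet fun z hz => ?_
  have hz' := closedAnnulus_subset h₁ h₂ hz
  have hz0 := norm_ne_zero_iff.2 (ne_zero_of_mem_annulus ha hz')
  have e1 : normDiff z z = ‖z‖ := by
    rw [normDiff_apply, div_eq_iff hz0, ← Complex.normSq_apply, Complex.normSq_eq_norm_sq, sq]
  have e2 : normDiff z (Complex.I * z) = 0 := by
    rw [normDiff_apply, div_eq_zero_iff]; left; simp; ring
  simp only [(hn z hz').fderiv, FunLike.coe_smul, Pi.smul_apply, e1, e2, argDensity,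
    smul_eq_mul]
  field_simp
  ring

lemma contDiffOn_comp_norm_comp {Ψ ψ : ℝ → ℝ} (hΨ : ∀ t, HasDerivAt Ψ (ψ t) t)
    (hψ : Continuous ψ) {U : Set ℂ} {h : ℂ → ℂ} (hh : ContDiffOn ℝ 1 h U)
    (hh0 : ∀ z ∈ U, h z ≠ 0) : ContDiffOn ℝ 1 (fun z => Ψ ‖h z‖) U := by
  have h1 : ContDiff ℝ 1 Ψ := by
    rw [contDiff_one_iff_deriv]
    refine ⟨fun t => (hΨ t).differentiableAt, ?_⟩
    rwa [show deriv Ψ = ψ from funext fun t => (hΨ t).deriv]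
  exact h1.comp_contDiffOn (hh.norm ℝ hh0)

lemma hasFDerivAt_comp_norm_comp {Ψ ψ : ℝ → ℝ} (hΨ : ∀ t, HasDerivAt Ψ (ψ t) t) {h : ℂ → ℂ} {z : ℂ}
    (hh : DifferentiableAt ℝ h z) (hh0 : h z ≠ 0) :
    HasFDerivAt (fun z => Ψ ‖h z‖) ((ψ ‖h z‖ • normDiff (h z)) ∘L fderiv ℝ h z) z :=
  (hasFDerivAt_comp_norm hh0 (hΨ ‖h z‖)).comp z hh.hasFDerivAt

/-- The radial derivative of `Ψ(|h|)` integrates to the difference of the boundary values. -/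
lemma integral_radial_deriv {a b r₁ r₂ : ℝ} (ha : 0 ≤ a) (h₁ : a < r₁) (h₁₂ : r₁ ≤ r₂) (h₂ : r₂ < b)
    {h : ℂ → ℂ} (hh : ContDiffOn ℝ 2 h (annulus a b)) (hh0 : ∀ z ∈ annulus a b, h z ≠ 0)
    {Ψ ψ : ℝ → ℝ} (hΨ : ∀ t, HasDerivAt Ψ (ψ t) t) (hψ : Continuous ψ) {c₁ c₂ : ℝ}
    (hc₁ : ∀ z, ‖z‖ = r₁ → Ψ ‖h z‖ = c₁) (hc₂ : ∀ z, ‖z‖ = r₂ → Ψ ‖h z‖ = c₂) :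
    ∫ z in closedAnnulus r₁ r₂, ψ ‖h z‖ * normDiff (h z) (fderiv ℝ h z z) / ‖z‖ ^ 2 =
      2 * Real.pi * (c₂ - c₁) := by
  have h0 : 0 < r₁ := ha.trans_lt h₁
  have hid : ∀ z ∈ annulus a b, argDensity id z = 1 := fun z hz => by
    simp [argDensity, ne_zero_of_mem_annulus ha hz]
  have hp : ∀ s, r₁ ≤ s → s ≤ r₂ → ∀ θ : ℝ, polar (s, θ) ∈ annulus a b := fun s hs hs' θ =>
    closedAnnulus_subset h₁ h₂ (polar_mem_closedAnnulus h0 ⟨hs, hs'⟩)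
  -- Stokes with ϑ = Ψ(|h|) and the argument of the identity map in place of arg h.
  have := stokes_closedAnnulus ha h₁ h₁₂ h₂
    (contDiffOn_comp_norm_comp hΨ hψ (hh.of_le (by norm_num)) hh0) (h := id) contDiffOn_id
    fun z hz => ne_zero_of_mem_annulus ha hz
  have e : ∀ s c, r₁ ≤ s → s ≤ r₂ → (∀ z, ‖z‖ = s → Ψ ‖h z‖ = c) →
      ∫ θ in -Real.pi..Real.pi, Ψ ‖h (polar (s, θ))‖ * argDensity id (polar (s, θ)) =
        2 * Real.pi * c := by
    intro s c hs hs' hc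
    have : ∀ θ : ℝ, Ψ ‖h (polar (s, θ))‖ * argDensity id (polar (s, θ)) = c := fun θ => by
      rw [hid _ (hp s hs hs' θ), mul_one, hc _ (by rw [norm_polar, abs_of_pos (h0.trans_le hs)])]
    simp only [this, intervalIntegral.integral_const, smul_eq_mul]
    ring
  rw [e r₁ c₁ le_rfl h₁₂ hc₁, e r₂ c₂ h₁₂ le_rfl hc₂] at this
  rw [mul_sub, ← this]
  refine setIntegral_congr_fun (isCompact_closedAnnulus _ _).measurableSet fun z hz => ?_
  have hz' := closedAnnulus_subset h₁ h₂ hz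
  have hz0 := ne_zero_of_mem_annulus ha hz'
  have hd : DifferentiableAt ℝ h z :=
    (hh.contDiffAt ((isOpen_annulus a b).mem_nhds hz')).differentiableAt (by simp)
  simp [(hasFDerivAt_comp_norm_comp hΨ hd (hh0 z hz')).fderiv, hz0]

/-- In the orthonormal frame w/|w|, iw/|w| a vector u has the components `normDiff w u` and |w|
Im(u/w). This is the determinant of u and v in that frame. -/
lemma normDiff_mul_im_sub {w : ℂ} (hw : w ≠ 0) (u v : ℂ) :
    normDiff w u * (v / w).im - normDiff w v * (u / w).im = (conj u * v).im / ‖w‖ := by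
  have h1 : ‖w‖ ^ 2 = w.re * w.re + w.im * w.im := by
    rw [← Complex.normSq_eq_norm_sq, Complex.normSq_apply]
  have h2 : ‖w‖ ≠ 0 := norm_ne_zero_iff.2 hw
  rw [normDiff_apply, normDiff_apply, Complex.div_im, Complex.div_im, Complex.normSq_eq_norm_sq]
  field_simp
  simp
  rw [h1]
  ring

/-- The pull-back of an area form `ψ(|w|) d|w| d arg w`. -/
lemma integral_jacobian {a b r₁ r₂ : ℝ} (ha : 0 ≤ a) (h₁ : a < r₁) (h₁₂ : r₁ ≤ r₂) (h₂ : r₂ < b)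
    {h : ℂ → ℂ} (hh : ContDiffOn ℝ 2 h (annulus a b)) (hh0 : ∀ z ∈ annulus a b, h z ≠ 0)
    {Ψ ψ : ℝ → ℝ} (hΨ : ∀ t, HasDerivAt Ψ (ψ t) t) (hψ : Continuous ψ) {c₁ c₂ : ℝ}
    (hc₁ : ∀ z, ‖z‖ = r₁ → Ψ ‖h z‖ = c₁) (hc₂ : ∀ z, ‖z‖ = r₂ → Ψ ‖h z‖ = c₂) :
    ∫ z in closedAnnulus r₁ r₂, ψ ‖h z‖ / ‖h z‖ * (fderiv ℝ h z).det =
      winding h r₁ * (c₂ - c₁) := by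
  have h0 : 0 < r₁ := ha.trans_lt h₁
  -- Stokes with ϑ = Ψ(|h|) and d arg h: dϑ ∧ d arg h is the pulled-back area form.
  have := stokes_closedAnnulus ha h₁ h₁₂ h₂
    (contDiffOn_comp_norm_comp hΨ hψ (hh.of_le (by norm_num)) hh0) hh hh0
  have e : ∀ s c, 0 < s → (∀ z, ‖z‖ = s → Ψ ‖h z‖ = c) →
      ∫ θ in -Real.pi..Real.pi, Ψ ‖h (polar (s, θ))‖ * argDensity h (polar (s, θ)) =
        c * winding h s := by
    intro s c hs hc
    have : ∀ θ : ℝ, Ψ ‖h (polar (s, θ))‖ = c := fun θ =>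
      hc _ (by rw [norm_polar, abs_of_pos hs])
    simp only [this, intervalIntegral.integral_const_mul, winding]
  rw [e r₁ c₁ h0 hc₁, e r₂ c₂ (h0.trans_le h₁₂) hc₂, winding_eq ha h₁ h₁₂ h₂ hh hh0] at this
  rw [mul_comm, sub_mul, ← this]
  refine setIntegral_congr_fun (isCompact_closedAnnulus _ _).measurableSet fun z hz => ?_
  have hz' := closedAnnulus_subset h₁ h₂ hz
  have hz0 := norm_ne_zero_iff.2 (ne_zero_of_mem_annulus ha hz')
  have hd : DifferentiableAt ℝ h z :=
    (hh.contDiffAt ((isOpen_annulus a b).mem_nhds hz')).differentiableAt (by simp)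
  have e1 := normDiff_mul_im_sub (hh0 z hz') (fderiv ℝ h z z) (fderiv ℝ h z (Complex.I * z))
  rw [← norm_sq_mul_det] at e1
  have hw := norm_ne_zero_iff.2 (hh0 z hz')
  simp only [(hasFDerivAt_comp_norm_comp hΨ hd (hh0 z hz')).fderiv, ContinuousLinearMap.coe_comp,
    Function.comp, FunLike.coe_smul, Pi.smul_apply, smul_eq_mul]
  rw [mul_assoc, mul_assoc, ← mul_sub, e1]
  field_simp

/-- Nearby maps have the same winding. -/
lemma winding_eq_of_norm_sub_lt {U : Set ℂ} (hU : IsOpen U) {h k : ℂ → ℂ} (hh : ContDiffOn ℝ 1 h U)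
    (hk : ContDiffOn ℝ 1 k U) {s : ℝ} (hs : 0 < s) (hsU : ∀ z : ℂ, ‖z‖ = s → z ∈ U)
    (hlt : ∀ z : ℂ, ‖z‖ = s → ‖k z - h z‖ < ‖h z‖) : winding k s = winding h s := by
  have hns : ∀ θ : ℝ, ‖polar (s, θ)‖ = s := fun θ => by rw [norm_polar, abs_of_pos hs]
  have hmem : ∀ θ : ℝ, polar (s, θ) ∈ U := fun θ => hsU _ (hns θ)
  have hlt' := fun θ : ℝ => hlt _ (hns θ)
  have hh0 : ∀ θ : ℝ, h (polar (s, θ)) ≠ 0 := fun θ h0 => by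
    have := hlt' θ; rw [h0, norm_zero] at this; exact (norm_nonneg _).not_gt this
  have hk0 : ∀ θ : ℝ, k (polar (s, θ)) ≠ 0 := fun θ h0 => by
    have := hlt' θ; rw [h0, zero_sub, norm_neg] at this; exact lt_irrefl _ this
  have hpc : Continuous fun θ : ℝ => polar (s, θ) :=
    (contDiff_polar (n := 0)).continuous.comp (by fun_prop)
  have hpd : ∀ θ : ℝ, HasDerivAt (fun θ : ℝ => polar (s, θ)) (Complex.I * polar (s, θ)) θ := by
    intro θ
    have h1 : HasDerivAt (fun θ : ℝ => (s, θ)) ((0 : ℝ), (1 : ℝ)) θ :=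
      (hasDerivAt_const θ s).prodMk (hasDerivAt_id θ)
    have h2 := (hasFDerivAt_polar (s, θ)).comp_hasDerivAt θ h1
    exact h2.congr_deriv (by simp)
  have hd : ∀ {f : ℂ → ℂ}, ContDiffOn ℝ 1 f U → ∀ θ : ℝ, HasDerivAt (fun θ : ℝ => f (polar (s, θ)))
      (fderiv ℝ f (polar (s, θ)) (Complex.I * polar (s, θ))) θ := fun hf θ =>
    ((hf.contDiffAt (hU.mem_nhds (hmem θ))).differentiableAt (by simp)).hasFDerivAt.comp_hasDerivAt
      θ (hpd θ)
  have hcd : ∀ {f : ℂ → ℂ}, ContDiffOn ℝ 1 f U →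
      Continuous fun θ : ℝ => fderiv ℝ f (polar (s, θ)) (Complex.I * polar (s, θ)) := fun hf =>
    ((hf.continuousOn_fderiv_of_isOpen hU le_rfl).comp_continuous hpc hmem).clm_apply
      (continuous_const.mul hpc)
  have hcont : ∀ {f : ℂ → ℂ}, ContDiffOn ℝ 1 f U → (∀ θ : ℝ, f (polar (s, θ)) ≠ 0) →
      Continuous fun θ : ℝ => argDensity f (polar (s, θ)) := fun hf hf0 =>
    Complex.continuous_im.comp ((hcd hf).div (hf.continuousOn.comp_continuous hpc hmem) hf0)
  -- The quotient k/h stays in the disc of radius 1 about 1, where the principal logarithm is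
  -- smooth. The change of arg(k/h) around the circle is therefore zero.
  have hslit : ∀ θ : ℝ, k (polar (s, θ)) / h (polar (s, θ)) ∈ Complex.slitPlane := by
    intro θ
    have h1 : ‖k (polar (s, θ)) / h (polar (s, θ)) - 1‖ < 1 := by
      rw [div_sub_one (hh0 θ), norm_div, div_lt_one (norm_pos_iff.2 (hh0 θ))]
      exact hlt' θ
    have h2 := Complex.mem_slitPlane_of_norm_lt_one h1
    simpa using h2
  have hlog : ∀ θ : ℝ, HasDerivAt
      (fun θ : ℝ => (Complex.log (k (polar (s, θ)) / h (polar (s, θ)))).im)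
      (argDensity k (polar (s, θ)) - argDensity h (polar (s, θ))) θ := by
    intro θ
    have h1 := ((hd hk θ).div (hd hh θ) (hh0 θ)).clog_real (hslit θ)
    refine (Complex.imCLM.hasFDerivAt.comp_hasDerivAt θ h1).congr_deriv ?_
    have a1 := hh0 θ
    have a2 := hk0 θ
    rw [argDensity, argDensity, ← Complex.sub_im]
    simp only [Complex.imCLM_apply, Pi.div_apply]
    congr 1
    field_simp
  have hint := intervalIntegral.integral_eq_sub_of_hasDerivAt (a := -Real.pi) (b := Real.pi)
    (fun θ _ => hlog θ) (((hcont hk hk0).sub (hcont hh hh0)).intervalIntegrable _ _)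
  rw [polar_pi, sub_self, intervalIntegral.integral_sub ((hcont hk hk0).intervalIntegrable _ _)
    ((hcont hh hh0).intervalIntegrable _ _)] at hint
  exact sub_eq_zero.1 hint

lemma argDensity_id {z : ℂ} (hz : z ≠ 0) : argDensity id z = 1 := by
  simp [argDensity, hz]

lemma winding_id {s : ℝ} (hs : 0 < s) : winding id s = 2 * Real.pi := by
  have : ∀ θ : ℝ, argDensity id (polar (s, θ)) = 1 := fun θ =>
    argDensity_id (norm_pos_iff.1 (by rw [norm_polar]; exact abs_pos.2 hs.ne'))
  simp only [winding, this, intervalIntegral.integral_const, smul_eq_mul]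
  ring

lemma det_one : (ContinuousLinearMap.id ℝ ℂ).det = 1 := by
  rw [det_eq]; simp

/-- Integration of radial functions over annuli. -/
lemma integral_radial {R S : ℝ} (hR : 0 < R) (hRS : R ≤ S) {Ψ ψ : ℝ → ℝ}
    (hΨ : ∀ t, HasDerivAt Ψ (ψ t) t) (hψ : Continuous ψ) :
    ∫ z in closedAnnulus R S, ψ ‖z‖ / ‖z‖ = 2 * Real.pi * (Ψ S - Ψ R) := by
  have h := integral_jacobian (a := 0) (b := S + 1) le_rfl hR hRS (by linarith) (h := id)
    contDiffOn_id (fun z hz => ne_zero_of_mem_annulus le_rfl hz) hΨ hψ (c₁ := Ψ R) (c₂ := Ψ S)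
    (fun z hz => by rw [id, hz]) (fun z hz => by rw [id, hz])
  rw [winding_id hR] at h
  simpa [det_one] using h

/-! ### Winding and boundary correspondence of diffeomorphisms -/

/-- The area formula for diffeomorphisms and radial weights. -/
lemma IsDiffeo.integral_comp_norm {Ω Ω' : Set ℂ} (hΩ : IsOpen Ω) {h : ℂ → ℂ}
    (hh : IsDiffeo Ω Ω' h) (φ : ℝ → ℝ) :
    ∫ z in Ω, φ ‖h z‖ * (fderiv ℝ h z).det = ∫ w in Ω', φ ‖w‖ := by
  have hd : ∀ z ∈ Ω, HasFDerivWithinAt h (fderiv ℝ h z) Ω z := fun z hz =>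
    (((hh.smooth.contDiffAt (hΩ.mem_nhds hz)).differentiableAt
      (by simp)).hasFDerivAt).hasFDerivWithinAt
  rw [← hh.bijOn.image_eq, integral_image_eq_integral_abs_det_fderiv_smul volume hΩ.measurableSet hd
    hh.bijOn.injOn]
  refine setIntegral_congr_fun hΩ.measurableSet fun z hz => ?_
  rw [smul_eq_mul, abs_of_pos (hh.jacobian_pos z hz), mul_comm]

/-- The boundary correspondence of `h` with respect to the circles of radius `r₁` and `r₂`: for
`σ = 1` the inner circle is mapped close to the inner boundary of `A(R,1)`, for `σ = -1` close to
the outer boundary. -/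
def Corresponds (R δ r₁ r₂ σ : ℝ) (h : ℂ → ℂ) : Prop :=
  σ = 1 ∧ (∀ z, ‖z‖ = r₁ → ‖h z‖ ≤ R + δ) ∧ (∀ z, ‖z‖ = r₂ → 1 - δ ≤ ‖h z‖) ∨
  σ = -1 ∧ (∀ z, ‖z‖ = r₁ → 1 - δ ≤ ‖h z‖) ∧ (∀ z, ‖z‖ = r₂ → ‖h z‖ ≤ R + δ)

/-- The winding of a diffeomorphism of annuli is `±2π`, according to its boundary
correspondence. -/
lemma IsDiffeo.winding_eq {r R : ℝ} (hr : 0 ≤ r) (hR : 0 < R) {h : ℂ → ℂ}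
    (hh : IsDiffeo (annulus r 1) (annulus R 1) h) {δ : ℝ} (hδ0 : 0 < δ) (hδ : R + δ < 1 - δ)
    {r₁ r₂ : ℝ} (h₁ : r < r₁) (h₁₂ : r₁ ≤ r₂) (h₂ : r₂ < 1)
    (hoff : ∀ z ∈ annulus r 1, z ∉ closedAnnulus r₁ r₂ → ‖h z‖ ≤ R + δ ∨ 1 - δ ≤ ‖h z‖)
    (hin : (∀ z, ‖z‖ = r₁ → ‖h z‖ ≤ R + δ) ∨ ∀ z, ‖z‖ = r₁ → 1 - δ ≤ ‖h z‖)
    (hout : (∀ z, ‖z‖ = r₂ → ‖h z‖ ≤ R + δ) ∨ ∀ z, ‖z‖ = r₂ → 1 - δ ≤ ‖h z‖) :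
    ∃ σ, Corresponds R δ r₁ r₂ σ h ∧ winding h r₁ = 2 * Real.pi * σ := by
  -- a bump supported in `[R + δ, 1 - δ]` and its primitive
  set ψ : ℝ → ℝ := fun t => max 0 ((t - (R + δ)) * (1 - δ - t)) with hψdef
  have hψ : Continuous ψ := by fun_prop
  have hψ0 : ∀ t, t ≤ R + δ ∨ 1 - δ ≤ t → ψ t = 0 := by
    intro t ht
    refine max_eq_left ?_
    rcases ht with ht | ht <;> nlinarith
  have hψpos : ∀ t ∈ Ioo (R + δ) (1 - δ), 0 < ψ t := fun t ht =>
    lt_max_of_lt_right (mul_pos (sub_pos.2 ht.1) (sub_pos.2 ht.2))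
  set Ψ : ℝ → ℝ := fun t => ∫ x in (R + δ)..t, ψ x with hΨdef
  have hΨ : ∀ t, HasDerivAt Ψ (ψ t) t := fun t =>
    intervalIntegral.integral_hasDerivAt_right (hψ.intervalIntegrable _ _)
      (hψ.stronglyMeasurableAtFilter _ _) hψ.continuousAt
  have hΨ1 : ∀ t ≤ R + δ, Ψ t = 0 := by
    intro t ht
    rw [hΨdef]
    simp only
    rw [intervalIntegral.integral_congr (g := fun _ => 0), intervalIntegral.integral_zero]
    intro x hx
    rw [uIcc_of_ge ht] at hx
    exact hψ0 x (Or.inl hx.2)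
  set c := Ψ (1 - δ) with hc
  have hcpos : 0 < c := intervalIntegral.intervalIntegral_pos_of_pos_on
    (hψ.intervalIntegrable _ _) hψpos hδ
  have hΨ2 : ∀ t, 1 - δ ≤ t → Ψ t = c := by
    intro t ht
    rw [hΨdef, hc, hΨdef]
    simp only
    rw [← intervalIntegral.integral_add_adjacent_intervals
      (hψ.intervalIntegrable (R + δ) (1 - δ)) (hψ.intervalIntegrable (1 - δ) t), add_eq_left]
    rw [intervalIntegral.integral_congr (g := fun _ => 0), intervalIntegral.integral_zero]
    intro x hx
    rw [uIcc_of_le ht] at hx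
    exact hψ0 x (Or.inr hx.1)
  have hh0 : ∀ z ∈ annulus r 1, h z ≠ 0 := fun z hz =>
    ne_zero_of_mem_annulus hR.le (hh.bijOn.mapsTo hz)
  -- The first value of the integral, by change of variables: ψ(|h|) vanishes off the closed
  -- annulus, so it is the full weighted area of the target.
  have area : ∫ z in closedAnnulus r₁ r₂, ψ ‖h z‖ / ‖h z‖ * (fderiv ℝ h z).det =
      2 * Real.pi * c := by
    have e1 := hh.integral_comp_norm (isOpen_annulus r 1) (fun t => ψ t / t)
    have e2 : ∫ w in annulus R 1, ψ ‖w‖ / ‖w‖ = 2 * Real.pi * c := by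
      have := integral_radial hR (by linarith : R ≤ 1) hΨ hψ
      rw [hΨ1 R (by linarith), hΨ2 1 (by linarith), sub_zero] at this
      rw [← this]
      refine (setIntegral_eq_of_subset_of_forall_sdiff_eq_zero
        (isCompact_closedAnnulus R 1).measurableSet (fun z hz => ⟨hz.1.le, hz.2.le⟩) ?_).symm
      intro z hz
      rw [hψ0, zero_div]
      by_contra hcon
      push Not at hcon
      exact hz.2 ⟨by linarith [hcon.1], by linarith [hcon.2]⟩
    rw [← e2, ← e1]
    refine (setIntegral_eq_of_subset_of_forall_sdiff_eq_zero
      (isOpen_annulus r 1).measurableSet (closedAnnulus_subset h₁ h₂) ?_).symm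
    intro z hz
    rw [hψ0 _ (hoff z hz.1 hz.2), zero_div, zero_mul]
  -- The second value, by Stokes. As c > 0, the two circles cannot lie on the same side, and
  -- otherwise the winding is 2π or -2π according to the order of the sides.
  have key : ∀ c₁ c₂, (∀ z, ‖z‖ = r₁ → Ψ ‖h z‖ = c₁) → (∀ z, ‖z‖ = r₂ → Ψ ‖h z‖ = c₂) →
      2 * Real.pi * c = winding h r₁ * (c₂ - c₁) := fun c₁ c₂ hc₁ hc₂ => by
    rw [← area, integral_jacobian hr h₁ h₁₂ h₂ (hh.smooth.of_le ENat.LEInfty.out) hh0 hΨ hψ hc₁ hc₂]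
  have hpos : 0 < 2 * Real.pi * c := by positivity
  rcases hin with hin | hin <;> rcases hout with hout | hout
  · have := key 0 0 (fun z hz => hΨ1 _ (hin z hz)) (fun z hz => hΨ1 _ (hout z hz))
    rw [sub_zero, mul_zero] at this
    exact absurd this hpos.ne'
  · have := key 0 c (fun z hz => hΨ1 _ (hin z hz)) (fun z hz => hΨ2 _ (hout z hz))
    refine ⟨1, Or.inl ⟨rfl, hin, hout⟩, ?_⟩
    rw [sub_zero] at this
    rw [mul_one]
    exact (mul_right_cancel₀ hcpos.ne' this).symm
  · have := key c 0 (fun z hz => hΨ2 _ (hin z hz)) (fun z hz => hΨ1 _ (hout z hz))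
    refine ⟨-1, Or.inr ⟨rfl, hin, hout⟩, ?_⟩
    have h3 : 2 * Real.pi * c = -winding h r₁ * c := by rw [this]; ring
    have h4 := mul_right_cancel₀ hcpos.ne' h3
    linarith
  · have := key c c (fun z hz => hΨ2 _ (hin z hz)) (fun z hz => hΨ2 _ (hout z hz))
    rw [sub_self, mul_zero] at this
    exact absurd this hpos.ne'

/-! ### The distance to the boundary -/

/-- The length of a Lipschitz curve is at least the distance of its endpoints. -/
lemma ofReal_norm_sub_le_length {L : NNReal} {c : ℝ → ℂ} (hc : LipschitzOnWith L c (Icc 0 1)) :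
    ENNReal.ofReal ‖c 1 - c 0‖ ≤ ∫⁻ t in Ioo (0 : ℝ) 1, ENNReal.ofReal ‖deriv c t‖ := by
  rcases eq_or_ne (c 1 - c 0) 0 with h0 | h0
  · simp [h0]
  -- Projection onto the direction of the chord: u = Re(ac) is absolutely continuous, rises by the
  -- chord length, and satisfies |u'| ≤ |c'| almost everywhere.
  set a : ℂ := conj ((c 1 - c 0) / (‖c 1 - c 0‖ : ℂ)) with ha
  have hna : ‖a‖ = 1 := by rw [ha, RCLike.norm_conj, norm_div_norm h0]
  set u : ℝ → ℝ := fun t => (a * c t).re with hu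
  have hau : AbsolutelyContinuousOnInterval u 0 1 := by
    refine LipschitzOnWith.absolutelyContinuousOnInterval (K := L) ?_
    rw [uIcc_of_le zero_le_one]
    refine LipschitzOnWith.of_dist_le_mul fun s hs t ht => ?_
    refine le_trans ?_ (hc.dist_le_mul s hs t ht)
    rw [Real.dist_eq, dist_eq_norm, hu]
    simp only
    rw [← Complex.sub_re, ← mul_sub]
    refine (Complex.abs_re_le_norm _).trans ?_
    rw [norm_mul, hna, one_mul]
  have hval : u 1 - u 0 = ‖c 1 - c 0‖ := by
    rw [hu]
    simp only
    rw [← Complex.sub_re, ← mul_sub, ha, map_div₀, Complex.conj_ofReal, div_mul_eq_mul_div, mul_comm,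
      Complex.mul_conj, Complex.normSq_eq_norm_sq, ← Complex.ofReal_div, Complex.ofReal_re]
    have := norm_ne_zero_iff.2 h0
    field_simp
  have hae : ∀ᵐ t ∂(volume.restrict (Ioo (0 : ℝ) 1)), |deriv u t| ≤ ‖deriv c t‖ := by
    rw [ae_restrict_iff' measurableSet_Ioo]
    filter_upwards [hc.ae_differentiableWithinAt_of_mem (μ := volume)] with t ht htI
    have hd : DifferentiableAt ℝ c t := (ht (Ioo_subset_Icc_self htI)).differentiableAt
      (Icc_mem_nhds htI.1 htI.2)
    have h1 : HasDerivAt u (a * deriv c t).re t :=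
      Complex.reCLM.hasFDerivAt.comp_hasDerivAt t (hd.hasDerivAt.const_mul a)
    rw [h1.deriv]
    refine (Complex.abs_re_le_norm _).trans ?_
    rw [norm_mul, hna, one_mul]
  rw [← hval, ← hau.integral_deriv_eq_sub, intervalIntegral.integral_of_le zero_le_one,
    integral_Ioc_eq_integral_Ioo]
  have hle : ENNReal.ofReal (∫ t in Ioo (0 : ℝ) 1, deriv u t) ≤
      ∫⁻ t in Ioo (0 : ℝ) 1, ‖deriv u t‖ₑ := by
    refine le_trans ?_ (enorm_integral_le_lintegral_enorm _)
    rw [← ofReal_norm, Real.norm_eq_abs]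
    exact ENNReal.ofReal_le_ofReal (le_abs_self _)
  refine hle.trans (lintegral_mono_ae (hae.mono fun t ht => ?_))
  rw [← ofReal_norm, Real.norm_eq_abs]
  exact ENNReal.ofReal_le_ofReal ht

lemma closure_annulus_subset (R : ℝ) : closure (annulus R 1) ⊆ closedAnnulus R 1 :=
  closure_minimal (fun z (hz : R < ‖z‖ ∧ ‖z‖ < 1) => (⟨hz.1.le, hz.2.le⟩ : R ≤ ‖z‖ ∧ ‖z‖ ≤ 1))
    (isCompact_closedAnnulus R 1).isClosed

lemma norm_of_mem_frontier_annulus {R : ℝ} {b : ℂ} (hb : b ∈ frontier (annulus R 1)) :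
    ‖b‖ = R ∨ ‖b‖ = 1 := by
  rw [(isOpen_annulus R 1).frontier_eq] at hb
  have hcl := closure_annulus_subset R hb.1
  by_contra hcon
  push Not at hcon
  exact hb.2 ⟨hcl.1.lt_of_ne' hcon.1, hcl.2.lt_of_ne hcon.2⟩

/-- The Euclidean distance to the boundary of `A(R,1)`. -/
def edist₁ (R : ℝ) (w : ℂ) : ℝ := min (‖w‖ - R) (1 - ‖w‖)

/-- An arc to the boundary has Euclidean length at least the difference of the moduli of its
endpoints. Together with `boundaryDist_le` this translates control of the metric distance into
control of |w|. -/
lemma ofReal_le_boundaryDist {R m : ℝ} {ρ : ℝ → ℝ} (hm : 0 ≤ m)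
    (hρ : ∀ t ∈ Icc R 1, m ≤ ρ t) {w : ℂ} (hw : w ∈ closedAnnulus R 1) :
    ENNReal.ofReal (m * edist₁ R w) ≤ boundaryDist (annulus R 1) (radial ρ) w := by
  rw [boundaryDist]
  split_ifs with hwm
  · refine le_iInf₂ fun b hb => le_iInf₂ fun c hc => ?_
    obtain ⟨L, hL⟩ := hc.lipschitz
    have h1 : edist₁ R w ≤ ‖c 1 - c 0‖ := by
      rw [hc.source, hc.target]
      have h2 := norm_sub_norm_le b w
      have h3 := norm_sub_norm_le w b
      rw [norm_sub_rev] at h3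
      rcases norm_of_mem_frontier_annulus hb with hb | hb
      · exact (min_le_left _ _).trans (by linarith)
      · exact (min_le_right _ _).trans (by linarith)
    calc ENNReal.ofReal (m * edist₁ R w) ≤ ENNReal.ofReal m * ENNReal.ofReal ‖c 1 - c 0‖ := by
          rw [← ENNReal.ofReal_mul hm]
          exact ENNReal.ofReal_le_ofReal (mul_le_mul_of_nonneg_left h1 hm)
      _ ≤ ENNReal.ofReal m * ∫⁻ t in Ioo (0 : ℝ) 1, ENNReal.ofReal ‖deriv c t‖ := by
          gcongr
          exact ofReal_norm_sub_le_length hL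
      _ = ∫⁻ t in Ioo (0 : ℝ) 1, ENNReal.ofReal m * ENNReal.ofReal ‖deriv c t‖ :=
          (lintegral_const_mul' _ _ ENNReal.ofReal_ne_top).symm
      _ ≤ _ := by
          refine setLIntegral_mono' measurableSet_Ioo fun t ht => ?_
          have hct := hc.mem t ⟨ht.1.le, ht.2⟩
          rw [← ENNReal.ofReal_mul hm]
          exact ENNReal.ofReal_le_ofReal (mul_le_mul_of_nonneg_right
            (hρ _ ⟨hct.1.le, hct.2.le⟩) (norm_nonneg _))
  · have : edist₁ R w = 0 := by
      have h1 := hw.1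
      have h2 := hw.2
      rcases eq_or_lt_of_le h1 with h | h
      · rw [edist₁, ← h, sub_self]
        exact min_eq_left (by linarith)
      · have h3 : ‖w‖ = 1 := by
          by_contra h4
          exact hwm ⟨h, lt_of_le_of_ne h2 h4⟩
        rw [edist₁, h3, sub_self]
        exact min_eq_right (by linarith)
    simp [this]

/-- The competing arc is the radial segment from w to the circle of radius l. -/
lemma boundaryDist_le_of_radial {R M l : ℝ} {ρ : ℝ → ℝ} (hR : 0 < R)
    (hρ : ∀ t ∈ Icc R 1, ρ t ≤ M) {w : ℂ} (hw : w ∈ annulus R 1) (hl : l = R ∨ l = 1) (hR1 : R < 1) :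
    boundaryDist (annulus R 1) (radial ρ) w ≤ ENNReal.ofReal (M * |l - ‖w‖|) := by
  have hw0 : 0 < ‖w‖ := hR.trans hw.1
  have hl0 : 0 < l := by rcases hl with rfl | rfl <;> linarith
  have hne : l - ‖w‖ ≠ 0 := by
    rcases hl with rfl | rfl
    · linarith [hw.1]
    · linarith [hw.2]
  set e : ℂ := w / (‖w‖ : ℂ) with he
  have hen : ‖e‖ = 1 := norm_div_norm (norm_pos_iff.1 hw0)
  set c : ℝ → ℂ := fun t => ((‖w‖ + t * (l - ‖w‖) : ℝ) : ℂ) * e with hc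
  have hcd : ∀ t, HasDerivAt c (((l - ‖w‖ : ℝ) : ℂ) * e) t := by
    intro t
    have h1 : HasDerivAt (fun t : ℝ => ‖w‖ + t * (l - ‖w‖)) (l - ‖w‖) t := by
      simpa using ((hasDerivAt_id t).mul_const (l - ‖w‖)).const_add ‖w‖
    exact (Complex.ofRealCLM.hasFDerivAt.comp_hasDerivAt t h1).mul_const e
  have hpos : ∀ t ∈ Icc (0 : ℝ) 1, 0 < ‖w‖ + t * (l - ‖w‖) := fun t ht => by
    rcases eq_or_lt_of_le ht.1 with h | h
    · rw [← h]; simpa using hw0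
    · nlinarith [ht.2, mul_pos h hl0]
  have hnorm : ∀ t ∈ Icc (0 : ℝ) 1, ‖c t‖ = ‖w‖ + t * (l - ‖w‖) := fun t ht => by
    rw [hc]
    simp only
    rw [norm_mul, hen, mul_one, Complex.norm_real, Real.norm_eq_abs, abs_of_pos (hpos t ht)]
  have hmem : ∀ t ∈ Ico (0 : ℝ) 1, c t ∈ annulus R 1 := fun t ht => by
    change _ < _ ∧ _ < _
    rw [hnorm t ⟨ht.1, ht.2.le⟩]
    have h1 := hw.1
    have h2 := hw.2
    rcases hl with rfl | rfl
    · constructor <;> nlinarith [ht.1, ht.2]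
    · constructor <;> nlinarith [ht.1, ht.2]
  have hlip : LipschitzWith (Real.nnabs (l - ‖w‖)) c := by
    refine LipschitzWith.of_dist_le_mul fun s t => ?_
    rw [dist_eq_norm, hc]
    simp only
    rw [← sub_mul, norm_mul, hen, mul_one, ← Complex.ofReal_sub, Complex.norm_real, Real.dist_eq,
      Real.norm_eq_abs, Real.coe_nnabs, ← abs_mul]
    apply le_of_eq
    congr 1
    ring
  have h1 : c 1 = (l : ℂ) * e := by simp [hc]
  have hfr : c 1 ∈ frontier (annulus R 1) := by
    rw [(isOpen_annulus R 1).frontier_eq]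
    refine ⟨?_, fun h => ?_⟩
    · have ht : Tendsto c (𝓝[<] 1) (𝓝 (c 1)) :=
        (hcd 1).continuousAt.tendsto.mono_left nhdsWithin_le_nhds
      refine mem_closure_of_tendsto ht ?_
      filter_upwards [Ioo_mem_nhdsLT (zero_lt_one (α := ℝ))] with t ht
      exact hmem t ⟨ht.1.le, ht.2⟩
    · change _ < _ ∧ _ < _ at h
      rw [hnorm 1 (right_mem_Icc.2 zero_le_one)] at h
      rcases hl with rfl | rfl
      · linarith [h.1]
      · linarith [h.2]
  have harc : IsArc (annulus R 1) w (c 1) c :=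
    { lipschitz := ⟨_, hlip.lipschitzOnWith⟩
      injOn := fun s hs t ht hst => by
        have := congrArg norm hst
        rw [hnorm s hs, hnorm t ht] at this
        have h2 : (s - t) * (l - ‖w‖) = 0 := by linarith
        exact sub_eq_zero.1 ((mul_eq_zero.1 h2).resolve_right hne)
      source := by
        have : (‖w‖ : ℂ) ≠ 0 := by exact_mod_cast hw0.ne'
        simp [hc, he]
        field_simp
      target := rfl
      mem := hmem }
  rw [boundaryDist, if_pos hw]
  refine (iInf₂_le (c 1) hfr).trans ((iInf₂_le c harc).trans ?_)
  calc ∫⁻ t in Ioo (0 : ℝ) 1, ENNReal.ofReal (radial ρ (c t) * ‖deriv c t‖)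
      ≤ ∫⁻ _ in Ioo (0 : ℝ) 1, ENNReal.ofReal (M * |l - ‖w‖|) := by
        refine setLIntegral_mono' measurableSet_Ioo fun t ht => ENNReal.ofReal_le_ofReal ?_
        have h := hmem t ⟨ht.1.le, ht.2⟩
        rw [(hcd t).deriv, norm_mul, hen, mul_one, Complex.norm_real, Real.norm_eq_abs]
        exact mul_le_mul_of_nonneg_right (hρ _ ⟨h.1.le, h.2.le⟩) (abs_nonneg _)
    _ = _ := by simp

lemma boundaryDist_le {R M : ℝ} {ρ : ℝ → ℝ} (hR : 0 < R) (hR1 : R < 1)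
    (hρ : ∀ t ∈ Icc R 1, ρ t ≤ M) (w : ℂ) :
    boundaryDist (annulus R 1) (radial ρ) w ≤ ENNReal.ofReal (M * edist₁ R w) := by
  by_cases hw : w ∈ annulus R 1
  · have h1 := boundaryDist_le_of_radial hR hρ hw (Or.inl rfl) hR1
    have h2 := boundaryDist_le_of_radial hR hρ hw (Or.inr rfl) hR1
    rw [abs_sub_comm, abs_of_pos (sub_pos.2 hw.1)] at h1
    rw [abs_of_pos (sub_pos.2 hw.2)] at h2
    rcases min_choice (‖w‖ - R) (1 - ‖w‖) with h | h
    · rwa [edist₁, h]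
    · rwa [edist₁, h]
  · rw [boundaryDist, if_neg hw]
    exact zero_le

/-! ### The boundary correspondence of deformations -/

lemma IsDiffeo.image_mem_nhds {Ω Ω' : Set ℂ} (hΩ : IsOpen Ω) {h : ℂ → ℂ} (hh : IsDiffeo Ω Ω' h)
    {z : ℂ} (hz : z ∈ Ω) : map h (𝓝 z) = 𝓝 (h z) := by
  have hs : HasStrictFDerivAt h (fderiv ℝ h z) z :=
    (hh.smooth.contDiffAt (hΩ.mem_nhds hz)).hasStrictFDerivAt (by simp)
  have hs' : HasStrictFDerivAt h
      ((fderiv ℝ h z).toContinuousLinearEquivOfDetNeZero (hh.jacobian_pos z hz).ne' : ℂ →L[ℝ] ℂ) z := by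
    rwa [ContinuousLinearMap.coe_toContinuousLinearEquivOfDetNeZero]
  exact hs'.map_nhds_eq_of_equiv

/-- Diffeomorphisms are proper. -/
lemma IsDiffeo.isCompact_preimage {Ω Ω' : Set ℂ} (hΩ : IsOpen Ω) {h : ℂ → ℂ}
    (hh : IsDiffeo Ω Ω' h) {K : Set ℂ} (hK : IsCompact K) (hKΩ : K ⊆ Ω') :
    IsCompact (Ω ∩ h ⁻¹' K) := by
  set g := Function.invFunOn h Ω with hg
  have hgm : ∀ w ∈ Ω', g w ∈ Ω ∧ h (g w) = w := fun w hw =>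
    ⟨Function.invFunOn_mem (hh.bijOn.surjOn hw), Function.invFunOn_eq (hh.bijOn.surjOn hw)⟩
  have hgc : ContinuousOn g K := by
    intro w hw
    have h1 := hgm w (hKΩ hw)
    have key : ContinuousWithinAt g Ω' w := by
      intro V hV
      have h2 : h '' (V ∩ Ω) ∈ 𝓝 w := by
        have h3 := hh.image_mem_nhds hΩ h1.1
        rw [h1.2] at h3
        rw [← h3]
        exact image_mem_map (inter_mem hV (hΩ.mem_nhds h1.1))
      refine mem_nhdsWithin_of_mem_nhds (mem_of_superset h2 ?_)
      rintro _ ⟨z, hz, rfl⟩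
      have h4 := hgm (h z) (hh.bijOn.mapsTo hz.2)
      have h5 : g (h z) = z := hh.bijOn.injOn h4.1 hz.2 h4.2
      change g (h z) ∈ V
      rw [h5]
      exact hz.1
    exact key.mono hKΩ
  have himg : Ω ∩ h ⁻¹' K = g '' K := by
    ext z
    refine ⟨fun hz => ⟨h z, hz.2, ?_⟩, ?_⟩
    · have h4 := hgm (h z) (hKΩ hz.2)
      exact hh.bijOn.injOn h4.1 hz.1 h4.2
    · rintro ⟨w, hw, rfl⟩
      have h4 := hgm w (hKΩ hw)
      exact ⟨h4.1, by rw [mem_preimage, h4.2]; exact hw⟩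
  rw [himg]
  exact hK.image_of_continuousOn hgc

lemma exists_subset_closedAnnulus {a b s₁ s₂ : ℝ} (h₁ : a < s₁) (h₂ : s₂ < b) {C : Set ℂ}
    (hC : IsCompact C) (hCs : C ⊆ annulus a b) :
    ∃ r₁ r₂, a < r₁ ∧ r₁ ≤ s₁ ∧ s₂ ≤ r₂ ∧ r₂ < b ∧ C ⊆ closedAnnulus r₁ r₂ := by
  rcases C.eq_empty_or_nonempty with rfl | hne
  · exact ⟨s₁, s₂, h₁, le_rfl, le_rfl, h₂, empty_subset _⟩
  obtain ⟨z₁, hz₁, hm₁⟩ := hC.exists_isMinOn hne continuous_norm.continuousOn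
  obtain ⟨z₂, hz₂, hm₂⟩ := hC.exists_isMaxOn hne continuous_norm.continuousOn
  exact ⟨min s₁ ‖z₁‖, max s₂ ‖z₂‖, lt_min h₁ (hCs hz₁).1, min_le_left _ _, le_max_left _ _,
    max_lt h₂ (hCs hz₂).2, fun z hz => ⟨(min_le_right _ _).trans (hm₁ hz),
      (hm₂ hz).trans (le_max_right _ _)⟩⟩

/-- A circle is mapped to one side of a gap if it avoids the gap. -/
lemma forall_norm_le_or {U : Set ℂ} {h : ℂ → ℂ} (hc : ContinuousOn h U) {s α β : ℝ} (hαβ : α < β)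
    (hs : 0 < s) (hsU : ∀ z : ℂ, ‖z‖ = s → z ∈ U)
    (hgap : ∀ z : ℂ, ‖z‖ = s → ‖h z‖ ≤ α ∨ β ≤ ‖h z‖) :
    (∀ z, ‖z‖ = s → ‖h z‖ ≤ α) ∨ ∀ z, ‖z‖ = s → β ≤ ‖h z‖ := by
  have hpc : Continuous fun θ : ℝ => polar (s, θ) :=
    (contDiff_polar (n := 0)).continuous.comp (by fun_prop)
  have hns : ∀ θ : ℝ, ‖polar (s, θ)‖ = s := fun θ => by rw [norm_polar, abs_of_pos hs]
  have hcc : Continuous fun θ : ℝ => ‖h (polar (s, θ))‖ :=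
    (hc.comp_continuous hpc fun θ => hsU _ (hns θ)).norm
  have hex : ∀ z : ℂ, ‖z‖ = s → ∃ θ : ℝ, polar (s, θ) = z := fun z hz =>
    ⟨z.arg, by rw [polar, ← hz]; exact Complex.norm_mul_exp_arg_mul_I z⟩
  by_contra hcon
  push Not at hcon
  obtain ⟨⟨z₁, hz₁, h₁⟩, ⟨z₂, hz₂, h₂⟩⟩ := hcon
  obtain ⟨θ₁, rfl⟩ := hex z₁ hz₁
  obtain ⟨θ₂, rfl⟩ := hex z₂ hz₂
  have h₂' : ‖h (polar (s, θ₂))‖ ≤ α := (hgap _ hz₂).resolve_right h₂.not_ge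
  -- If both sides occurred, the intermediate value theorem would produce a value in the middle of
  -- the gap.
  obtain ⟨θ, hθ⟩ := mem_range_of_exists_le_of_exists_ge hcc
    (c := (α + β) / 2) ⟨θ₂, by linarith⟩ ⟨θ₁, by
      have := (hgap _ hz₁).resolve_left h₁.not_ge; linarith⟩
  simp only at hθ
  rcases hgap _ (hns θ) with h | h <;> linarith

/-- On a large closed annulus a deformation is close to a diffeomorphism with the same boundary
correspondence. -/
lemma CDeltaTendsto.exists_diffeo {r R m M : ℝ} (hr : 0 ≤ r) (hR : 0 < R) (hR1 : R < 1)
    {ρ : ℝ → ℝ} (hm : 0 < m) (hρm : ∀ t ∈ Icc R 1, m ≤ ρ t) (hρM : ∀ t ∈ Icc R 1, ρ t ≤ M)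
    {g : ℂ → ℂ} {hj : ℕ → ℂ → ℂ} (hdiff : ∀ j, IsDiffeo (annulus r 1) (annulus R 1) (hj j))
    (hg : MapsTo g (annulus r 1) (closure (annulus R 1)))
    (hlim : CDeltaTendsto (annulus r 1) (annulus R 1) (radial ρ) hj g)
    {δ : ℝ} (hδ0 : 0 < δ) (hδ : R + δ < 1 - δ) {s₁ s₂ : ℝ} (h₁ : r < s₁) (h₁₂ : s₁ ≤ s₂)
    (h₂ : s₂ < 1) :
    ∃ r₁ r₂ σ h, r < r₁ ∧ r₁ ≤ s₁ ∧ s₂ ≤ r₂ ∧ r₂ < 1 ∧ IsDiffeo (annulus r 1) (annulus R 1) h ∧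
      Corresponds R δ r₁ r₂ σ g ∧ winding h r₁ = 2 * Real.pi * σ ∧
      ∀ z ∈ closedAnnulus r₁ r₂, ‖h z - g z‖ < R / 2 := by
  have hM : 0 < M := hm.trans_le ((hρm R (left_mem_Icc.2 hR1.le)).trans
    (hρM R (left_mem_Icc.2 hR1.le)))
  have hmδ : 0 < m * δ / 3 := by positivity
  obtain ⟨J, hJ⟩ := eventually_atTop.1 (hlim.boundary _ (ENNReal.ofReal_pos.2 hmδ))
  -- Points within Euclidean distance η of the boundary have metric distance at most Mη = mδ/3.
  -- Passing from h_J to g and from g to h_j adds two more thirds, and mδ in the metric means at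
  -- most δ in the modulus.
  set η := m * δ / 3 / M with hη
  have hη0 : 0 < η := by positivity
  have hMη : M * η = m * δ / 3 := by rw [hη]; field_simp
  have hCsub : closedAnnulus (R + η) (1 - η) ⊆ annulus R 1 :=
    closedAnnulus_subset (by linarith) (by linarith)
  -- Properness of the single diffeomorphism h_J: outside this annulus it is close to the boundary,
  -- and so are g and all later h_j.
  obtain ⟨t₁, t₂, ht₁, hts₁, hts₂, ht₂, hC⟩ := exists_subset_closedAnnulus h₁ h₂
    ((hdiff J).isCompact_preimage (isOpen_annulus r 1) (isCompact_closedAnnulus _ _) hCsub)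
    inter_subset_left
  have side : ∀ w : ℂ, w ∈ closedAnnulus R 1 →
      boundaryDist (annulus R 1) (radial ρ) w ≤ ENNReal.ofReal (m * δ) →
      ‖w‖ ≤ R + δ ∨ 1 - δ ≤ ‖w‖ := by
    intro w hw hb
    have h3 := (ofReal_le_boundaryDist hm.le hρm hw).trans hb
    rw [ENNReal.ofReal_le_ofReal_iff (by positivity)] at h3
    have h4 : edist₁ R w ≤ δ := le_of_mul_le_mul_left h3 hm
    rcases min_le_iff.1 h4 with h5 | h5
    · left; linarith
    · right; linarith
  have hbJ : ∀ z ∈ annulus r 1, z ∉ closedAnnulus t₁ t₂ →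
      boundaryDist (annulus R 1) (radial ρ) (hj J z) ≤ ENNReal.ofReal (m * δ / 3) := by
    intro z hz hzt
    refine (boundaryDist_le hR hR1 hρM _).trans (ENNReal.ofReal_le_ofReal ?_)
    rw [← hMη]
    refine mul_le_mul_of_nonneg_left ?_ hM.le
    have h3 : ¬ (R + η ≤ ‖hj J z‖ ∧ ‖hj J z‖ ≤ 1 - η) := fun h => hzt (hC ⟨hz, h⟩)
    rcases not_and_or.1 h3 with h4 | h4
    · exact (min_le_left _ _).trans (by linarith [not_le.1 h4])
    · exact (min_le_right _ _).trans (by linarith [not_le.1 h4])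
  have hbg : ∀ z ∈ annulus r 1, z ∉ closedAnnulus t₁ t₂ →
      boundaryDist (annulus R 1) (radial ρ) (g z) ≤
        ENNReal.ofReal (m * δ / 3) + ENNReal.ofReal (m * δ / 3) := fun z hz hzt =>
    ((hJ J le_rfl z hz).2).trans (by gcongr; exact hbJ z hz hzt)
  have hsum : ENNReal.ofReal (m * δ / 3) + ENNReal.ofReal (m * δ / 3) +
      ENNReal.ofReal (m * δ / 3) = ENNReal.ofReal (m * δ) := by
    rw [← ENNReal.ofReal_add hmδ.le hmδ.le, ← ENNReal.ofReal_add (by positivity) hmδ.le]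
    congr 1
    ring
  have hoffg : ∀ z ∈ annulus r 1, z ∉ closedAnnulus t₁ t₂ → ‖g z‖ ≤ R + δ ∨ 1 - δ ≤ ‖g z‖ :=
    fun z hz hzt => side _ (closure_annulus_subset R (hg hz))
      ((hbg z hz hzt).trans (hsum ▸ le_self_add))
  have hoffj : ∀ j ≥ J, ∀ z ∈ annulus r 1, z ∉ closedAnnulus t₁ t₂ →
      ‖hj j z‖ ≤ R + δ ∨ 1 - δ ≤ ‖hj j z‖ := fun j hjJ z hz hzt =>
    side _ (closure_annulus_subset R (subset_closure ((hdiff j).bijOn.mapsTo hz)))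
      (((hJ j hjJ z hz).1).trans ((by gcongr; exact hbg z hz hzt : _ ≤ _).trans hsum.le))
  -- The circles must lie outside the annulus t₁ ≤ |z| ≤ t₂ yet compactly inside the domain, so
  -- midpoints are taken.
  have hr₁ : r < (r + t₁) / 2 := by linarith
  have hr₁' : (r + t₁) / 2 < t₁ := by linarith
  have hr₂ : (t₂ + 1) / 2 < 1 := by linarith
  have hr₂' : t₂ < (t₂ + 1) / 2 := by linarith
  set r₁ := (r + t₁) / 2
  set r₂ := (t₂ + 1) / 2
  have hr0 : 0 < r₁ := hr.trans_lt hr₁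
  have hr₁₂ : r₁ ≤ r₂ := by linarith
  have hoff : ∀ z, z ∉ closedAnnulus r₁ r₂ → z ∉ closedAnnulus t₁ t₂ := fun z hz hzt =>
    hz ⟨hr₁'.le.trans hzt.1, hzt.2.trans hr₂'.le⟩
  have hK : closedAnnulus r₁ r₂ ⊆ annulus r 1 := closedAnnulus_subset hr₁ hr₂
  -- Closeness R/2 is for comparing windings later; closeness below the gap prevents g and h_j from
  -- lying on different sides.
  set κ := min (R / 2) (1 - δ - (R + δ)) with hκ
  have hκ0 : 0 < κ := lt_min (by linarith) (by linarith)
  have hunif := Metric.tendstoUniformlyOn_iff.1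
    (hlim.compact _ hK (isCompact_closedAnnulus r₁ r₂)) κ hκ0
  obtain ⟨j, hju, hjJ⟩ := (hunif.and (eventually_ge_atTop J)).exists
  have hclose : ∀ z ∈ closedAnnulus r₁ r₂, ‖hj j z - g z‖ < κ := fun z hz => by
    rw [← dist_eq_norm, dist_comm]; exact hju z hz
  have hin₁ : ∀ z : ℂ, ‖z‖ = r₁ → z ∈ closedAnnulus r₁ r₂ ∧ z ∉ closedAnnulus t₁ t₂ := fun z hz =>
    ⟨⟨hz.ge, hz.le.trans hr₁₂⟩, fun h => by have := h.1; linarith⟩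
  have hin₂ : ∀ z : ℂ, ‖z‖ = r₂ → z ∈ closedAnnulus r₁ r₂ ∧ z ∉ closedAnnulus t₁ t₂ := fun z hz =>
    ⟨⟨hr₁₂.trans hz.ge, hz.le⟩, fun h => by have := h.2; linarith⟩
  have hcj := (hdiff j).smooth.continuousOn
  obtain ⟨σ, hσ, hw⟩ := (hdiff j).winding_eq hr hR hδ0 hδ hr₁ hr₁₂ hr₂
    (fun z hz hz' => hoffj j hjJ z hz (hoff z hz'))
    (forall_norm_le_or hcj hδ hr0 (fun z hz => hK (hin₁ z hz).1)
      fun z hz => hoffj j hjJ z (hK (hin₁ z hz).1) (hin₁ z hz).2)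
    (forall_norm_le_or hcj hδ (hr0.trans_le hr₁₂) (fun z hz => hK (hin₂ z hz).1)
      fun z hz => hoffj j hjJ z (hK (hin₂ z hz).1) (hin₂ z hz).2)
  have small : ∀ z, z ∈ closedAnnulus r₁ r₂ ∧ z ∉ closedAnnulus t₁ t₂ → ‖hj j z‖ ≤ R + δ →
      ‖g z‖ ≤ R + δ := fun z hz h => by
    refine (hoffg z (hK hz.1) hz.2).resolve_right fun h' => ?_
    have h3 := hclose z hz.1
    have h4 := norm_sub_norm_le (g z) (hj j z)
    rw [norm_sub_rev] at h4
    have := min_le_right (R / 2) (1 - δ - (R + δ))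
    linarith
  have large : ∀ z, z ∈ closedAnnulus r₁ r₂ ∧ z ∉ closedAnnulus t₁ t₂ → 1 - δ ≤ ‖hj j z‖ →
      1 - δ ≤ ‖g z‖ := fun z hz h => by
    refine (hoffg z (hK hz.1) hz.2).resolve_left fun h' => ?_
    have h3 := hclose z hz.1
    have h4 := norm_sub_norm_le (hj j z) (g z)
    have := min_le_right (R / 2) (1 - δ - (R + δ))
    linarith
  refine ⟨r₁, r₂, σ, hj j, hr₁, by linarith, by linarith, hr₂, hdiff j, ?_, hw,
    fun z hz => (hclose z hz).trans_le (min_le_left _ _)⟩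
  rcases hσ with ⟨h3, h4, h5⟩ | ⟨h3, h4, h5⟩
  · exact Or.inl ⟨h3, fun z hz => small z (hin₁ z hz) (h4 z hz),
      fun z hz => large z (hin₂ z hz) (h5 z hz)⟩
  · exact Or.inr ⟨h3, fun z hz => large z (hin₁ z hz) (h4 z hz),
      fun z hz => small z (hin₂ z hz) (h5 z hz)⟩

/-! ### Limits of integrals of products -/

section Limits

variable {α : Type*} [MeasurableSpace α] {μ : Measure α}

/-- Hölder for UV - uv = (U-u)(V-v) + (U-u)v + u(V-v). -/
lemma tendsto_eLpNorm_mul {u v : α → ℂ} {U V : ℕ → α → ℂ} (hu : MemLp u 2 μ) (hv : MemLp v 2 μ)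
    (hU : ∀ n, AEStronglyMeasurable (U n) μ) (hV : ∀ n, AEStronglyMeasurable (V n) μ)
    (hUu : Tendsto (fun n => eLpNorm (U n - u) 2 μ) atTop (𝓝 0))
    (hVv : Tendsto (fun n => eLpNorm (V n - v) 2 μ) atTop (𝓝 0)) :
    Tendsto (fun n => eLpNorm (U n * V n - u * v) 1 μ) atTop (𝓝 0) := by
  have hle : ∀ n, eLpNorm (U n * V n - u * v) 1 μ ≤
      eLpNorm (U n - u) 2 μ * eLpNorm (V n - v) 2 μ + eLpNorm (U n - u) 2 μ * eLpNorm v 2 μ +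
        eLpNorm u 2 μ * eLpNorm (V n - v) 2 μ := fun n => by
    have hUn := (hU n).sub hu.1
    have hVn := (hV n).sub hv.1
    have e : U n * V n - u * v =
        (U n - u) • (V n - v) + (U n - u) • v + u • (V n - v) := by
      simp only [smul_eq_mul]; ring
    rw [e]
    refine (eLpNorm_add_le ((hUn.smul hVn).add (hUn.smul hv.1)) (hu.1.smul hVn) le_rfl).trans ?_
    refine add_le_add ((eLpNorm_add_le (hUn.smul hVn) (hUn.smul hv.1) le_rfl).trans
      (add_le_add ?_ ?_)) ?_
    · exact eLpNorm_smul_le_mul_eLpNorm hVn hUn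
    · exact eLpNorm_smul_le_mul_eLpNorm hv.1 hUn
    · exact eLpNorm_smul_le_mul_eLpNorm hVn hu.1
  refine tendsto_of_tendsto_of_tendsto_of_le_of_le tendsto_const_nhds ?_ (fun _ => zero_le) hle
  have h1 := ENNReal.Tendsto.mul hUu (Or.inr ENNReal.zero_ne_top) hVv (Or.inr ENNReal.zero_ne_top)
  have h2 := ENNReal.Tendsto.mul_const hUu (b := eLpNorm v 2 μ) (Or.inr hv.2.ne)
  have h3 := ENNReal.Tendsto.const_mul hVv (a := eLpNorm u 2 μ) (Or.inr hu.2.ne)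
  simpa using (h1.add h2).add h3

/-- Split BₙXₙ = Bₙ(Xₙ - x) + Bₙx. The first term is small in L¹, the second converges by dominated
convergence; pointwise convergence of bounded coefficients is enough. -/
lemma tendsto_integral_mul {B : ℕ → α → ℂ} {b : α → ℂ} {X : ℕ → α → ℂ} {x : α → ℂ} {C : ℝ}
    (hBm : ∀ n, AEStronglyMeasurable (B n) μ) (hB : ∀ n, ∀ᵐ z ∂μ, ‖B n z‖ ≤ C)
    (hBb : ∀ᵐ z ∂μ, Tendsto (fun n => B n z) atTop (𝓝 (b z)))
    (hXm : ∀ n, AEStronglyMeasurable (X n) μ) (hx : Integrable x μ)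
    (hXx : Tendsto (fun n => eLpNorm (X n - x) 1 μ) atTop (𝓝 0)) :
    Integrable (fun z => b z * x z) μ ∧
    Tendsto (fun n => ∫ z, B n z * X n z ∂μ) atTop (𝓝 (∫ z, b z * x z ∂μ)) := by
  have hbm : AEStronglyMeasurable b μ := aestronglyMeasurable_of_tendsto_ae atTop hBm hBb
  have hb : ∀ᵐ z ∂μ, ‖b z‖ ≤ C := by
    filter_upwards [hBb, ae_all_iff.2 hB] with z hz hz'
    exact le_of_tendsto hz.norm (Eventually.of_forall hz')
  have hbx : Integrable (fun z => b z * x z) μ := hx.bdd_mul hbm hb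
  have hdom : Tendsto (fun n => ∫ z, B n z * x z ∂μ) atTop (𝓝 (∫ z, b z * x z ∂μ)) := by
    refine tendsto_integral_of_dominated_convergence (fun z => C * ‖x z‖)
      (fun n => (hBm n).mul hx.1) (hx.norm.const_mul C) (fun n => ?_) ?_
    · filter_upwards [hB n] with z hz
      rw [norm_mul]
      gcongr
    · filter_upwards [hBb] with z hz
      exact hz.mul_const _
  have hXn : ∀ᶠ n in atTop, Integrable (X n) μ := by
    filter_upwards [hXx.eventually_lt_const ENNReal.zero_lt_top] with n hn
    have : MemLp (X n - x) 1 μ := ⟨(hXm n).sub hx.1, hn⟩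
    have h2 := (memLp_one_iff_integrable.1 this).add hx
    rwa [sub_add_cancel] at h2
  have hL1 : Tendsto (fun n => ∫ z, B n z * (X n - x) z ∂μ) atTop (𝓝 0) := by
    have h0 : Tendsto (fun n => ENNReal.ofReal C * eLpNorm (X n - x) 1 μ) atTop (𝓝 0) := by
      simpa using ENNReal.Tendsto.const_mul hXx (a := ENNReal.ofReal C) (Or.inr ENNReal.ofReal_ne_top)
    have h1 : Tendsto (fun n => eLpNorm ((fun z => B n z * (X n - x) z) - fun _ => (0 : ℂ)) 1 μ)
        atTop (𝓝 0) := by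
      refine tendsto_of_tendsto_of_tendsto_of_le_of_le tendsto_const_nhds h0 (fun _ => zero_le)
        fun n => ?_
      refine eLpNorm_le_mul_eLpNorm_of_ae_le_mul ?_ 1
      filter_upwards [hB n] with z hz
      simp only [Pi.sub_apply, sub_zero, norm_mul]
      gcongr
    have h2 := tendsto_integral_of_L1' (fun _ : α => (0 : ℂ)) aestronglyMeasurable_const ?_ h1
    · simpa using h2
    · filter_upwards [hXn] with n hn
      exact (hn.sub hx).bdd_mul (hBm n) (hB n)
  refine ⟨hbx, ?_⟩
  have := hL1.add hdom
  rw [zero_add] at this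
  refine this.congr' ?_
  filter_upwards [hXn] with n hn
  rw [← integral_add ((hn.sub hx).bdd_mul (hBm n) (hB n)) (hx.bdd_mul (hBm n) (hB n))]
  refine integral_congr_ae (ae_of_all _ fun z => ?_)
  simp only [Pi.sub_apply]
  ring

end Limits

/-! ### Smooth approximation of the differential -/

/-- A sequence of smooth maps that approximates `g` uniformly on `K`, with differentials converging
to `D` in `L²(K)`. -/
structure ApproxOn (K : Set ℂ) (ε : ℝ) (G : ℕ → ℂ → ℂ) (g : ℂ → ℂ) (D : ℂ → ℂ →L[ℝ] ℂ) : Prop where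
  smooth : ∀ n, ContDiff ℝ ∞ (G n)
  le : ∀ n, ∀ z ∈ K, ‖G n z - g z‖ ≤ ε
  tendsto : ∀ z ∈ K, Tendsto (fun n => G n z) atTop (𝓝 (g z))
  memLp : MemLp D 2 (volume.restrict K)
  tendsto_diff : Tendsto (fun n => eLpNorm (fderiv ℝ (G n) - D) 2 (volume.restrict K)) atTop (𝓝 0)

lemma HasWeakDiff.exists_approxOn {Ω : Set ℂ} (hΩ : IsOpen Ω) {g : ℂ → ℂ}
    {D : ℂ → ℂ →L[ℝ] ℂ} (hD : HasWeakDiff Ω g D) (hg : ContinuousOn g Ω) {K : Set ℂ}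
    (hKΩ : K ⊆ Ω) (hK : IsCompact K) {ε : ℝ} (hε : 0 < ε) : ∃ G, ApproxOn K ε G g D := by
  have hεn : ∀ n : ℕ, 0 < ε / (n + 1) := fun n => by positivity
  choose G hG hGg hGD using fun n : ℕ => hD.exists_smooth_approx hΩ hg hKΩ hK (hεn n)
  have hlim : Tendsto (fun n : ℕ => ε / ((n : ℝ) + 1)) atTop (𝓝 0) := by
    have := (tendsto_one_div_add_atTop_nhds_zero_nat (𝕜 := ℝ)).const_mul ε
    simpa only [mul_one_div, mul_zero] using this
  refine ⟨G, hG, fun n z hz => (hGg n z hz).trans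
    (div_le_self hε.le (by linarith [n.cast_nonneg (α := ℝ)])), fun z hz => ?_,
    hD.memLp_diff K hKΩ hK, ?_⟩
  · rw [tendsto_iff_norm_sub_tendsto_zero]
    exact squeeze_zero (fun _ => norm_nonneg _) (fun n => hGg n z hz) hlim
  · refine tendsto_of_tendsto_of_tendsto_of_le_of_le tendsto_const_nhds ?_ (fun _ => zero_le) hGD
    have := (ENNReal.continuous_ofReal.tendsto 0).comp hlim
    rwa [ENNReal.ofReal_zero] at this

lemma ApproxOn.mono {K K' : Set ℂ} {ε : ℝ} {G : ℕ → ℂ → ℂ} {g : ℂ → ℂ} {D : ℂ → ℂ →L[ℝ] ℂ}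
    (h : ApproxOn K' ε G g D) (hK : K ⊆ K') : ApproxOn K ε G g D where
  smooth := h.smooth
  le := fun n z hz => h.le n z (hK hz)
  tendsto := fun z hz => h.tendsto z (hK hz)
  memLp := h.memLp.mono_measure (Measure.restrict_mono_set _ hK)
  tendsto_diff := tendsto_of_tendsto_of_tendsto_of_le_of_le tendsto_const_nhds h.tendsto_diff
    (fun _ => zero_le) fun _ => eLpNorm_mono_measure _ (Measure.restrict_mono_set _ hK)

section

variable {K : Set ℂ} {ε : ℝ} {G : ℕ → ℂ → ℂ} {g : ℂ → ℂ} {D : ℂ → ℂ →L[ℝ] ℂ}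

lemma ApproxOn.continuous_fderiv (h : ApproxOn K ε G g D) (n : ℕ) : Continuous (fderiv ℝ (G n)) :=
  (h.smooth n).continuous_fderiv (by simp)

lemma memLp_apply {μ : Measure ℂ} (hD : MemLp D 2 μ) {v : ℂ → ℂ} (hv : Continuous v) {C : ℝ}
    (hC : ∀ᵐ z ∂μ, ‖v z‖ ≤ C) : MemLp (fun z => D z (v z)) 2 μ := by
  refine hD.of_le_mul (c := C) ?_ ?_
  · exact (ContinuousLinearMap.apply ℝ ℂ).flip.aestronglyMeasurable_comp₂ hD.1
      hv.aestronglyMeasurable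
  · filter_upwards [hC] with z hz
    rw [mul_comm]
    exact ((D z).le_opNorm _).trans (by gcongr)

lemma ApproxOn.tendsto_apply (h : ApproxOn K ε G g D) (hK : IsCompact K) {v : ℂ → ℂ} {C : ℝ}
    (hC : ∀ z ∈ K, ‖v z‖ ≤ C) :
    Tendsto (fun n => eLpNorm ((fun z => fderiv ℝ (G n) z (v z)) - fun z => D z (v z)) 2
      (volume.restrict K)) atTop (𝓝 0) := by
  have h0 : Tendsto (fun n => ENNReal.ofReal C *
      eLpNorm (fderiv ℝ (G n) - D) 2 (volume.restrict K)) atTop (𝓝 0) := by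
    simpa using ENNReal.Tendsto.const_mul h.tendsto_diff (a := ENNReal.ofReal C)
      (Or.inr ENNReal.ofReal_ne_top)
  refine tendsto_of_tendsto_of_tendsto_of_le_of_le tendsto_const_nhds h0 (fun _ => zero_le)
    fun n => ?_
  refine eLpNorm_le_mul_eLpNorm_of_ae_le_mul ?_ 2
  refine (ae_restrict_iff' hK.measurableSet).2 (ae_of_all _ fun z hz => ?_)
  simp only [Pi.sub_apply]
  rw [← sub_apply, mul_comm]
  exact (ContinuousLinearMap.le_opNorm _ _).trans (by gcongr; exact hC z hz)

lemma ApproxOn.tendsto_integral_apply (h : ApproxOn K ε G g D) (hK : IsCompact K) {v : ℂ → ℂ}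
    (hv : Continuous v) {C : ℝ} {B : ℕ → ℂ → ℂ} {b : ℂ → ℂ}
    (hBm : ∀ n, ContinuousOn (B n) K) (hB : ∀ n, ∀ z ∈ K, ‖B n z‖ ≤ C)
    (hBb : ∀ z ∈ K, Tendsto (fun n => B n z) atTop (𝓝 (b z))) :
    IntegrableOn (fun z => b z * D z (v z)) K ∧
    Tendsto (fun n => ∫ z in K, B n z * fderiv ℝ (G n) z (v z)) atTop
      (𝓝 (∫ z in K, b z * D z (v z))) := by
  have : IsFiniteMeasure (volume.restrict K) :=
    ⟨by rw [Measure.restrict_apply_univ]; exact hK.measure_lt_top⟩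
  have hKm := hK.measurableSet
  obtain ⟨Cv, hCv⟩ := hK.exists_bound_of_continuousOn hv.continuousOn
  have hCv' := (ae_restrict_iff' (μ := volume) hKm).2 (ae_of_all _ hCv)
  have hDv := memLp_apply h.memLp hv hCv'
  have hXm : ∀ n, AEStronglyMeasurable (fun z => fderiv ℝ (G n) z (v z)) (volume.restrict K) :=
    fun n => ((h.continuous_fderiv n).clm_apply hv).aestronglyMeasurable
  -- The product with the constant 1 turns L² convergence into L¹ convergence on a set of finite
  -- measure.
  have h1 := tendsto_eLpNorm_mul (memLp_const (1 : ℂ)) hDv (U := fun _ _ => 1)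
    (fun _ => aestronglyMeasurable_const) hXm (by simp) (h.tendsto_apply hK hCv)
  refine tendsto_integral_mul (fun n => (hBm n).aestronglyMeasurable hKm)
    (fun n => (ae_restrict_iff' hKm).2 (ae_of_all _ (hB n)))
    ((ae_restrict_iff' hKm).2 (ae_of_all _ hBb)) hXm (hDv.integrable one_le_two) ?_
  refine h1.congr fun n => ?_
  congr 1
  ext z
  simp

/-- The determinant Im(conj(D1) · Di) is bilinear in two L²-convergent factors, hence converges in
L¹. -/
lemma ApproxOn.tendsto_integral_det (h : ApproxOn K ε G g D) (hK : IsCompact K) {C : ℝ}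
    {B : ℕ → ℂ → ℝ} {b : ℂ → ℝ}
    (hBm : ∀ n, ContinuousOn (B n) K) (hB : ∀ n, ∀ z ∈ K, |B n z| ≤ C)
    (hBb : ∀ z ∈ K, Tendsto (fun n => B n z) atTop (𝓝 (b z))) :
    IntegrableOn (fun z => b z * (D z).det) K ∧
    Tendsto (fun n => ∫ z in K, B n z * (fderiv ℝ (G n) z).det) atTop
      (𝓝 (∫ z in K, b z * (D z).det)) := by
  have hKm := hK.measurableSet
  have hone : ∀ v : ℂ, MemLp (fun z => D z v) 2 (volume.restrict K) := fun v =>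
    memLp_apply h.memLp (v := fun _ => v) continuous_const (C := ‖v‖) (ae_of_all _ fun _ => le_rfl)
  have hXm : ∀ (v : ℂ) n, AEStronglyMeasurable (fun z => fderiv ℝ (G n) z v) (volume.restrict K) :=
    fun v n => ((h.continuous_fderiv n).clm_apply continuous_const).aestronglyMeasurable
  have hconj : ∀ {f : ℂ → ℂ}, AEStronglyMeasurable f (volume.restrict K) →
      AEStronglyMeasurable (fun z => conj (f z)) (volume.restrict K) := fun hf =>
    Complex.continuous_conj.comp_aestronglyMeasurable hf
  have hu : MemLp (fun z => conj (D z 1)) 2 (volume.restrict K) :=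
    (hone 1).of_le (hconj (hone 1).1) (ae_of_all _ fun z => by simp)
  have hU : Tendsto (fun n => eLpNorm ((fun z => conj (fderiv ℝ (G n) z 1)) -
      fun z => conj (D z 1)) 2 (volume.restrict K)) atTop (𝓝 0) := by
    refine (h.tendsto_apply hK (v := fun _ => 1) (C := 1) (by simp)).congr fun n => ?_
    refine eLpNorm_congr_norm_ae (ae_of_all _ fun z => ?_)
    simp only [Pi.sub_apply]
    rw [← map_sub, Complex.norm_conj]
  have h1 := tendsto_eLpNorm_mul hu (hone Complex.I) (fun n => hconj (hXm 1 n)) (hXm Complex.I) hU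
    (h.tendsto_apply hK (v := fun _ => Complex.I) (C := 1) (by simp))
  obtain ⟨h2, h3⟩ := tendsto_integral_mul (B := fun n z => (B n z : ℂ)) (b := fun z => (b z : ℂ))
    (C := C) (μ := volume.restrict K)
    (fun n => (Complex.continuous_ofReal.comp_continuousOn (hBm n)).aestronglyMeasurable hKm)
    (fun n => (ae_restrict_iff' hKm).2 (ae_of_all _ fun z hz => by simpa using hB n z hz))
    ((ae_restrict_iff' hKm).2 (ae_of_all _ fun z hz =>
      (Complex.continuous_ofReal.tendsto _).comp (hBb z hz)))
    (fun n => (hconj (hXm 1 n)).mul (hXm Complex.I n))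
    (hu.integrable_mul (hone Complex.I)) h1
  have e : ∀ (c : ℝ) (T : ℂ →L[ℝ] ℂ), ((c : ℂ) * (conj (T 1) * T Complex.I)).im = c * T.det :=
    fun c T => by rw [Complex.im_ofReal_mul, det_eq]
  have h4 : ∀ n, Integrable (fun z => (B n z : ℂ) *
      ((fun z => conj (fderiv ℝ (G n) z 1)) * fun z => fderiv ℝ (G n) z Complex.I) z)
      (volume.restrict K) := fun n => by
    refine ContinuousOn.integrableOn_compact hK ?_
    refine (Complex.continuous_ofReal.comp_continuousOn (hBm n)).mul (Continuous.continuousOn ?_)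
    exact (Complex.continuous_conj.comp ((h.continuous_fderiv n).clm_apply continuous_const)).mul
      ((h.continuous_fderiv n).clm_apply continuous_const)
  refine ⟨?_, ?_⟩
  · refine (Complex.imCLM.integrable_comp h2).congr (ae_of_all _ fun z => ?_)
    exact e _ _
  · have h5 := (Complex.continuous_im.tendsto _).comp h3
    have h6 : (∫ z in K, b z * (D z).det) = (∫ z in K, (b z : ℂ) *
        ((fun z => conj (D z 1)) * fun z => D z Complex.I) z).im := by
      rw [← Complex.imCLM_apply, ← Complex.imCLM.integral_comp_comm h2]
      exact integral_congr_ae (ae_of_all _ fun z => (e _ _).symm)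
    rw [h6]
    refine h5.congr fun n => ?_
    simp only [Function.comp_apply]
    rw [← Complex.imCLM_apply, ← Complex.imCLM.integral_comp_comm (h4 n)]
    exact integral_congr_ae (ae_of_all _ fun z => e _ _)

end

/-! ### Integral identities for deformations -/

lemma normDiff_eq_re (w v : ℂ) : normDiff w v = (conj w * v).re / ‖w‖ := by
  rw [normDiff_apply]
  simp

/-- A primitive is constant where the integrand vanishes. -/
lemma integral_eq_zero_of_forall_uIcc {ψ : ℝ → ℝ} {a b : ℝ} (h : ∀ t ∈ uIcc a b, ψ t = 0) :
    ∫ t in a..b, ψ t = 0 := by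
  rw [intervalIntegral.integral_congr (g := fun _ => 0) h, intervalIntegral.integral_zero]

lemma Corresponds.mono {R δ δ' r₁ r₂ σ ε : ℝ} {g G : ℂ → ℂ} (h : Corresponds R δ r₁ r₂ σ g)
    (hG₁ : ∀ z, ‖z‖ = r₁ → ‖G z - g z‖ ≤ ε) (hG₂ : ∀ z, ‖z‖ = r₂ → ‖G z - g z‖ ≤ ε)
    (hδ : δ + ε ≤ δ') : Corresponds R δ' r₁ r₂ σ G := by
  have hle : ∀ z, ‖G z - g z‖ ≤ ε → ‖g z‖ ≤ R + δ → ‖G z‖ ≤ R + δ' := fun z hz h' => by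
    have := norm_sub_norm_le (G z) (g z)
    linarith
  have hge : ∀ z, ‖G z - g z‖ ≤ ε → 1 - δ ≤ ‖g z‖ → 1 - δ' ≤ ‖G z‖ := fun z hz h' => by
    have := norm_sub_norm_le (g z) (G z)
    rw [norm_sub_rev] at this
    linarith
  rcases h with ⟨hσ, h₁, h₂⟩ | ⟨hσ, h₁, h₂⟩
  · exact Or.inl ⟨hσ, fun z hz => hle z (hG₁ z hz) (h₁ z hz), fun z hz => hge z (hG₂ z hz) (h₂ z hz)⟩
  · exact Or.inr ⟨hσ, fun z hz => hge z (hG₁ z hz) (h₁ z hz), fun z hz => hle z (hG₂ z hz) (h₂ z hz)⟩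

lemma Corresponds.sq_eq_one {R δ r₁ r₂ σ : ℝ} {g : ℂ → ℂ} (h : Corresponds R δ r₁ r₂ σ g) :
    σ ^ 2 = 1 := by
  rcases h with ⟨rfl, -⟩ | ⟨rfl, -⟩ <;> norm_num

/-- The identities for smooth maps. -/
lemma Corresponds.integral_eq {R δ a b r₁ r₂ σ : ℝ} (ha : 0 ≤ a) (h₁ : a < r₁)
    (h₁₂ : r₁ ≤ r₂) (h₂ : r₂ < b) (hδ0 : 0 ≤ δ) {G : ℂ → ℂ}
    (hG : ContDiffOn ℝ 2 G (annulus a b)) (hG0 : ∀ z ∈ annulus a b, G z ≠ 0)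
    (hc : Corresponds R δ r₁ r₂ σ G) (hw : winding G r₁ = 2 * Real.pi * σ) {ψ : ℝ → ℝ}
    (hψ : Continuous ψ) (hψ0 : ∀ t, t ≤ R + δ ∨ 1 - δ ≤ t → ψ t = 0) :
    ∫ z in closedAnnulus r₁ r₂, ψ ‖G z‖ / ‖G z‖ * (fderiv ℝ G z).det =
      2 * Real.pi * ∫ t in R..1, ψ t ∧
    ∫ z in closedAnnulus r₁ r₂, ψ ‖G z‖ * normDiff (G z) (fderiv ℝ G z z) / ‖z‖ ^ 2 =
      2 * Real.pi * σ * ∫ t in R..1, ψ t := by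
  set Ψ : ℝ → ℝ := fun t => ∫ x in R..t, ψ x with hΨdef
  have hΨ : ∀ t, HasDerivAt Ψ (ψ t) t := fun t =>
    intervalIntegral.integral_hasDerivAt_right (hψ.intervalIntegrable _ _)
      (hψ.stronglyMeasurableAtFilter _ _) hψ.continuousAt
  have hΨ1 : ∀ t ≤ R + δ, Ψ t = 0 := fun t ht =>
    integral_eq_zero_of_forall_uIcc fun x hx => hψ0 x
      (Or.inl ((hx.2).trans (sup_le (by linarith) ht)))
  have hΨ2 : ∀ t, 1 - δ ≤ t → Ψ t = Ψ 1 := fun t ht => by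
    rw [hΨdef]
    simp only
    rw [← intervalIntegral.integral_add_adjacent_intervals
      (hψ.intervalIntegrable R 1) (hψ.intervalIntegrable 1 t), add_eq_left]
    exact integral_eq_zero_of_forall_uIcc fun x hx => hψ0 x
      (Or.inr ((le_inf (by linarith) ht).trans hx.1))
  have key : ∀ c₁ c₂, (∀ z, ‖z‖ = r₁ → Ψ ‖G z‖ = c₁) → (∀ z, ‖z‖ = r₂ → Ψ ‖G z‖ = c₂) →
      ∫ z in closedAnnulus r₁ r₂, ψ ‖G z‖ / ‖G z‖ * (fderiv ℝ G z).det =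
        2 * Real.pi * σ * (c₂ - c₁) ∧
      ∫ z in closedAnnulus r₁ r₂, ψ ‖G z‖ * normDiff (G z) (fderiv ℝ G z z) / ‖z‖ ^ 2 =
        2 * Real.pi * (c₂ - c₁) := fun c₁ c₂ hc₁ hc₂ => by
    rw [integral_jacobian ha h₁ h₁₂ h₂ hG hG0 hΨ hψ hc₁ hc₂,
      integral_radial_deriv ha h₁ h₁₂ h₂ hG hG0 hΨ hψ hc₁ hc₂, hw]
    exact ⟨rfl, rfl⟩
  -- In the Jacobian identity σ enters through the winding and through the order of the boundary
  -- values, and cancels; in the radial identity it enters only once.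
  rcases hc with ⟨rfl, hin, hout⟩ | ⟨rfl, hin, hout⟩
  · obtain ⟨e₁, e₂⟩ := key 0 (Ψ 1) (fun z hz => hΨ1 _ (hin z hz)) (fun z hz => hΨ2 _ (hout z hz))
    rw [e₁, e₂]
    constructor <;> ring
  · obtain ⟨e₁, e₂⟩ := key (Ψ 1) 0 (fun z hz => hΨ2 _ (hin z hz)) (fun z hz => hΨ1 _ (hout z hz))
    rw [e₁, e₂]
    constructor <;> ring

/-- The integral identities for a map `g` with weak differential `D` on the closed annulus
`{r₁ ≤ |z| ≤ r₂}`, where `R ≤ |g|` and the boundary correspondence is given by `σ`. -/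
structure HasIdentities (R δ r₁ r₂ σ : ℝ) (g : ℂ → ℂ) (D : ℂ → ℂ →L[ℝ] ℂ) : Prop where
  jacobian : ∀ ψ : ℝ → ℝ, Continuous ψ → (∀ t, t ≤ R + δ ∨ 1 - δ ≤ t → ψ t = 0) →
    IntegrableOn (fun z => ψ ‖g z‖ / ‖g z‖ * (D z).det) (closedAnnulus r₁ r₂) ∧
    ∫ z in closedAnnulus r₁ r₂, ψ ‖g z‖ / ‖g z‖ * (D z).det = 2 * Real.pi * ∫ t in R..1, ψ t
  radial_deriv : ∀ ψ : ℝ → ℝ, Continuous ψ → (∀ t, t ≤ R + δ ∨ 1 - δ ≤ t → ψ t = 0) →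
    IntegrableOn (fun z => ψ ‖g z‖ * normDiff (g z) (D z z) / ‖z‖ ^ 2) (closedAnnulus r₁ r₂) ∧
    ∫ z in closedAnnulus r₁ r₂, ψ ‖g z‖ * normDiff (g z) (D z z) / ‖z‖ ^ 2 =
      2 * Real.pi * σ * ∫ t in R..1, ψ t
  angular : IntegrableOn (fun z => (D z (Complex.I * z) / g z).im / ‖z‖ ^ 2) (closedAnnulus r₁ r₂) ∧
    ∫ z in closedAnnulus r₁ r₂, (D z (Complex.I * z) / g z).im / ‖z‖ ^ 2 =
      2 * Real.pi * σ * Real.log (r₂ / r₁)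

section ApproxLimits

variable {K : Set ℂ} {ε c : ℝ} {G : ℕ → ℂ → ℂ} {g : ℂ → ℂ} {D : ℂ → ℂ →L[ℝ] ℂ}

lemma ApproxOn.le_norm (h : ApproxOn K ε G g D) (hG : ∀ n, ∀ z ∈ K, c ≤ ‖G n z‖) {z : ℂ}
    (hz : z ∈ K) : c ≤ ‖g z‖ :=
  ge_of_tendsto (h.tendsto z hz).norm (Eventually.of_forall fun n => hG n z hz)

lemma ApproxOn.tendsto_jacobian (h : ApproxOn K ε G g D) (hK : IsCompact K) (hc : 0 < c)
    (hG : ∀ n, ∀ z ∈ K, c ≤ ‖G n z‖) {ψ : ℝ → ℝ} (hψ : Continuous ψ) {C : ℝ}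
    (hC : ∀ t, |ψ t| ≤ C) :
    IntegrableOn (fun z => ψ ‖g z‖ / ‖g z‖ * (D z).det) K ∧
    Tendsto (fun n => ∫ z in K, ψ ‖G n z‖ / ‖G n z‖ * (fderiv ℝ (G n) z).det) atTop
      (𝓝 (∫ z in K, ψ ‖g z‖ / ‖g z‖ * (D z).det)) := by
  have hC0 : 0 ≤ C := (abs_nonneg _).trans (hC 0)
  have hGc : ∀ n, ContinuousOn (fun z => ‖G n z‖) K := fun n =>
    (h.smooth n).continuous.norm.continuousOn
  refine h.tendsto_integral_det hK (C := C * c⁻¹)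
    (fun n => (hψ.comp_continuousOn (hGc n)).div (hGc n) fun z hz => (hc.trans_le (hG n z hz)).ne')
    (fun n z hz => ?_) fun z hz => ?_
  · rw [div_eq_mul_inv, abs_mul, abs_inv, abs_norm]
    exact mul_le_mul (hC _) (inv_anti₀ hc (hG n z hz)) (by positivity) hC0
  · exact ((hψ.tendsto _).comp (h.tendsto z hz).norm).div (h.tendsto z hz).norm
      (hc.trans_le (h.le_norm hG hz)).ne'

/-- The integrand is the real part of β(g,z) · D(z), linear in D with a bounded continuous
coefficient; the lower bound c keeps |g| and |z| away from 0. -/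
lemma ApproxOn.tendsto_radial (h : ApproxOn K ε G g D) (hK : IsCompact K) (hc : 0 < c)
    (hG : ∀ n, ∀ z ∈ K, c ≤ ‖G n z‖) (hKc : ∀ z ∈ K, c ≤ ‖z‖) {ψ : ℝ → ℝ} (hψ : Continuous ψ)
    {C : ℝ} (hC : ∀ t, |ψ t| ≤ C) :
    IntegrableOn (fun z => ψ ‖g z‖ * normDiff (g z) (D z z) / ‖z‖ ^ 2) K ∧
    Tendsto (fun n => ∫ z in K, ψ ‖G n z‖ * normDiff (G n z) (fderiv ℝ (G n) z z) / ‖z‖ ^ 2) atTop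
      (𝓝 (∫ z in K, ψ ‖g z‖ * normDiff (g z) (D z z) / ‖z‖ ^ 2)) := by
  have hC0 : 0 ≤ C := (abs_nonneg _).trans (hC 0)
  have hGc : ∀ n, ContinuousOn (fun z => ‖G n z‖) K := fun n =>
    (h.smooth n).continuous.norm.continuousOn
  set β : ℂ → ℂ → ℂ := fun w z => (ψ ‖w‖ / ‖w‖ / ‖z‖ ^ 2 : ℝ) * conj w with hβ
  have e : ∀ w v z : ℂ, ψ ‖w‖ * normDiff w v / ‖z‖ ^ 2 = (β w z * v).re := fun w v z => by
    rw [hβ]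
    simp only
    rw [mul_assoc, Complex.re_ofReal_mul, normDiff_eq_re]
    ring
  have hβc : ∀ n, ContinuousOn (fun z => β (G n z) z) K := fun n =>
    (Complex.continuous_ofReal.comp_continuousOn
      (((hψ.comp_continuousOn (hGc n)).div (hGc n) fun z hz => (hc.trans_le (hG n z hz)).ne').div
        (continuous_norm.pow 2).continuousOn
        fun z hz => pow_ne_zero 2 (hc.trans_le (hKc z hz)).ne')).mul
      (Complex.continuous_conj.comp_continuousOn (h.smooth n).continuous.continuousOn)
  obtain ⟨e₁, e₂⟩ := h.tendsto_integral_apply hK (v := fun z => z) continuous_id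
    (B := fun n z => β (G n z) z) (b := fun z => β (g z) z) (C := C * (c ^ 2)⁻¹) hβc
    (fun n z hz => by
      have h3 : ‖G n z‖ ≠ 0 := (hc.trans_le (hG n z hz)).ne'
      have h4 : (‖z‖ ^ 2)⁻¹ ≤ (c ^ 2)⁻¹ :=
        inv_anti₀ (by positivity) (pow_le_pow_left₀ hc.le (hKc z hz) 2)
      rw [hβ]
      simp only
      rw [norm_mul, Complex.norm_conj, Complex.norm_real, Real.norm_eq_abs, abs_div, abs_div,
        abs_norm, abs_pow, abs_norm, div_div, mul_comm ‖G n z‖, ← div_div, div_mul_cancel₀ _ h3,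
        div_eq_mul_inv]
      exact mul_le_mul (hC _) h4 (by positivity) hC0)
    fun z hz => ((Complex.continuous_ofReal.tendsto _).comp
      ((((hψ.tendsto _).comp (h.tendsto z hz).norm).div (h.tendsto z hz).norm
        (hc.trans_le (h.le_norm hG hz)).ne').div_const _)).mul
      ((Complex.continuous_conj.tendsto _).comp (h.tendsto z hz))
  have hint : ∀ n, IntegrableOn (fun z => β (G n z) z * fderiv ℝ (G n) z z) K := fun n =>
    ContinuousOn.integrableOn_compact hK
      ((hβc n).mul ((h.continuous_fderiv n).clm_apply continuous_id).continuousOn)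
  simp only [e]
  refine ⟨Complex.reCLM.integrable_comp e₁, ?_⟩
  have h7 := Complex.reCLM.integral_comp_comm e₁
  have h8 := fun n => Complex.reCLM.integral_comp_comm (hint n)
  simp only [Complex.reCLM_apply] at h7 h8
  simp only [h7, h8]
  exact (Complex.continuous_re.tendsto _).comp e₂

lemma ApproxOn.tendsto_angular (h : ApproxOn K ε G g D) (hK : IsCompact K) (hc : 0 < c)
    (hG : ∀ n, ∀ z ∈ K, c ≤ ‖G n z‖) (hKc : ∀ z ∈ K, c ≤ ‖z‖) :
    IntegrableOn (fun z => (D z (Complex.I * z) / g z).im / ‖z‖ ^ 2) K ∧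
    Tendsto (fun n => ∫ z in K, argDensity (G n) z / ‖z‖ ^ 2) atTop
      (𝓝 (∫ z in K, (D z (Complex.I * z) / g z).im / ‖z‖ ^ 2)) := by
  set β : ℂ → ℂ → ℂ := fun w z => w⁻¹ * ((‖z‖ ^ 2)⁻¹ : ℝ) with hβ
  have e : ∀ w v z : ℂ, (v / w).im / ‖z‖ ^ 2 = (β w z * v).im := fun w v z => by
    rw [hβ]
    simp only
    rw [mul_comm w⁻¹, mul_assoc, Complex.im_ofReal_mul, mul_comm w⁻¹, ← div_eq_mul_inv,
      mul_comm, ← div_eq_mul_inv]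
  have hβc : ∀ n, ContinuousOn (fun z => β (G n z) z) K := fun n =>
    ((h.smooth n).continuous.continuousOn.inv₀ fun z hz =>
      norm_pos_iff.1 (hc.trans_le (hG n z hz))).mul
      (Complex.continuous_ofReal.comp_continuousOn ((continuous_norm.pow 2).continuousOn.inv₀
        fun z hz => pow_ne_zero 2 (hc.trans_le (hKc z hz)).ne'))
  have hI : Continuous fun z : ℂ => Complex.I * z := continuous_const.mul continuous_id
  obtain ⟨e₁, e₂⟩ := h.tendsto_integral_apply hK hI
    (B := fun n z => β (G n z) z) (b := fun z => β (g z) z) (C := c⁻¹ * (c ^ 2)⁻¹) hβc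
    (fun n z hz => by
      have h4 : (‖z‖ ^ 2)⁻¹ ≤ (c ^ 2)⁻¹ :=
        inv_anti₀ (by positivity) (pow_le_pow_left₀ hc.le (hKc z hz) 2)
      rw [hβ]
      simp only
      rw [norm_mul, norm_inv, Complex.norm_real, Real.norm_of_nonneg (by positivity)]
      exact mul_le_mul (inv_anti₀ hc (hG n z hz)) h4 (by positivity) (by positivity))
    fun z hz => ((h.tendsto z hz).inv₀
      (norm_pos_iff.1 (hc.trans_le (h.le_norm hG hz)))).mul_const _
  have hint : ∀ n, IntegrableOn (fun z => β (G n z) z * fderiv ℝ (G n) z (Complex.I * z)) K :=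
    fun n => ContinuousOn.integrableOn_compact hK
      ((hβc n).mul ((h.continuous_fderiv n).clm_apply hI).continuousOn)
  simp only [argDensity, e]
  refine ⟨Complex.imCLM.integrable_comp e₁, ?_⟩
  have h7 := Complex.imCLM.integral_comp_comm e₁
  have h8 := fun n => Complex.imCLM.integral_comp_comm (hint n)
  simp only [Complex.imCLM_apply] at h7 h8
  simp only [h7, h8]
  exact (Complex.continuous_im.tendsto _).comp e₂

end ApproxLimits

/-- The identities hold for smooth approximations Gₙ of g and pass to the limit. The diffeomorphism
h serves only to supply the winding of Gₙ. Since g attains the two sides only up to δ and Gₙ only up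
to another δ, the conclusion is for 2δ. -/
lemma HasWeakDiff.hasIdentities {r R δ r₁ r₂ σ : ℝ} (hr : 0 ≤ r) (hR : 0 < R) (hδ0 : 0 < δ)
    (h₁ : r < r₁) (h₁₂ : r₁ ≤ r₂) (h₂ : r₂ < 1) {g h : ℂ → ℂ} {D : ℂ → ℂ →L[ℝ] ℂ}
    (hD : HasWeakDiff (annulus r 1) g D) (hgc : ContinuousOn g (annulus r 1))
    (hg : ∀ z ∈ annulus r 1, R ≤ ‖g z‖) (hh : ContDiffOn ℝ 1 h (annulus r 1))
    (hc : Corresponds R δ r₁ r₂ σ g) (hw : winding h r₁ = 2 * Real.pi * σ)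
    (hclose : ∀ z ∈ closedAnnulus r₁ r₂, ‖h z - g z‖ < R / 2) :
    HasIdentities R (2 * δ) r₁ r₂ σ g D := by
  -- With R/4 the maps Gₙ satisfy |Gₙ| ≥ 3R/4, which exceeds |Gₙ - h| < R/4 + R/2; this gives both
  -- the absence of zeros and equality of windings.
  set ε := min (R / 4) δ with hε
  have hε0 : 0 < ε := lt_min (by linarith) hδ0
  have hεR : ε ≤ R / 4 := min_le_left _ _
  have hεδ : ε ≤ δ := min_le_right _ _
  set a := (r + r₁) / 2 with ha
  set b := (r₂ + 1) / 2 with hb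
  have hra : r < a := by linarith
  have har : a < r₁ := by linarith
  have hrb : r₂ < b := by linarith
  have hb1 : b < 1 := by linarith
  have ha0 : 0 ≤ a := hr.trans hra.le
  have hr₁ : 0 < r₁ := ha0.trans_lt har
  obtain ⟨G, hG'⟩ := hD.exists_approxOn (isOpen_annulus r 1) hgc (closedAnnulus_subset hra hb1)
    (isCompact_closedAnnulus a b) hε0
  have hsub : annulus a b ⊆ closedAnnulus a b := fun z hz => ⟨hz.1.le, hz.2.le⟩
  have hKK' : closedAnnulus r₁ r₂ ⊆ closedAnnulus a b := (closedAnnulus_subset har hrb).trans hsub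
  have hG := hG'.mono hKK'
  have hK := isCompact_closedAnnulus r₁ r₂
  have hKΩ : closedAnnulus r₁ r₂ ⊆ annulus r 1 := closedAnnulus_subset h₁ h₂
  have hnorm : ∀ n, ∀ z ∈ closedAnnulus a b, 3 * R / 4 ≤ ‖G n z‖ := fun n z hz => by
    have h3 := hg z (closedAnnulus_subset hra hb1 hz)
    have h4 := hG'.le n z hz
    have h5 := norm_sub_norm_le (g z) (G n z)
    rw [norm_sub_rev] at h5
    linarith
  have hG0 : ∀ n, ∀ z ∈ closedAnnulus a b, G n z ≠ 0 := fun n z hz =>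
    norm_pos_iff.1 (by have := hnorm n z hz; linarith)
  have hin₁ : ∀ z : ℂ, ‖z‖ = r₁ → z ∈ closedAnnulus r₁ r₂ := fun z hz =>
    ⟨hz.ge, hz.le.trans h₁₂⟩
  have hin₂ : ∀ z : ℂ, ‖z‖ = r₂ → z ∈ closedAnnulus r₁ r₂ := fun z hz =>
    ⟨h₁₂.trans hz.ge, hz.le⟩
  have hGc : ∀ n, Corresponds R (2 * δ) r₁ r₂ σ (G n) := fun n =>
    hc.mono (fun z hz => hG.le n z (hin₁ z hz)) (fun z hz => hG.le n z (hin₂ z hz)) (by linarith)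
  have hG2 : ∀ n, ContDiffOn ℝ 2 (G n) (annulus a b) := fun n =>
    ((hG.smooth n).of_le ENat.LEInfty.out).contDiffOn
  have hGw : ∀ n, winding (G n) r₁ = 2 * Real.pi * σ := fun n => by
    rw [← hw]
    refine (winding_eq_of_norm_sub_lt (isOpen_annulus r 1)
      ((hG.smooth n).of_le ENat.LEInfty.out).contDiffOn hh hr₁
      (fun z hz => hKΩ (hin₁ z hz)) fun z hz => ?_).symm
    have h3 := hclose z (hin₁ z hz)
    have h4 := hG.le n z (hin₁ z hz)
    have h5 := hnorm n z (hKK' (hin₁ z hz))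
    have h6 := norm_sub_le_norm_sub_add_norm_sub (h z) (g z) (G n z)
    rw [norm_sub_rev (g z)] at h6
    linarith
  have hbound : ∀ ψ : ℝ → ℝ, Continuous ψ → (∀ t, t ≤ R + 2 * δ ∨ 1 - 2 * δ ≤ t → ψ t = 0) →
      ∃ C, ∀ t, |ψ t| ≤ C := fun ψ hψ hψ0 => by
    obtain ⟨C, hC⟩ := isCompact_Icc.exists_bound_of_continuousOn
      (hψ.continuousOn (s := Icc (R + 2 * δ) (1 - 2 * δ)))
    refine ⟨max C 0, fun t => ?_⟩
    by_cases ht : t ∈ Icc (R + 2 * δ) (1 - 2 * δ)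
    · exact (hC t ht).trans (le_max_left _ _)
    · rw [hψ0 t, abs_zero]
      · exact le_max_right _ _
      · by_contra hcon
        push Not at hcon
        exact ht ⟨hcon.1.le, hcon.2.le⟩
  have hc0 : 0 < min (3 * R / 4) r₁ := lt_min (by linarith) hr₁
  have hcG : ∀ n, ∀ z ∈ closedAnnulus r₁ r₂, min (3 * R / 4) r₁ ≤ ‖G n z‖ := fun n z hz =>
    (min_le_left _ _).trans (hnorm n z (hKK' hz))
  have hcz : ∀ z ∈ closedAnnulus r₁ r₂, min (3 * R / 4) r₁ ≤ ‖z‖ := fun z hz =>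
    (min_le_right _ _).trans hz.1
  refine ⟨fun ψ hψ hψ0 => ?_, fun ψ hψ hψ0 => ?_, ?_⟩
  · obtain ⟨C, hC⟩ := hbound ψ hψ hψ0
    obtain ⟨e₁, e₂⟩ := hG.tendsto_jacobian hK hc0 hcG hψ hC
    refine ⟨e₁, tendsto_nhds_unique e₂ (tendsto_const_nhds.congr fun n => ?_)⟩
    exact ((hGc n).integral_eq ha0 har h₁₂ hrb (by linarith) (hG2 n) (fun z hz => hG0 n z (hsub hz))
      (hGw n) hψ hψ0).1.symm
  · obtain ⟨C, hC⟩ := hbound ψ hψ hψ0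
    obtain ⟨e₁, e₂⟩ := hG.tendsto_radial hK hc0 hcG hcz hψ hC
    refine ⟨e₁, tendsto_nhds_unique e₂ (tendsto_const_nhds.congr fun n => ?_)⟩
    exact ((hGc n).integral_eq ha0 har h₁₂ hrb (by linarith) (hG2 n) (fun z hz => hG0 n z (hsub hz))
      (hGw n) hψ hψ0).2.symm
  · obtain ⟨e₁, e₂⟩ := hG.tendsto_angular hK hc0 hcG hcz
    refine ⟨e₁, tendsto_nhds_unique e₂ (tendsto_const_nhds.congr fun n => ?_)⟩
    rw [← hGw n, ← integral_argDensity ha0 har h₁₂ hrb (hG2 n) fun z hz => hG0 n z (hsub hz)]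

/-! ### Free Lagrangians below the energy density -/

lemma normDiff_sq_add {w : ℂ} (hw : w ≠ 0) (v : ℂ) :
    normDiff w v ^ 2 + (‖w‖ * (v / w).im) ^ 2 = ‖v‖ ^ 2 := by
  have h1 : ‖w‖ ^ 2 = w.re * w.re + w.im * w.im := by
    rw [← Complex.normSq_eq_norm_sq, Complex.normSq_apply]
  have h2 : ‖w‖ ≠ 0 := norm_ne_zero_iff.2 hw
  rw [normDiff_apply, Complex.div_im, Complex.normSq_eq_norm_sq, ← Complex.normSq_eq_norm_sq v,
    Complex.normSq_apply]
  field_simp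
  rw [h1]
  ring

/-- Polar frames in the domain, at z, and in the target, at w; the domain frame z, iz has length
|z|, hence the denominator. -/
lemma det_eq_components {w z : ℂ} (hw : w ≠ 0) (hz : z ≠ 0) (T : ℂ →L[ℝ] ℂ) :
    T.det = ‖w‖ * (normDiff w (T z) * (T (Complex.I * z) / w).im -
      (T z / w).im * normDiff w (T (Complex.I * z))) / ‖z‖ ^ 2 := by
  have h1 := normDiff_mul_im_sub hw (T z) (T (Complex.I * z))
  rw [← norm_sq_mul_det T z, eq_div_iff (norm_ne_zero_iff.2 hw)] at h1
  rw [eq_div_iff (pow_ne_zero 2 (norm_ne_zero_iff.2 hz))]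
  linear_combination -h1

lemma hsSq_eq_components {w z : ℂ} (hw : w ≠ 0) (hz : z ≠ 0) (T : ℂ →L[ℝ] ℂ) :
    hsSq T = (normDiff w (T z) ^ 2 + (‖w‖ * (T z / w).im) ^ 2 +
      (normDiff w (T (Complex.I * z)) ^ 2 + (‖w‖ * (T (Complex.I * z) / w).im) ^ 2)) / ‖z‖ ^ 2 := by
  rw [normDiff_sq_add hw, normDiff_sq_add hw, ← norm_sq_mul_hsSq,
    mul_div_cancel_left₀ _ (pow_ne_zero 2 (norm_ne_zero_iff.2 hz))]

/-- Put n = N/F, n' = N'/F and replace ρ²F² by t²ρ² + γ. The difference of the two sides is then ρ²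
times a convex combination of sums of squares, with weight χ on (tn - T')² + (T + tn')², plus γ((n -
σχ)² + n'² + 1 - χ²). For χ = σ = 1 it vanishes at N = F, T' = t, T = N' = 0, the values of the
radial map. -/
lemma lagrangian_le_of_nonneg {ρ F t N T N' T' χ σ γ : ℝ} (hF : F ≠ 0) (hγ : 0 ≤ γ)
    (hFt : ρ ^ 2 * F ^ 2 = t ^ 2 * ρ ^ 2 + γ) (hχ0 : 0 ≤ χ) (hχ1 : χ ≤ 1) (hσ : σ ^ 2 = 1) :
    χ * (2 * ρ ^ 2 * t / F) * (N * T' - T * N') + γ * (2 * σ * χ * (N / F) - 1) ≤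
      ρ ^ 2 * (N ^ 2 + T ^ 2 + (N' ^ 2 + T' ^ 2)) := by
  obtain ⟨n, rfl⟩ : ∃ n, N = n * F := ⟨N / F, (div_mul_cancel₀ N hF).symm⟩
  obtain ⟨n', rfl⟩ : ∃ n', N' = n' * F := ⟨N' / F, (div_mul_cancel₀ N' hF).symm⟩
  have e1 : χ * (2 * ρ ^ 2 * t / F) * (n * F * T' - T * (n' * F)) =
      χ * (2 * ρ ^ 2 * t) * (n * T' - T * n') := by
    field_simp
  rw [e1, mul_div_cancel_right₀ _ hF]
  have h1 : 0 ≤ ρ ^ 2 * ((1 - χ) * (T ^ 2 + T' ^ 2 + (t * n) ^ 2 + (t * n') ^ 2) +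
      χ * ((t * n - T') ^ 2 + (T + t * n') ^ 2)) :=
    mul_nonneg (sq_nonneg _) (add_nonneg (mul_nonneg (by linarith) (by positivity))
      (mul_nonneg hχ0 (by positivity)))
  have h2 : 0 ≤ γ * ((n - σ * χ) ^ 2 + n' ^ 2 + (1 - χ ^ 2)) := by
    refine mul_nonneg hγ (add_nonneg (by positivity) ?_)
    nlinarith
  linear_combination h1 + h2 - (n ^ 2 + n' ^ 2) * hFt + γ * χ ^ 2 * hσ

/-- Now t²ρ² is replaced by ρ²F² - γ in the terms with m = T/t, m' = T'/t, leaving squares with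
coefficient -γ ≥ 0. The linear term in m' needs no cutoff, because d arg g is closed without any
weight. -/
lemma lagrangian_le_of_nonpos {ρ F t N m N' m' χ σ γ : ℝ} (hγ : γ ≤ 0)
    (hFt : ρ ^ 2 * F ^ 2 = t ^ 2 * ρ ^ 2 + γ) (hχ0 : 0 ≤ χ) (hχ1 : χ ≤ 1) (hσ : σ ^ 2 = 1) :
    χ * (2 * ρ ^ 2 * F) * (N * m' - m * N') + -γ * (2 * σ * m' - 1) ≤
      ρ ^ 2 * (N ^ 2 + (t * m) ^ 2 + (N' ^ 2 + (t * m') ^ 2)) := by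
  have h1 : 0 ≤ ρ ^ 2 * ((1 - χ) * (N ^ 2 + N' ^ 2 + (F * m) ^ 2 + (F * m') ^ 2) +
      χ * ((F * m' - N) ^ 2 + (N' + F * m) ^ 2)) :=
    mul_nonneg (sq_nonneg _) (add_nonneg (mul_nonneg (by linarith) (by positivity))
      (mul_nonneg hχ0 (by positivity)))
  have h2 : 0 ≤ -γ * ((m' - σ) ^ 2 + m ^ 2) := mul_nonneg (by linarith) (by positivity)
  linear_combination h1 + h2 + (m ^ 2 + m' ^ 2) * hFt - γ * hσ

/-- A continuous cutoff function supported in `[R + δ, 1 - δ]`. -/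
def cutoff (R δ t : ℝ) : ℝ := max 0 (min 1 (min ((t - R - δ) / δ) ((1 - δ - t) / δ)))

lemma continuous_cutoff (R δ : ℝ) : Continuous (cutoff R δ) := by
  unfold cutoff; fun_prop

lemma cutoff_nonneg (R δ t : ℝ) : 0 ≤ cutoff R δ t := le_max_left _ _

lemma cutoff_le_one (R δ t : ℝ) : cutoff R δ t ≤ 1 := max_le zero_le_one (min_le_left _ _)

lemma cutoff_eq_zero {R δ t : ℝ} (hδ : 0 < δ) (ht : t ≤ R + δ ∨ 1 - δ ≤ t) : cutoff R δ t = 0 := by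
  refine max_eq_left (min_le_iff.2 (Or.inr (min_le_iff.2 ?_)))
  rcases ht with ht | ht
  · exact Or.inl (div_nonpos_of_nonpos_of_nonneg (by linarith) hδ.le)
  · exact Or.inr (div_nonpos_of_nonpos_of_nonneg (by linarith) hδ.le)

lemma eventually_cutoff_eq_one {R t : ℝ} (ht : t ∈ Ioo R 1) :
    ∀ᶠ δ in 𝓝[>] (0 : ℝ), cutoff R δ t = 1 := by
  have h0 : (0 : ℝ) < min ((t - R) / 2) ((1 - t) / 2) :=
    lt_min (by linarith [ht.1]) (by linarith [ht.2])
  filter_upwards [Ioo_mem_nhdsGT h0] with δ hδ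
  have h1 : δ < (t - R) / 2 := hδ.2.trans_le (min_le_left _ _)
  have h2 : δ < (1 - t) / 2 := hδ.2.trans_le (min_le_right _ _)
  have h3 : 1 ≤ min ((t - R - δ) / δ) ((1 - δ - t) / δ) :=
    le_min ((one_le_div hδ.1).2 (by linarith)) ((one_le_div hδ.1).2 (by linarith))
  rw [cutoff, min_eq_left h3, max_eq_right zero_le_one]

/-- The weight may blow up at the endpoints; only its values on [R + δ, 1 - δ] matter, so it may be
extended from there by constants. -/
lemma continuous_cutoff_mul {R δ : ℝ} (hδ : 0 < δ) (hδ1 : R + δ ≤ 1 - δ) {w : ℝ → ℝ}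
    (hw : ContinuousOn w (Ioo R 1)) : Continuous fun t => cutoff R δ t * w t := by
  have hsub : Icc (R + δ) (1 - δ) ⊆ Ioo R 1 := fun t ht => ⟨by linarith [ht.1], by linarith [ht.2]⟩
  have h1 : Continuous (IccExtend hδ1 ((Icc (R + δ) (1 - δ)).domRestrict w)) :=
    (continuousOn_iff_continuous_domRestrict.1 (hw.mono hsub)).Icc_extend'
  refine ((continuous_cutoff R δ).mul h1).congr fun t => ?_
  by_cases ht : t ∈ Icc (R + δ) (1 - δ)
  · rw [Pi.mul_apply, IccExtend_of_mem _ _ ht, domRestrict_apply]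
  · have h0 : cutoff R δ t = 0 := cutoff_eq_zero hδ (by
      by_contra hcon
      push Not at hcon
      exact ht ⟨hcon.1.le, hcon.2.le⟩)
    rw [Pi.mul_apply, h0, zero_mul, zero_mul]

lemma tendsto_integral_cutoff_mul {R : ℝ} (hR1 : R < 1) {w : ℝ → ℝ}
    (hw : IntervalIntegrable w volume R 1) :
    Tendsto (fun δ => ∫ t in R..1, cutoff R δ t * w t) (𝓝[>] 0) (𝓝 (∫ t in R..1, w t)) := by
  refine intervalIntegral.tendsto_integral_filter_of_dominated_convergence (fun t => |w t|)
    (Eventually.of_forall fun δ => ?_) (Eventually.of_forall fun δ => ae_of_all _ fun t _ => ?_)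
    hw.norm ?_
  · exact (continuous_cutoff R δ).aestronglyMeasurable.mul hw.def'.aestronglyMeasurable
  · rw [norm_mul, Real.norm_of_nonneg (cutoff_nonneg R δ t)]
    exact mul_le_of_le_one_left (norm_nonneg _) (cutoff_le_one R δ t)
  · have h1 : ∀ᵐ t : ℝ, t ≠ 1 := by simp [ae_iff, measure_singleton]
    filter_upwards [h1] with t ht1 ht
    rw [uIoc_of_le hR1.le] at ht
    refine tendsto_const_nhds.congr' ?_
    filter_upwards [eventually_cutoff_eq_one ⟨ht.1, lt_of_le_of_ne ht.2 ht1⟩] with δ hδ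
    rw [hδ, one_mul]

/-- The energy density u is not known to be integrable, so the bound is taken in [0,∞]; the negative
part of f is dropped. -/
lemma ofReal_integral_le_lintegral {α : Type*} [MeasurableSpace α] {μ : Measure α} {f u : α → ℝ}
    (hf : Integrable f μ) (hfu : ∀ᵐ x ∂μ, f x ≤ u x) :
    ENNReal.ofReal (∫ x, f x ∂μ) ≤ ∫⁻ x, ENNReal.ofReal (u x) ∂μ := by
  rw [integral_eq_lintegral_pos_part_sub_lintegral_neg_part hf]
  refine (ENNReal.ofReal_le_ofReal (sub_le_self _ ENNReal.toReal_nonneg)).trans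
    (ENNReal.ofReal_toReal_le.trans (lintegral_mono_ae ?_))
  filter_upwards [hfu] with x hx
  exact ENNReal.ofReal_le_ofReal hx

lemma ofReal_add_integral_le_lintegral {α : Type*} [MeasurableSpace α] {μ : Measure α}
    {f₁ f₂ f₃ u : α → ℝ} (h₁ : Integrable f₁ μ) (h₂ : Integrable f₂ μ) (h₃ : Integrable f₃ μ)
    (c₂ c₃ : ℝ) (hle : ∀ᵐ x ∂μ, f₁ x + c₂ * f₂ x + c₃ * f₃ x ≤ u x) :
    ENNReal.ofReal (∫ x, f₁ x ∂μ + c₂ * ∫ x, f₂ x ∂μ + c₃ * ∫ x, f₃ x ∂μ) ≤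
      ∫⁻ x, ENNReal.ofReal (u x) ∂μ := by
  refine le_trans (le_of_eq ?_)
    (ofReal_integral_le_lintegral ((h₁.add (h₂.const_mul c₂)).add (h₃.const_mul c₃)) hle)
  rw [integral_add' (h₁.add (h₂.const_mul c₂)) (h₃.const_mul c₃), integral_add' h₁ (h₂.const_mul c₂),
    integral_const_mul, integral_const_mul]

lemma integral_inv_norm_sq {r₁ r₂ : ℝ} (h₁ : 0 < r₁) (h₁₂ : r₁ ≤ r₂) :
    ∫ z in closedAnnulus r₁ r₂, (1 : ℝ) / ‖z‖ ^ 2 = 2 * Real.pi * Real.log (r₂ / r₁) := by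
  rw [← winding_id h₁, ← integral_argDensity (a := 0) (b := r₂ + 1) le_rfl h₁ h₁₂ (by linarith)
    contDiffOn_id (fun z hz => ne_zero_of_mem_annulus le_rfl hz)]
  refine setIntegral_congr_fun (isCompact_closedAnnulus r₁ r₂).measurableSet fun z hz => ?_
  rw [argDensity_id (norm_pos_iff.1 (h₁.trans_le hz.1))]

lemma integrableOn_inv_norm_sq {r₁ r₂ : ℝ} (h₁ : 0 < r₁) :
    IntegrableOn (fun z : ℂ => (1 : ℝ) / ‖z‖ ^ 2) (closedAnnulus r₁ r₂) :=
  (continuousOn_const.div (continuous_norm.pow 2).continuousOn fun _ hz =>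
    pow_ne_zero 2 (h₁.trans_le hz.1).ne').integrableOn_compact (isCompact_closedAnnulus r₁ r₂)

section

variable {R : ℝ} {ρ : ℝ → ℝ} {γ : ℝ} {δ r₁ r₂ σ : ℝ} {g : ℂ → ℂ} {D : ℂ → ℂ →L[ℝ] ℂ}

lemma HasIdentities.le_lintegral_of_nonneg (H : IsProfile R ρ γ) (hγ : 0 ≤ γ)
    (hI : HasIdentities R δ r₁ r₂ σ g D) (hδ : 0 < δ) (hδ1 : R + δ ≤ 1 - δ) (hσ : σ ^ 2 = 1)
    (h₁ : 0 < r₁) (h₁₂ : r₁ ≤ r₂)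
    (hg : ∀ z ∈ closedAnnulus r₁ r₂, ‖g z‖ ∈ Icc R 1) :
    ENNReal.ofReal (2 * Real.pi * ((∫ t in R..1, cutoff R δ t *
      (2 * ρ t ^ 2 * t ^ 2 / speed ρ γ t + 2 * γ / speed ρ γ t)) - γ * Real.log (r₂ / r₁))) ≤
      ∫⁻ z in closedAnnulus r₁ r₂, ENNReal.ofReal (radial ρ (g z) ^ 2 * hsSq (D z)) := by
  have hF : ContinuousOn (speed ρ γ) (Ioo R 1) := H.continuousOn_speed.mono Ioo_subset_Icc_self
  have hF0 : ∀ t ∈ Ioo R 1, speed ρ γ t ≠ 0 := fun t ht => (H.speed_pos ht).ne'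
  have hρc : ContinuousOn ρ (Ioo R 1) := H.cont.mono Ioo_subset_Icc_self
  have hc₁ := continuous_cutoff_mul hδ hδ1 (w := fun t => 2 * ρ t ^ 2 * t ^ 2 / speed ρ γ t)
    (((continuousOn_const.mul (hρc.pow 2)).mul (continuousOn_id.pow 2)).div hF hF0)
  have hc₂ := continuous_cutoff_mul hδ hδ1 (w := fun t => 2 * γ / speed ρ γ t)
    (continuousOn_const.div hF hF0)
  obtain ⟨i₁, e₁⟩ := hI.jacobian _ hc₁ fun t ht => by rw [cutoff_eq_zero hδ ht, zero_mul]
  obtain ⟨i₂, e₂⟩ := hI.radial_deriv _ hc₂ fun t ht => by rw [cutoff_eq_zero hδ ht, zero_mul]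
  have hKm := (isCompact_closedAnnulus r₁ r₂).measurableSet
  refine le_trans (le_of_eq ?_) (ofReal_add_integral_le_lintegral i₁ i₂
    (integrableOn_inv_norm_sq (r₂ := r₂) h₁) σ (-γ)
    ((ae_restrict_iff' hKm).2 (ae_of_all _ fun z hz => ?_)))
  · congr 1
    rw [e₁, e₂, integral_inv_norm_sq h₁ h₁₂]
    simp only [mul_add]
    rw [intervalIntegral.integral_add (hc₁.intervalIntegrable _ _) (hc₂.intervalIntegrable _ _)]
    linear_combination (-2 * Real.pi * ∫ t in R..1, cutoff R δ t * (2 * γ / speed ρ γ t)) * hσ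
  · have hz0 : 0 < ‖z‖ := h₁.trans_le hz.1
    have ht := hg z hz
    have ht0 : 0 < ‖g z‖ := H.R_pos.trans_le ht.1
    have hg0 : g z ≠ 0 := norm_pos_iff.1 ht0
    rw [det_eq_components hg0 (norm_pos_iff.1 hz0), hsSq_eq_components hg0 (norm_pos_iff.1 hz0),
      radial]
    set t := ‖g z‖
    set N := normDiff (g z) (D z z)
    set N' := normDiff (g z) (D z (Complex.I * z))
    set m := (D z z / g z).im
    set m' := (D z (Complex.I * z) / g z).im
    have key : cutoff R δ t * (2 * ρ t ^ 2 * t ^ 2 / speed ρ γ t) * (N * m' - m * N') +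
        σ * (cutoff R δ t * (2 * γ / speed ρ γ t) * N) - γ ≤
        ρ t ^ 2 * (N ^ 2 + (t * m) ^ 2 + (N' ^ 2 + (t * m') ^ 2)) := by
      -- At |g| = R or 1 the cutoff vanishes and the left side is -γ ≤ 0.
      by_cases htI : t ∈ Ioo R 1
      · have key := lagrangian_le_of_nonneg (N := N) (T := t * m) (N' := N') (T' := t * m')
          (hF0 t htI) hγ (H.rho_sq_mul_speed_sq ht) (cutoff_nonneg R δ t) (cutoff_le_one R δ t) hσ
        refine le_trans (le_of_eq ?_) key
        ring
      · have h0 : cutoff R δ t = 0 := cutoff_eq_zero hδ (by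
          by_contra hcon
          push Not at hcon
          exact htI ⟨by linarith [hcon.1], by linarith [hcon.2]⟩)
        have : 0 ≤ ρ t ^ 2 * (N ^ 2 + (t * m) ^ 2 + (N' ^ 2 + (t * m') ^ 2)) := by positivity
        rw [h0]
        linarith
    refine le_trans (le_of_eq ?_) ((div_le_div_of_nonneg_right key (sq_nonneg ‖z‖)).trans
      (mul_div_assoc _ _ _).le)
    field_simp
    ring

lemma HasIdentities.le_lintegral_of_nonpos (H : IsProfile R ρ γ) (hγ : γ ≤ 0)
    (hI : HasIdentities R δ r₁ r₂ σ g D) (hδ : 0 < δ) (hδ1 : R + δ ≤ 1 - δ) (hσ : σ ^ 2 = 1)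
    (h₁ : 0 < r₁) (h₁₂ : r₁ ≤ r₂)
    (hg : ∀ z ∈ closedAnnulus r₁ r₂, ‖g z‖ ∈ Icc R 1) :
    ENNReal.ofReal (2 * Real.pi * ((∫ t in R..1, cutoff R δ t * (2 * ρ t ^ 2 * speed ρ γ t)) -
      γ * Real.log (r₂ / r₁))) ≤
      ∫⁻ z in closedAnnulus r₁ r₂, ENNReal.ofReal (radial ρ (g z) ^ 2 * hsSq (D z)) := by
  have hF : ContinuousOn (speed ρ γ) (Ioo R 1) := H.continuousOn_speed.mono Ioo_subset_Icc_self
  have hρc : ContinuousOn ρ (Ioo R 1) := H.cont.mono Ioo_subset_Icc_self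
  have hc₁ := continuous_cutoff_mul hδ hδ1 (w := fun t => 2 * ρ t ^ 2 * speed ρ γ t)
    ((continuousOn_const.mul (hρc.pow 2)).mul hF)
  obtain ⟨i₁, e₁⟩ := hI.jacobian _ hc₁ fun t ht => by rw [cutoff_eq_zero hδ ht, zero_mul]
  obtain ⟨i₂, e₂⟩ := hI.angular
  have hKm := (isCompact_closedAnnulus r₁ r₂).measurableSet
  refine le_trans (le_of_eq ?_) (ofReal_add_integral_le_lintegral i₁ i₂
    (integrableOn_inv_norm_sq (r₂ := r₂) h₁) (-2 * γ * σ) γ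
    ((ae_restrict_iff' hKm).2 (ae_of_all _ fun z hz => ?_)))
  · congr 1
    rw [e₁, e₂, integral_inv_norm_sq h₁ h₁₂]
    linear_combination (4 * γ * Real.pi * Real.log (r₂ / r₁)) * hσ
  · have hz0 : 0 < ‖z‖ := h₁.trans_le hz.1
    have ht := hg z hz
    have ht0 : 0 < ‖g z‖ := H.R_pos.trans_le ht.1
    have hg0 : g z ≠ 0 := norm_pos_iff.1 ht0
    rw [det_eq_components hg0 (norm_pos_iff.1 hz0), hsSq_eq_components hg0 (norm_pos_iff.1 hz0),
      radial]
    have key := lagrangian_le_of_nonpos (N := normDiff (g z) (D z z)) (m := (D z z / g z).im)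
      (N' := normDiff (g z) (D z (Complex.I * z))) (m' := (D z (Complex.I * z) / g z).im)
      hγ (H.rho_sq_mul_speed_sq ht) (cutoff_nonneg R δ ‖g z‖) (cutoff_le_one R δ ‖g z‖) hσ
    refine le_trans (le_of_eq ?_) ((div_le_div_of_nonneg_right key (sq_nonneg ‖z‖)).trans
      (mul_div_assoc _ _ _).le)
    field_simp
    ring

end

/-! ### The lower bound for the energy -/

/-- The energy of the radial harmonic map. -/
def nitscheEnergy (R : ℝ) (ρ : ℝ → ℝ) (γ : ℝ) : ℝ :=
  2 * Real.pi * ∫ t in R..1, ρ t ^ 2 * (speed ρ γ t ^ 2 + t ^ 2) / speed ρ γ t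

lemma CDeltaTendsto.continuousOn {r R : ℝ} {m : ℂ → ℝ} {g : ℂ → ℂ} {hj : ℕ → ℂ → ℂ}
    (hdiff : ∀ j, IsDiffeo (annulus r 1) (annulus R 1) (hj j))
    (hlim : CDeltaTendsto (annulus r 1) (annulus R 1) m hj g) : ContinuousOn g (annulus r 1) :=
  ((tendstoLocallyUniformlyOn_iff_forall_isCompact (isOpen_annulus r 1)).2 hlim.compact).continuousOn
    (Frequently.of_forall fun j => (hdiff j).smooth.continuousOn)

lemma CDeltaTendsto.exists_hasIdentities {r R m M : ℝ} (hr : 0 ≤ r) (hR : 0 < R) (hR1 : R < 1)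
    {ρ : ℝ → ℝ} (hm : 0 < m) (hρm : ∀ t ∈ Icc R 1, m ≤ ρ t) (hρM : ∀ t ∈ Icc R 1, ρ t ≤ M)
    {g : ℂ → ℂ} {hj : ℕ → ℂ → ℂ} (hdiff : ∀ j, IsDiffeo (annulus r 1) (annulus R 1) (hj j))
    (hg : MapsTo g (annulus r 1) (closure (annulus R 1)))
    (hlim : CDeltaTendsto (annulus r 1) (annulus R 1) (RadialNitsche.radial ρ) hj g)
    {D : ℂ → ℂ →L[ℝ] ℂ} (hD : HasWeakDiff (annulus r 1) g D)
    {δ : ℝ} (hδ0 : 0 < δ) (hδ : R + δ < 1 - δ) {s₁ s₂ : ℝ} (h₁ : r < s₁) (h₁₂ : s₁ ≤ s₂)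
    (h₂ : s₂ < 1) :
    ∃ r₁ r₂ σ, r < r₁ ∧ r₁ ≤ s₁ ∧ s₂ ≤ r₂ ∧ r₂ < 1 ∧ σ ^ 2 = 1 ∧
      HasIdentities R δ r₁ r₂ σ g D := by
  obtain ⟨r₁, r₂, σ, h, hr₁, hrs₁, hrs₂, hr₂, hh, hc, hw, hclose⟩ :=
    -- Half of δ, because mollification doubles it.
    hlim.exists_diffeo hr hR hR1 hm hρm hρM hdiff hg (half_pos hδ0)
      (by linarith : R + δ / 2 < 1 - δ / 2) h₁ h₁₂ h₂
  have hI := hD.hasIdentities hr hR (half_pos hδ0) hr₁ (hrs₁.trans (h₁₂.trans hrs₂)) hr₂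
    (hlim.continuousOn hdiff) (fun z hz => (closure_annulus_subset R (hg hz)).1)
    (hh.smooth.of_le ENat.LEInfty.out) hc hw hclose
  rw [mul_div_cancel₀ δ two_ne_zero] at hI
  exact ⟨r₁, r₂, σ, hr₁, hrs₁, hrs₂, hr₂, hc.sq_eq_one, hI⟩

namespace IsProfile

variable {R : ℝ} {ρ : ℝ → ℝ} {γ : ℝ}

lemma intervalIntegrable_inv_speed (H : IsProfile R ρ γ) :
    IntervalIntegrable (fun t => (speed ρ γ t)⁻¹) volume R 1 :=
  H.intervalIntegrable (left_mem_Icc.2 H.R_lt.le) (right_mem_Icc.2 H.R_lt.le)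

lemma log_inv_qFun (H : IsProfile R ρ γ) :
    Real.log (1 / qFun ρ γ R) = ∫ t in R..1, (speed ρ γ t)⁻¹ := by
  rw [one_div, Real.log_inv, H.qFun_eq (left_mem_Icc.2 H.R_lt.le), Real.log_exp, neg_neg]

lemma integral_congr_Ioo (H : IsProfile R ρ γ) {u v : ℝ → ℝ} (h : ∀ t ∈ Ioo R 1, u t = v t) :
    ∫ t in R..1, u t = ∫ t in R..1, v t := by
  rw [intervalIntegral.integral_of_le H.R_lt.le, intervalIntegral.integral_of_le H.R_lt.le,
    integral_Ioc_eq_integral_Ioo, integral_Ioc_eq_integral_Ioo]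
  exact setIntegral_congr_fun measurableSet_Ioo h

/-- The bound from `HasIdentities`, in a form without distinction of the sign of `γ`. -/
lemma exists_bound (H : IsProfile R ρ γ) : ∃ w : ℝ → ℝ, IntervalIntegrable w volume R 1 ∧
    2 * Real.pi * ((∫ t in R..1, w t) - γ * Real.log (1 / qFun ρ γ R)) = nitscheEnergy R ρ γ ∧
    ∀ {δ r₁ r₂ σ : ℝ} {g : ℂ → ℂ} {D : ℂ → ℂ →L[ℝ] ℂ}, HasIdentities R δ r₁ r₂ σ g D → 0 < δ →
      R + δ ≤ 1 - δ → σ ^ 2 = 1 → 0 < r₁ → r₁ ≤ r₂ → (∀ z ∈ closedAnnulus r₁ r₂, ‖g z‖ ∈ Icc R 1) →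
      ENNReal.ofReal (2 * Real.pi * ((∫ t in R..1, cutoff R δ t * w t) - γ * Real.log (r₂ / r₁))) ≤
        ∫⁻ z in closedAnnulus r₁ r₂, ENNReal.ofReal (radial ρ (g z) ^ 2 * hsSq (D z)) := by
  have hi := H.intervalIntegrable_inv_speed
  have hu : uIcc R 1 = Icc R 1 := uIcc_of_le H.R_lt.le
  -- As log(1/r) is the integral of 1/F, the bound has the integrand w - γ/F. For both choices of w
  -- this is the energy integrand of the radial map.
  have hval : ∀ w : ℝ → ℝ, IntervalIntegrable w volume R 1 →
      (∀ t ∈ Ioo R 1, w t - γ * (speed ρ γ t)⁻¹ =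
        ρ t ^ 2 * (speed ρ γ t ^ 2 + t ^ 2) / speed ρ γ t) →
      2 * Real.pi * ((∫ t in R..1, w t) - γ * Real.log (1 / qFun ρ γ R)) =
        nitscheEnergy R ρ γ := fun w hw h => by
    rw [H.log_inv_qFun, nitscheEnergy, ← intervalIntegral.integral_const_mul,
      ← intervalIntegral.integral_sub hw (hi.const_mul γ), H.integral_congr_Ioo h]
  rcases le_total 0 γ with hγ | hγ
  · have hw : IntervalIntegrable
        (fun t => 2 * ρ t ^ 2 * t ^ 2 / speed ρ γ t + 2 * γ / speed ρ γ t) volume R 1 := by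
      simp only [div_eq_mul_inv]
      refine IntervalIntegrable.add (hi.continuousOn_mul ?_) (hi.const_mul _)
      rw [hu]
      exact (continuousOn_const.mul (H.cont.pow 2)).mul (continuousOn_id.pow 2)
    refine ⟨_, hw, hval _ hw fun t ht => ?_,
      fun hI hδ hδ1 hσ h₁ h₁₂ hg => hI.le_lintegral_of_nonneg H hγ hδ hδ1 hσ h₁ h₁₂ hg⟩
    have h0 := (H.speed_pos ht).ne'
    have h1 := H.rho_sq_mul_speed_sq (Ioo_subset_Icc_self ht)
    field_simp
    linear_combination -h1
  · have hw : IntervalIntegrable (fun t => 2 * ρ t ^ 2 * speed ρ γ t) volume R 1 := by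
      refine ContinuousOn.intervalIntegrable ?_
      rw [hu]
      exact (continuousOn_const.mul (H.cont.pow 2)).mul H.continuousOn_speed
    refine ⟨_, hw, hval _ hw fun t ht => ?_,
      fun hI hδ hδ1 hσ h₁ h₁₂ hg => hI.le_lintegral_of_nonpos H hγ hδ hδ1 hσ h₁ h₁₂ hg⟩
    have h0 := (H.speed_pos ht).ne'
    have h1 := H.rho_sq_mul_speed_sq (Ioo_subset_Icc_self ht)
    field_simp
    linear_combination h1

/-- For each small δ the Lagrangian bound holds on some large closed annulus; then δ tends to 0, and
both the cutoffs and the moduli converge. -/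
lemma nitscheEnergy_le_energy (H : IsProfile R ρ γ) {g : ℂ → ℂ}
    (hg : IsDeformation (annulus (qFun ρ γ R) 1) (annulus R 1) (radial ρ) g) :
    ENNReal.ofReal (nitscheEnergy R ρ γ) ≤
      energy (annulus (qFun ρ γ R) 1) (radial ρ) g := by
  set r := qFun ρ γ R with hr
  have hr0 : 0 < r := qFun_pos R
  have hr1 : r < 1 := H.qFun_left_lt_one
  obtain ⟨M, -, hM⟩ := H.exists_le
  obtain ⟨hj, hdiff, hlim⟩ := hg.approx
  obtain ⟨w, hw, hE, hbound⟩ := H.exists_bound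
  refine le_iInf₂ fun D hD => ?_
  -- Only γ log(r₂/r₁) ≤ γℓ is needed. For γ ≥ 0 the trivial bound r₂/r₁ ≤ 1/r does it; for γ < 0
  -- the modulus must be large, which is ensured by prescribing margins (1-r)δ/2 that shrink with δ.
  set ℓ : ℝ → ℝ := fun δ => if 0 ≤ γ then Real.log (1 / r) else
    Real.log ((1 - (1 - r) / 2 * δ) / (r + (1 - r) / 2 * δ)) with hℓ
  have hℓlim : Tendsto ℓ (𝓝[>] 0) (𝓝 (Real.log (1 / r))) := by
    by_cases hγ : 0 ≤ γ
    · simp only [hℓ, if_pos hγ]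
      exact tendsto_const_nhds
    · simp only [hℓ, if_neg hγ]
      have hc : ContinuousAt (fun δ : ℝ =>
          Real.log ((1 - (1 - r) / 2 * δ) / (r + (1 - r) / 2 * δ))) 0 := by
        refine ContinuousAt.log (ContinuousAt.div (by fun_prop) (by fun_prop) ?_) ?_
        · simpa using hr0.ne'
        · simpa using hr0.ne'
      have := hc.tendsto.mono_left (nhdsWithin_le_nhds (s := Ioi 0))
      simpa using this
  have hlimit : Tendsto (fun δ => ENNReal.ofReal (2 * Real.pi *
      ((∫ t in R..1, cutoff R δ t * w t) - γ * ℓ δ))) (𝓝[>] 0)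
      (𝓝 (ENNReal.ofReal (nitscheEnergy R ρ γ))) := by
    rw [← hE]
    exact (ENNReal.continuous_ofReal.tendsto _).comp
      (((tendsto_integral_cutoff_mul H.R_lt hw).sub (hℓlim.const_mul γ)).const_mul _)
  refine le_of_tendsto hlimit ?_
  have hpos : (0 : ℝ) < min 1 ((1 - R) / 2) := lt_min one_pos (by linarith [H.R_lt])
  filter_upwards [Ioo_mem_nhdsGT hpos] with δ hδ
  have hδ1 : δ < 1 := hδ.2.trans_le (min_le_left _ _)
  have hδR : R + δ < 1 - δ := by linarith [hδ.2.trans_le (min_le_right 1 ((1 - R) / 2))]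
  have hcδ : 0 < (1 - r) / 2 * δ := mul_pos (by linarith) hδ.1
  have hcδ1 : (1 - r) / 2 * δ < (1 - r) / 2 := mul_lt_of_lt_one_right (by linarith) hδ1
  obtain ⟨r₁, r₂, σ, hr₁, hrs₁, hrs₂, hr₂, hσ, hI⟩ := hlim.exists_hasIdentities hr0.le H.R_pos
    H.R_lt (mul_pos H.R_pos H.pos_left) (fun t ht => H.le_apply ht) hM hdiff hg.mapsTo hD hδ.1 hδR
    (s₁ := r + (1 - r) / 2 * δ) (s₂ := 1 - (1 - r) / 2 * δ) (by linarith) (by linarith)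
    (by linarith)
  have h₁₂ : r₁ ≤ r₂ := by linarith
  have hr₁0 : 0 < r₁ := hr0.trans hr₁
  have hr₂0 : 0 < r₂ := hr₁0.trans_le h₁₂
  have hsub := closedAnnulus_subset hr₁ hr₂
  refine le_trans (ENNReal.ofReal_le_ofReal ?_) ((hbound hI hδ.1 hδR.le hσ hr₁0 h₁₂
    fun z hz => closure_annulus_subset R (hg.mapsTo (hsub hz))).trans (lintegral_mono_set hsub))
  have hle : γ * Real.log (r₂ / r₁) ≤ γ * ℓ δ := by
    by_cases hγ : 0 ≤ γ
    · simp only [hℓ, if_pos hγ]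
      refine mul_le_mul_of_nonneg_left (Real.log_le_log (by positivity) ?_) hγ
      exact div_le_div₀ zero_le_one hr₂.le hr0 hr₁.le
    · simp only [hℓ, if_neg hγ]
      refine mul_le_mul_of_nonpos_left (Real.log_le_log ?_ ?_) (not_le.1 hγ).le
      · exact div_pos (by linarith) (by linarith)
      · exact div_le_div₀ (by linarith) hrs₂ hr₁0 hrs₁
  have := Real.pi_pos
  gcongr

end IsProfile

/-! ### The radial map is a minimizer -/

lemma lintegral_annulus_comp_norm {a b : ℝ} (ha : 0 ≤ a) {φ : ℝ → ℝ≥0∞}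
    (hφ : AEMeasurable φ (volume.restrict (Ioo a b))) :
    ∫⁻ w in annulus a b, φ ‖w‖ =
      ENNReal.ofReal (2 * Real.pi) * ∫⁻ t in Ioo a b, ENNReal.ofReal t * φ t := by
  set u : ℝ → ℝ≥0∞ := (Ioo a b).indicator fun t => ENNReal.ofReal t * φ t with hu
  have hum : AEMeasurable u :=
    (aemeasurable_indicator_iff measurableSet_Ioo).2
      (ENNReal.measurable_ofReal.aemeasurable.mul hφ)
  rw [← lintegral_indicator (isOpen_annulus a b).measurableSet,
    ← Complex.lintegral_comp_polarCoord_symm, polarCoord_target, Measure.volume_eq_prod,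
    ← Measure.prod_restrict]
  have e : ∀ᵐ p ∂((volume.restrict (Ioi (0 : ℝ))).prod
      (volume.restrict (Ioo (-Real.pi) Real.pi))),
      ENNReal.ofReal p.1 • (annulus a b).indicator (fun w => φ ‖w‖)
        (Complex.polarCoord.symm p) = u p.1 * (fun _ => 1) p.2 := by
    rw [Measure.prod_restrict,
      ae_restrict_iff' (measurableSet_Ioi.prod measurableSet_Ioo)]
    refine ae_of_all _ fun p hp => ?_
    have hn : ‖Complex.polarCoord.symm p‖ = p.1 := by
      rw [Complex.norm_polarCoord_symm, abs_of_pos hp.1]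
    by_cases h : p.1 ∈ Ioo a b
    · rw [indicator_of_mem (show Complex.polarCoord.symm p ∈ annulus a b by
        rw [annulus, mem_ofPred_eq, hn]; exact h), hu, indicator_of_mem h, hn, mul_one, smul_eq_mul]
    · rw [indicator_of_notMem (show Complex.polarCoord.symm p ∉ annulus a b by
        rw [annulus, mem_ofPred_eq, hn]; exact h), hu, indicator_of_notMem h, smul_zero, zero_mul]
  rw [lintegral_congr_ae e, lintegral_prod_mul hum.restrict aemeasurable_const, lintegral_one,
    Measure.restrict_apply_univ, Real.volume_Ioo, mul_comm, sub_neg_eq_add, ← two_mul,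
    hu, lintegral_indicator measurableSet_Ioo, Measure.restrict_restrict measurableSet_Ioo,
    inter_eq_left.2 (Ioo_subset_Ioi_self.trans (Ioi_subset_Ioi ha))]

namespace IsProfile

variable {R : ℝ} {ρ : ℝ → ℝ} {γ : ℝ}

lemma fderiv_nitscheMap (H : IsProfile R ρ γ) {z : ℂ} (hz : z ∈ annulus (qFun ρ γ R) 1) :
    fderiv ℝ (nitscheMap R ρ γ) z = radialDiff (z / (‖z‖ : ℂ))
      (speed ρ γ (pFun R ρ γ ‖z‖) / ‖z‖) (pFun R ρ γ ‖z‖ / ‖z‖) :=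
  (H.hasFDerivAt_nitscheMap hz).fderiv

lemma hasWeakDiff_nitscheMap (H : IsProfile R ρ γ) :
    HasWeakDiff (annulus (qFun ρ γ R) 1) (nitscheMap R ρ γ) (fderiv ℝ (nitscheMap R ρ γ)) :=
  hasWeakDiff_fderiv (isOpen_annulus _ _) (H.contDiffOn_nitscheMap.of_le ENat.LEInfty.out)

lemma intervalIntegrable_energy (H : IsProfile R ρ γ) : IntervalIntegrable
    (fun t => ρ t ^ 2 * (speed ρ γ t ^ 2 + t ^ 2) / speed ρ γ t) volume R 1 := by
  simp only [div_eq_mul_inv]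
  refine H.intervalIntegrable_inv_speed.continuousOn_mul ?_
  rw [uIcc_of_le H.R_lt.le]
  exact (H.cont.pow 2).mul ((H.continuousOn_speed.pow 2).add (continuousOn_id.pow 2))

lemma energy_nitscheMap_le (H : IsProfile R ρ γ) :
    energy (annulus (qFun ρ γ R) 1) (radial ρ) (nitscheMap R ρ γ) ≤
      ENNReal.ofReal (nitscheEnergy R ρ γ) := by
  refine (iInf₂_le _ H.hasWeakDiff_nitscheMap).trans (le_of_eq ?_)
  -- The energy density ρ²(F² + t²)/|z|² divided by the Jacobian Ft/|z|². The change of variables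
  -- moves the integral to the target, where it is radial.
  set φ : ℝ → ℝ≥0∞ := fun t =>
    ENNReal.ofReal (ρ t ^ 2 * (speed ρ γ t ^ 2 + t ^ 2) / (speed ρ γ t * t)) with hφ
  have hm := (isOpen_annulus (qFun ρ γ R) 1).measurableSet
  have hd := fun z hz => (H.hasFDerivAt_nitscheMap (z := z) hz).hasFDerivWithinAt
    (s := annulus (qFun ρ γ R) 1)
  have h1 := lintegral_image_eq_lintegral_abs_det_fderiv_mul volume hm hd
    H.bijOn_nitscheMap.injOn fun w => φ ‖w‖
  have hφm : AEMeasurable φ (volume.restrict (Ioo R 1)) := by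
    refine ENNReal.measurable_ofReal.comp_aemeasurable
      (ContinuousOn.aemeasurable ?_ measurableSet_Ioo)
    have hF := H.continuousOn_speed.mono Ioo_subset_Icc_self
    exact (((H.cont.mono Ioo_subset_Icc_self).pow 2).mul ((hF.pow 2).add (continuousOn_id.pow 2))).div
      (hF.mul continuousOn_id) fun t ht =>
      (mul_pos (H.speed_pos ht) (H.R_pos.trans ht.1)).ne'
  rw [H.bijOn_nitscheMap.image_eq, lintegral_annulus_comp_norm H.R_pos.le hφm] at h1
  have h2 : ∫⁻ t in Ioo R 1, ENNReal.ofReal t * φ t =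
      ENNReal.ofReal (∫ t in R..1, ρ t ^ 2 * (speed ρ γ t ^ 2 + t ^ 2) / speed ρ γ t) := by
    rw [intervalIntegral.integral_of_le H.R_lt.le, integral_Ioc_eq_integral_Ioo,
      ofReal_integral_eq_lintegral_ofReal]
    · refine setLIntegral_congr_fun measurableSet_Ioo fun t ht => ?_
      have ht0 : 0 < t := H.R_pos.trans ht.1
      have := (H.speed_pos ht).ne'
      simp only [hφ]
      rw [← ENNReal.ofReal_mul ht0.le]
      congr 1
      field_simp
    · exact (intervalIntegrable_iff_integrableOn_Ioo_of_le H.R_lt.le).1 H.intervalIntegrable_energy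
    · refine (ae_restrict_iff' measurableSet_Ioo).2 (ae_of_all _ fun t ht => ?_)
      have := H.speed_pos ht
      change 0 ≤ ρ t ^ 2 * (speed ρ γ t ^ 2 + t ^ 2) / speed ρ γ t
      positivity
  rw [nitscheEnergy, ENNReal.ofReal_mul (by positivity), ← h2, h1]
  refine setLIntegral_congr_fun hm fun z hz => ?_
  have hz0 := ne_zero_of_mem_annulus (qFun_pos R).le hz
  have hzn : 0 < ‖z‖ := norm_pos_iff.2 hz0
  have hp := H.pFun_mem hz
  have hp0 : 0 < pFun R ρ γ ‖z‖ := H.R_pos.trans hp.1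
  have hF := H.speed_pos hp
  simp only [hφ]
  rw [H.fderiv_nitscheMap hz, hsSq_radialDiff (norm_div_norm hz0), det_radialDiff (norm_div_norm hz0),
    radial, H.norm_nitscheMap hz, ← ENNReal.ofReal_mul (abs_nonneg _), abs_of_pos (by positivity)]
  congr 1
  field_simp

lemma isDeformation_nitscheMap (H : IsProfile R ρ γ) :
    IsDeformation (annulus (qFun ρ γ R) 1) (annulus R 1) (radial ρ) (nitscheMap R ρ γ) where
  mapsTo := fun z hz => subset_closure (H.mapsTo_nitscheMap hz)
  energy_lt_top := H.energy_nitscheMap_le.trans_lt ENNReal.ofReal_lt_top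
  jacobian := by
    have hm := (isOpen_annulus (qFun ρ γ R) 1).measurableSet
    refine ⟨_, H.hasWeakDiff_nitscheMap, (ae_restrict_iff' hm).2 (ae_of_all _ fun z hz =>
      (H.isDiffeo_nitscheMap.jacobian_pos z hz).le), le_of_eq ?_⟩
    have h1 := lintegral_image_eq_lintegral_abs_det_fderiv_mul volume hm
      (fun z hz => (H.hasFDerivAt_nitscheMap hz).differentiableAt.hasFDerivAt.hasFDerivWithinAt)
      H.bijOn_nitscheMap.injOn fun w => ENNReal.ofReal (radial ρ w ^ 2)
    rw [H.bijOn_nitscheMap.image_eq] at h1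
    rw [area, h1]
    refine setLIntegral_congr_fun hm fun z hz => ?_
    rw [abs_of_pos (H.isDiffeo_nitscheMap.jacobian_pos z hz), mul_comm,
      ENNReal.ofReal_mul (H.isDiffeo_nitscheMap.jacobian_pos z hz).le]
  approx := ⟨fun _ => nitscheMap R ρ γ, fun _ => H.isDiffeo_nitscheMap, fun K _ _ =>
    Metric.tendstoUniformlyOn_iff.2 fun ε hε =>
      Eventually.of_forall fun _ x _ => by rwa [dist_self],
    fun ε _ => Eventually.of_forall fun _ z _ => ⟨le_self_add, le_self_add⟩⟩

lemma isMinimizer_nitscheMap (H : IsProfile R ρ γ) :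
    IsMinimizer (annulus (qFun ρ γ R) 1) (annulus R 1) (radial ρ) (nitscheMap R ρ γ) :=
  ⟨H.isDeformation_nitscheMap, fun _ hg => H.energy_nitscheMap_le.trans (H.nitscheEnergy_le_energy hg)⟩

end IsProfile

/-! ### Quasiconformality -/

/-- The distortion inequality for a `C¹` map holds everywhere. -/
lemma IsQCWith.norm_sq_le {K : ℝ} {Ω Ω' : Set ℂ} {f : ℂ → ℂ} (hΩ : IsOpen Ω)
    (hf : ContDiffOn ℝ 1 f Ω) (h : IsQCWith K Ω Ω' f) {z : ℂ} (hz : z ∈ Ω) :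
    ‖fderiv ℝ f z‖ ^ 2 ≤ K * (fderiv ℝ f z).det := by
  obtain ⟨D, hD, hK⟩ := h.distortion
  have hc := hf.continuousOn_fderiv_of_isOpen hΩ le_rfl
  have hc1 : ContinuousOn (fun z => ‖fderiv ℝ f z‖ ^ 2) Ω := hc.norm.pow 2
  have hc2 : ContinuousOn (fun z => K * (fderiv ℝ f z).det) Ω := by
    simp only [det_eq]
    exact continuousOn_const.mul (Complex.continuous_im.comp_continuousOn
      ((Complex.continuous_conj.comp_continuousOn (hc.clm_apply continuousOn_const)).mul
        (hc.clm_apply continuousOn_const)))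
  -- The inequality a ≤ b is encoded as min a b = a, since an almost everywhere equality of
  -- continuous functions extends to the whole open set.
  have hae : (fun z => min (‖fderiv ℝ f z‖ ^ 2) (K * (fderiv ℝ f z).det))
      =ᵐ[volume.restrict Ω] fun z => ‖fderiv ℝ f z‖ ^ 2 := by
    filter_upwards [hK, hD.ae_eq hΩ (hasWeakDiff_fderiv hΩ hf)] with z h1 h2
    rw [h2] at h1
    exact min_eq_left h1
  exact min_eq_left_iff.1 (Measure.eqOn_open_of_ae_eq hae hΩ (hc1.inf hc2) hc1 hz)

namespace IsProfile

variable {R : ℝ} {ρ : ℝ → ℝ} {γ : ℝ}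

/-- The operator norm is max(F,t)/|z| and the determinant Ft/|z|², so the distortion is the larger
of F/t and t/F. -/
lemma isQCWith_nitscheMap (H : IsProfile R ρ γ) {K : ℝ} (hK : 1 ≤ K)
    (h₁ : ∀ t ∈ Ioo R 1, speed ρ γ t ≤ K * t) (h₂ : ∀ t ∈ Ioo R 1, t ≤ K * speed ρ γ t) :
    IsQCWith K (annulus (qFun ρ γ R) 1) (annulus R 1) (nitscheMap R ρ γ) where
  one_le := hK
  image_eq := H.bijOn_nitscheMap.image_eq
  isEmbedding := H.isEmbedding_nitscheMap
  distortion := by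
    refine ⟨_, H.hasWeakDiff_nitscheMap,
      (ae_restrict_iff' (isOpen_annulus _ _).measurableSet).2 (ae_of_all _ fun z hz => ?_)⟩
    have hz0 := ne_zero_of_mem_annulus (qFun_pos R).le hz
    have hzn : 0 < ‖z‖ := norm_pos_iff.2 hz0
    have hp := H.pFun_mem hz
    have hp0 : 0 < pFun R ρ γ ‖z‖ := H.R_pos.trans hp.1
    have hF := H.speed_pos hp
    have h3 := h₁ _ hp
    have h4 := h₂ _ hp
    rw [H.fderiv_nitscheMap hz, det_radialDiff (norm_div_norm hz0)]
    set t := pFun R ρ γ ‖z‖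
    set F := speed ρ γ t
    rcases le_total F t with h | h
    · have h5 := norm_radialDiff_le (norm_div_norm hz0) (A := F / ‖z‖) (B := t / ‖z‖)
        (M := t / ‖z‖) (by positivity) (by positivity) (by gcongr) le_rfl
      refine (pow_le_pow_left₀ (norm_nonneg _) h5 2).trans ?_
      calc (t / ‖z‖) ^ 2 = t / ‖z‖ * (t / ‖z‖) := sq _
        _ ≤ K * F / ‖z‖ * (t / ‖z‖) := by gcongr
        _ = _ := by ring
    · have h5 := norm_radialDiff_le (norm_div_norm hz0) (A := F / ‖z‖) (B := t / ‖z‖)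
        (M := F / ‖z‖) (by positivity) (by positivity) le_rfl (by gcongr)
      refine (pow_le_pow_left₀ (norm_nonneg _) h5 2).trans ?_
      calc (F / ‖z‖) ^ 2 = F / ‖z‖ * (F / ‖z‖) := sq _
        _ ≤ F / ‖z‖ * (K * t / ‖z‖) := by gcongr
        _ = _ := by ring

/-- The map takes no values of modulus R; the pointwise inequalities hold for every t in (R,1) and
extend to t = R by continuity of F. -/
lemma le_of_isQCWith (H : IsProfile R ρ γ) {K : ℝ}
    (hK : IsQCWith K (annulus (qFun ρ γ R) 1) (annulus R 1) (nitscheMap R ρ γ)) :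
    speed ρ γ R ≤ K * R ∧ R ≤ K * speed ρ γ R := by
  have key : ∀ t ∈ Ioo R 1, speed ρ γ t ≤ K * t ∧ t ≤ K * speed ρ γ t := fun t ht => by
    have hw : (t : ℂ) ∈ annulus R 1 := ofReal_mem_annulus H.R_pos.le ht
    obtain ⟨z, hz, hzt⟩ := H.bijOn_nitscheMap.surjOn hw
    have hz0 := ne_zero_of_mem_annulus (qFun_pos R).le hz
    have hzn : 0 < ‖z‖ := norm_pos_iff.2 hz0
    have ht0 : 0 < t := H.R_pos.trans ht.1
    have hF := H.speed_pos ht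
    have hpt : pFun R ρ γ ‖z‖ = t := by
      rw [← H.norm_nitscheMap hz, hzt, Complex.norm_real, Real.norm_of_nonneg ht0.le]
    have h := hK.norm_sq_le (isOpen_annulus _ _)
      (H.contDiffOn_nitscheMap.of_le ENat.LEInfty.out) hz
    rw [H.fderiv_nitscheMap hz, det_radialDiff (norm_div_norm hz0), hpt] at h
    obtain ⟨h1, h2⟩ := le_norm_radialDiff (norm_div_norm hz0) (speed ρ γ t / ‖z‖) (t / ‖z‖)
    have h3 := (pow_le_pow_left₀ (by positivity) h1 2).trans h
    have h4 := (pow_le_pow_left₀ (by positivity) h2 2).trans h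
    have e : K * (speed ρ γ t / ‖z‖ * (t / ‖z‖)) = K * speed ρ γ t * t / ‖z‖ ^ 2 := by
      field_simp
    rw [e, div_pow, div_le_div_iff_of_pos_right (by positivity)] at h3 h4
    constructor
    · exact le_of_mul_le_mul_left (by linarith) hF
    · exact le_of_mul_le_mul_left (by linarith) ht0
  have hcl : R ∈ closure (Ioo R 1) := by
    rw [closure_Ioo H.R_lt.ne]; exact left_mem_Icc.2 H.R_lt.le
  have hF : ContinuousOn (speed ρ γ) (closure (Ioo R 1)) := by
    rw [closure_Ioo H.R_lt.ne]; exact H.continuousOn_speed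
  exact ⟨le_on_closure (fun t ht => (key t ht).1) hF (by fun_prop) hcl,
    le_on_closure (fun t ht => (key t ht).2) continuousOn_id (continuousOn_const.mul hF) hcl⟩

lemma sq_mul_speed_left (H : IsProfile R ρ γ) :
    ρ R ^ 2 * speed ρ γ R ^ 2 = γ - gammaCrit R ρ := by
  rw [H.rho_sq_mul_speed_sq (left_mem_Icc.2 H.R_lt.le), gammaCrit]
  ring

lemma speed_left_pos (H : IsProfile R ρ γ) (hγ : gammaCrit R ρ < γ) : 0 < speed ρ γ R := by
  refine lt_of_le_of_ne (Real.sqrt_nonneg _) fun h => ?_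
  have := H.sq_mul_speed_left
  rw [← h] at this
  linarith

/-- At the critical parameter F(R) = 0, so a finite K would give R ≤ K · 0. -/
lemma not_isQC_nitscheMap (H : IsProfile R ρ γ) (hγ : γ = gammaCrit R ρ) :
    ¬ IsQC (annulus (qFun ρ γ R) 1) (annulus R 1) (nitscheMap R ρ γ) := by
  rintro ⟨K, hK⟩
  have h1 := (H.le_of_isQCWith hK).2
  have h2 := H.sq_mul_speed_left
  rw [hγ, sub_self, mul_eq_zero, or_iff_right (pow_ne_zero 2 H.pos_left.ne'),
    pow_eq_zero_iff two_ne_zero] at h2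
  rw [← hγ] at h2
  rw [h2, mul_zero] at h1
  exact h1.not_gt H.R_pos

lemma sqrt_ratio (H : IsProfile R ρ γ) :
    √((gammaCrit R ρ - γ) / gammaCrit R ρ) = speed ρ γ R / R ∧
    √(gammaCrit R ρ / (gammaCrit R ρ - γ)) = R / speed ρ γ R := by
  have hF : 0 ≤ speed ρ γ R := Real.sqrt_nonneg _
  have hR := H.R_pos
  have hρ := H.pos_left.ne'
  have e1 : gammaCrit R ρ - γ = -(ρ R ^ 2 * speed ρ γ R ^ 2) := by
    rw [H.sq_mul_speed_left]; ring
  rw [e1, gammaCrit, neg_div_neg_eq, neg_div_neg_eq, mul_comm (R ^ 2),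
    mul_div_mul_left _ _ (pow_ne_zero 2 hρ), mul_div_mul_left _ _ (pow_ne_zero 2 hρ), ← div_pow,
    ← div_pow]
  exact ⟨Real.sqrt_sq (by positivity), Real.sqrt_sq (by positivity)⟩

/-- The ratio (F/t)² = 1 + γ/(tρ)² lies between 1 and its value at R, because tρ(t) ≥ Rρ(R). So the
constant k that works at R works everywhere, and `le_of_isQCWith` shows that none smaller does. -/
lemma isLeast_isQCWith (H : IsProfile R ρ γ) (hγ : gammaCrit R ρ < γ) :
    IsLeast {K : ℝ | IsQCWith K (annulus (qFun ρ γ R) 1) (annulus R 1) (nitscheMap R ρ γ)}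
      (max (√((gammaCrit R ρ - γ) / gammaCrit R ρ)) (√(gammaCrit R ρ / (gammaCrit R ρ - γ)))) := by
  have hR := H.R_pos
  have hF := H.speed_left_pos hγ
  have hρ := H.pos_left
  rw [H.sqrt_ratio.1, H.sqrt_ratio.2]
  set k := max (speed ρ γ R / R) (R / speed ρ γ R) with hk
  have hk1 : speed ρ γ R / R ≤ k := le_max_left _ _
  have hk2 : R / speed ρ γ R ≤ k := le_max_right _ _
  have hone : 1 ≤ k := by
    rcases le_total (speed ρ γ R) R with h | h
    · exact ((one_le_div hF).2 h).trans hk2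
    · exact ((one_le_div hR).2 h).trans hk1
  have hk1' : speed ρ γ R ≤ k * R := (div_le_iff₀ hR).1 hk1
  have hk2' : R ≤ k * speed ρ γ R := (div_le_iff₀ hF).1 hk2
  have hcrit := H.sq_mul_speed_left
  rw [gammaCrit] at hcrit
  refine ⟨H.isQCWith_nitscheMap hone (fun t ht => ?_) fun t ht => ?_, fun K hK => ?_⟩
  · have ht0 : 0 < t := hR.trans ht.1
    have h1 := H.rho_sq_mul_speed_sq (Ioo_subset_Icc_self ht)
    have h2 := H.lower t (Ioo_subset_Icc_self ht)
    have h3 := H.pos (Ioo_subset_Icc_self ht)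
    have h4 : (R * ρ R) ^ 2 ≤ (t * ρ t) ^ 2 := pow_le_pow_left₀ (by positivity) h2 2
    have h5 := pow_le_pow_left₀ hF.le hk1' 2
    have h6 : 1 ≤ k ^ 2 := one_le_pow₀ hone
    have h7 : (ρ t * speed ρ γ t) ^ 2 ≤ (ρ t * (k * t)) ^ 2 := by
      -- The inequality F(R) ≤ kR, squared and multiplied by ρ(R)²; as k ≥ 1, Rρ(R) may then be
      -- replaced by the larger tρ(t).
      have h8 : γ ≤ (k ^ 2 - 1) * (R * ρ R) ^ 2 := by
        have := mul_le_mul_of_nonneg_left h5 (sq_nonneg (ρ R))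
        linarith
      have h9 := mul_le_mul_of_nonneg_left h4 (sub_nonneg.2 h6)
      linarith
    exact le_of_mul_le_mul_left
      (le_of_sq_le_sq h7 (by positivity)) h3
  · have ht0 : 0 < t := hR.trans ht.1
    have hFt := H.speed_pos ht
    have h1 := H.rho_sq_mul_speed_sq (Ioo_subset_Icc_self ht)
    have h2 := H.lower t (Ioo_subset_Icc_self ht)
    have h3 := H.pos (Ioo_subset_Icc_self ht)
    have h4 : (R * ρ R) ^ 2 ≤ (t * ρ t) ^ 2 := pow_le_pow_left₀ (by positivity) h2 2
    have h5 := pow_le_pow_left₀ hR.le hk2' 2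
    have h6 : 1 ≤ k ^ 2 := one_le_pow₀ hone
    have h7 : (ρ t * t) ^ 2 ≤ (ρ t * (k * speed ρ γ t)) ^ 2 := by
      have h8 : 0 ≤ (k ^ 2 - 1) * (R * ρ R) ^ 2 + k ^ 2 * γ := by
        have := mul_le_mul_of_nonneg_left h5 (sq_nonneg (ρ R))
        nlinarith
      have h9 := mul_le_mul_of_nonneg_left h4 (sub_nonneg.2 h6)
      have h10 : (ρ t * (k * speed ρ γ t)) ^ 2 = k ^ 2 * (t ^ 2 * ρ t ^ 2 + γ) := by
        rw [← h1]; ring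
      rw [h10]
      linarith
    exact le_of_mul_le_mul_left (le_of_sq_le_sq h7 (by positivity)) h3
  · obtain ⟨h1, h2⟩ := H.le_of_isQCWith hK
    exact max_le ((div_le_iff₀ hR).2 h1) ((div_le_iff₀ hF).2 h2)

/-! ### The critical modulus -/

lemma ofReal_modAnnulus (H : IsProfile R ρ γ) :
    ENNReal.ofReal (modAnnulus (qFun ρ γ R)) = qIntegral ρ γ R := by
  rw [modAnnulus, one_div, Real.log_inv, qFun, Real.log_exp, neg_neg, ENNReal.ofReal_toReal H.fin.ne]

lemma inv_ofReal_speed (H : IsProfile R ρ γ) {t : ℝ} (ht : t ∈ Ioo R 1) :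
    (ENNReal.ofReal (√(t ^ 2 + γ * (1 / ρ t) ^ 2)))⁻¹ =
      ENNReal.ofReal (ρ t) / ENNReal.ofReal (√(t ^ 2 * ρ t ^ 2 + γ)) := by
  have h3 := H.pos (Ioo_subset_Icc_self ht)
  change (ENNReal.ofReal (speed ρ γ t))⁻¹ = _
  rw [← H.rho_sq_mul_speed_sq (Ioo_subset_Icc_self ht), ← mul_pow,
    Real.sqrt_sq (mul_nonneg h3.le (H.speed_pos ht).le), ENNReal.ofReal_mul h3.le,
    div_eq_mul_inv, ENNReal.mul_inv (Or.inl (ENNReal.ofReal_pos.2 h3).ne')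
    (Or.inl ENNReal.ofReal_ne_top), ← mul_assoc, ENNReal.mul_inv_cancel
    (ENNReal.ofReal_pos.2 h3).ne' ENNReal.ofReal_ne_top, one_mul]

/-- The integrand ρ/√(t²ρ² + γ) strictly decreases in γ, and the smaller integral is finite, so
strictness survives integration even if τ_⋄ = ∞. Conversely γ ≥ γ_⋄ always holds, and equality would
make the two integrals equal. -/
lemma gammaCrit_lt_iff (H : IsProfile R ρ γ) :
    gammaCrit R ρ < γ ↔ ENNReal.ofReal (modAnnulus (qFun ρ γ R)) < tauCrit R ρ := by
  rw [H.ofReal_modAnnulus]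
  have hq : qIntegral ρ γ R =
      ∫⁻ t in Ioo R 1, ENNReal.ofReal (ρ t) / ENNReal.ofReal (√(t ^ 2 * ρ t ^ 2 + γ)) :=
    setLIntegral_congr_fun measurableSet_Ioo fun t ht => H.inv_ofReal_speed ht
  have hfin := H.fin.ne
  constructor
  · intro hγ
    rw [hq] at hfin ⊢
    refine lintegral_strict_mono ?_ ?_ hfin ?_
    · rw [Ne, Measure.restrict_eq_zero, Real.volume_Ioo, ENNReal.ofReal_eq_zero]
      linarith [H.R_lt]
    · have hρ := H.cont.mono Ioo_subset_Icc_self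
      refine AEMeasurable.div
        (ENNReal.measurable_ofReal.comp_aemeasurable (hρ.aemeasurable measurableSet_Ioo))
        (ENNReal.measurable_ofReal.comp_aemeasurable (ContinuousOn.aemeasurable ?_ measurableSet_Ioo))
      exact (((continuousOn_id.pow 2).mul (hρ.pow 2)).sub continuousOn_const).sqrt
    · refine (ae_restrict_iff' measurableSet_Ioo).2 (ae_of_all _ fun t ht => ?_)
      have htI := Ioo_subset_Icc_self ht
      have h1 : 0 < ρ t ^ 2 * speed ρ γ t ^ 2 := by
        have := H.pos htI
        have := H.speed_pos ht
        positivity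
      rw [H.rho_sq_mul_speed_sq htI] at h1
      refine ENNReal.div_lt_div_left (ENNReal.ofReal_pos.2 (H.pos htI)).ne' ENNReal.ofReal_ne_top
        ((ENNReal.ofReal_lt_ofReal_iff (Real.sqrt_pos.2 h1)).2 (Real.sqrt_lt_sqrt ?_ ?_))
      · have := pow_le_pow_left₀ (mul_pos H.R_pos H.pos_left).le (H.lower t htI) 2
        linarith
      · rw [gammaCrit] at hγ
        linarith
  · intro h
    refine lt_of_le_of_ne H.crit_le fun hγ => h.ne ?_
    rw [hq, tauCrit]
    simp only [← hγ, gammaCrit, ← sub_eq_add_neg]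

end IsProfile

end RadialNitsche

end

/-! ### The theorem -/

open RadialNitsche
theorem lemma9p4 (R : ℝ) (hR0 : 0 < R) (hR1 : R < 1) (ρ : ℝ → ℝ) (hρ : IsRegular R ρ)
    (γ : ℝ) (hγ : ∀ y ∈ Icc R 1, 0 ≤ y ^ 2 + γ * (1 / ρ y) ^ 2) (hfin : qIntegral ρ γ R < ⊤)
    (r : ℝ) (hr : r = qFun ρ γ R) :
    IsHarmonic (annulus r 1) (annulus R 1) (radial ρ) (nitscheMap R ρ γ) ∧
    ((IsMinimizer (annulus r 1) (annulus R 1) (radial ρ) (nitscheMap R ρ γ) ∧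
        IsQC (annulus r 1) (annulus R 1) (nitscheMap R ρ γ)) ↔ gammaCrit R ρ < γ) ∧
    (gammaCrit R ρ < γ ↔ ENNReal.ofReal (modAnnulus r) < tauCrit R ρ) ∧
    (γ = gammaCrit R ρ →
      IsMinimizer (annulus r 1) (annulus R 1) (radial ρ) (nitscheMap R ρ γ) ∧
      IsHarmonic (annulus r 1) (annulus R 1) (radial ρ) (nitscheMap R ρ γ) ∧
      ¬ IsQC (annulus r 1) (annulus R 1) (nitscheMap R ρ γ)) ∧
    (gammaCrit R ρ < γ →
      IsLeast {K : ℝ | IsQCWith K (annulus r 1) (annulus R 1) (nitscheMap R ρ γ)}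
        (max (√((gammaCrit R ρ - γ) / gammaCrit R ρ))
          (√(gammaCrit R ρ / (gammaCrit R ρ - γ))))) := by
  subst hr
  have H := hρ.isProfile hR0 hR1 hγ hfin
  refine ⟨H.isHarmonic_nitscheMap, ⟨fun ⟨_, hqc⟩ => ?_, fun h =>
    ⟨H.isMinimizer_nitscheMap, _, (H.isLeast_isQCWith h).1⟩⟩, H.gammaCrit_lt_iff,
    fun h => ⟨H.isMinimizer_nitscheMap, H.isHarmonic_nitscheMap, H.not_isQC_nitscheMap h⟩,
    H.isLeast_isQCWith⟩
  exact lt_of_le_of_ne H.crit_le fun h => H.not_isQC_nitscheMap h.symm hqc
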